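/- **Theorem 4.2.** *Nonuniformly expanding maps.* Let $(M,d_M)$ be a locally compact separable bounded metric space with a finite Borel measure $m$. A nonsingular map $T:M\to M$ for which $m$ is ergodic is *nonuniformly expanding* if there are a measurable set $Y\subset M$ with $m(Y)>0$, an at most countable measurable partition $\alpha$ of $Y$ (modulo $m$-null sets) with $m(A)>0$ for $A\in\alpha$, an $m$-integrable return time $\tau:Y\to\{1,2,\dots\}$ constant on each $A\in\alpha$, and constants $\lambda>1$, $\eta\in(0,1]$, $C_0,C_1\ge1$ such that, writing $F=T^{\tau}$, for each $A\in\alpha$ and all $x,y\in A$: 1. $F$ restricts to a measure-theoretic bijection from $A$ onto $Y$; 2. $d_M(Fx,Fy)\ge\lambda d_M(x,y)$; 3. $d_M(T^\ell x,T^\ell y)\le C_0\,d_M(Fx,Fy)$ for $0\le\ell<\tau(A)$; 4. $\zeta=\frac{dm|_Y}{dm|_Y\circ F}$ satisfies $|\log\zeta(x)-\log\zeta(y)|\le C_1 d_M(Fx,Fy)^\eta$. Let $\varepsilon_0>0$ and $p>1$. A family $T_\varepsilon:M\to M$, $\varepsilon\in[0,\varepsilon_0)$, is a *uniform family of nonuniformly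 expanding maps of order $p$* if each $T_\varepsilon$ is nonuniformly expanding, with data $Y_\varepsilon,\alpha_\varepsilon,\tau_\varepsilon$ and with constants $\lambda,\eta,C_0,C_1$ independent of $\varepsilon$, and $$\sup_{\varepsilon\in[0,\varepsilon_0)}\frac1{m(Y_\varepsilon)}\int_{Y_\varepsilon}\tau_\varepsilon^{\,p}\,dm<\infty .$$ (If $\inf_\varepsilon m(Y_\varepsilon)>0$, for instance if $Y_\varepsilon$ does not depend on $\varepsilon$, this is the same as $\sup_\varepsilon\int_{Y_\varepsilon}\tau_\varepsilon^{\,p}\,dm<\infty$.) *Order function.* Let $\nu_\varepsilon$ be the $T_\varepsilon$-invariant ergodic probability measure with $\nu_\varepsilon\ll m$. Use the maximum norm on $\mathbb R^d$ and on $d\times d$ matrices, fix $x_0\in\mathbb R^d$ and $L_1,L_2,L_3\ge1$, and put $E=\{x\in\mathbb R^d:|x-x_0|\le L_1\}$. For functions $g(x,y,\varepsilon)$ let $\|g\|_{\rm Lip}=|g|_\infty+\sup_\varepsilon{\rm Lip}\,g(\cdot,\cdot,\varepsilon)$, the Lipschitz constant being with respect to $|x-x'|+d_M(y,y')$. Let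 $a:\mathbb R^d\times M\times[0,\varepsilon_0)\to\mathbb R^d$ satisfy $\|a\|_{\rm Lip}\le L_1$, let $a$ be differentiable in $x$ at the points of $E$ with derivative $D a=\partial a/\partial x$ satisfying $\|Da|_E\|_{\rm Lip}\le L_2$, and let $\sup_{x\in E,\,y\in M}|a(x,y,\varepsilon)-a(x,y,0)|\le L_3\varepsilon$ for all $\varepsilon\in[0,\varepsilon_0)$. Put $v_{\varepsilon,x}(y)=a(x,y,\varepsilon)-\int_M a(x,\cdot,\varepsilon)\,d\nu_\varepsilon$ and $$\delta_\varepsilon=\sup_{x\in E}\sup_{1\le n\le1/\varepsilon}\varepsilon\Bigl|\sum_{j=0}^{n-1}v_{\varepsilon,x}\circ T_\varepsilon^j\Bigr|+\sup_{x\in E}\sup_{1\le n\le1/\varepsilon}\varepsilon\Bigl|\sum_{j=0}^{n-1}(Dv_{\varepsilon,x})\circ T_\varepsilon^j\Bigr|$$ (all $n\ge1$ are allowed if $\varepsilon=0$; a supremum over no $n$ is $0$). *Conclusion.* If $T_\varepsilon$ is a uniform family of nonuniformly expanding maps of order $p>1$, then there is a constant $C>0$ such that for all $\varepsilon\in[0,\varepsilon_0)$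 the function $\delta_\varepsilon^{\,p+d-1}$ is $\nu_\varepsilon$-integrable and $$\int_M\delta_\varepsilon^{\,p+d-1}\,d\nu_\varepsilon\le\begin{cases}C\varepsilon^{(p-1)/2},&p>2,\\ C\varepsilon^{(p-1)^2/p},&p\in(1,2].\end{cases}$$ -/

import Mathlib

open Set MeasureTheory Filter Topology
open scoped ENNReal NNReal

namespace FastSlow

section Expanding

variable {M : Type*} [MetricSpace M] [MeasurableSpace M]

/-- The induced map `F y = T^{τ(y)} y`. -/
def inducedMap (T : M → M) (τ : M → ℕ) (y : M) : M := T^[τ y] y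

/-- `Y`, `α`, `τ` form an inducing scheme for `T` with constants `lam`, `η`, `C₀`, `C₁`: `α` is an at
most countable measurable partition of `Y` (modulo `m`-null sets), the integrable return time `τ` is
constant on the elements of `α`, and `F = T^τ` satisfies the four expansion/distortion conditions.
(The values of `τ` off the partition elements are irrelevant.) -/
structure IsInducingScheme (m : Measure M) (T : M → M) (Y : Set M) (α : Set (Set M)) (τ : M → ℕ)
    (lam η C₀ C₁ : ℝ) : Prop where
  measurableSet_base : MeasurableSet Y
  base_pos : 0 < m Y
  countable : α.Countable
  measurableSet_elem : ∀ A ∈ α, MeasurableSet A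
  elem_subset : ∀ A ∈ α, A ⊆ Y
  elem_pos : ∀ A ∈ α, 0 < m A
  disjoint : α.PairwiseDisjoint id
  cover : m (Y \ ⋃₀ α) = 0
  one_le_time : ∀ A ∈ α, ∀ x ∈ A, 1 ≤ τ x
  time_const : ∀ A ∈ α, ∀ x ∈ A, ∀ y ∈ A, τ x = τ y
  time_integrable : IntegrableOn (fun x => (τ x : ℝ)) Y m
  /-- (1) `F` restricts to a measure-theoretic bijection from `A` onto `Y` (nonsingularity in both
  directions is part of the existence of the density in (4)). -/
  mapsTo : ∀ A ∈ α, MapsTo (inducedMap T τ) A Y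
  injOn : ∀ A ∈ α, InjOn (inducedMap T τ) A
  onto : ∀ A ∈ α, m (Y \ inducedMap T τ '' A) = 0
  /-- (2) expansion -/
  expand : ∀ A ∈ α, ∀ x ∈ A, ∀ y ∈ A,
    lam * dist x y ≤ dist (inducedMap T τ x) (inducedMap T τ y)
  /-- (3) control of the intermediate iterates -/
  intermediate : ∀ A ∈ α, ∀ x ∈ A, ∀ y ∈ A, ∀ l < τ x,
    dist (T^[l] x) (T^[l] y) ≤ C₀ * dist (inducedMap T τ x) (inducedMap T τ y)
  /-- (4) bounded distortion: `ζ = dm|_Y / (dm|_Y ∘ F)` is a positive density, that is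
  `m (F B) = ∫_B ζ⁻¹ dm` for measurable subsets `B` of partition elements. -/
  distortion : ∃ ζ : M → ℝ, Measurable ζ ∧ ∀ A ∈ α, (∀ x ∈ A, 0 < ζ x) ∧
    (∀ B, MeasurableSet B → B ⊆ A →
      m (inducedMap T τ '' B) = ∫⁻ x in B, ENNReal.ofReal (ζ x)⁻¹ ∂m) ∧
    ∀ x ∈ A, ∀ y ∈ A, |Real.log (ζ x) - Real.log (ζ y)| ≤
      C₁ * dist (inducedMap T τ x) (inducedMap T τ y) ^ η

/-- `T_ε`, `ε ∈ [0, ε₀)`, is a uniform family of nonuniformly expanding maps of order `p`: each `T_ε`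
is nonsingular, `m` is ergodic for it, and it has an inducing scheme `(Y_ε, α_ε, τ_ε)`, with constants
`lam`, `η`, `C₀`, `C₁` not depending on `ε` and return times bounded in `L^p` uniformly in `ε`.
The `L^p` norm on `Y_ε` is taken for the normalised measure `m|_{Y_ε} / m(Y_ε)`. -/
def IsUniformFamily (m : Measure M) (T : ℝ → M → M) (ε₀ p : ℝ) : Prop :=
  ∃ lam η C₀ C₁ : ℝ, ∃ K : ℝ≥0, 1 < lam ∧ 0 < η ∧ η ≤ 1 ∧ 1 ≤ C₀ ∧ 1 ≤ C₁ ∧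
    ∀ ε ∈ Ico 0 ε₀, QuasiErgodic (T ε) m ∧
      ∃ (Y : Set M) (α : Set (Set M)) (τ : M → ℕ),
        IsInducingScheme m (T ε) Y α τ lam η C₀ C₁ ∧
        ⨍⁻ x in Y, (τ x : ℝ≥0∞) ^ p ∂m ≤ K

end Expanding

section Averaging

variable {M : Type*} {d : ℕ}

/-- `‖g‖_Lip = |g|_∞ + sup_ε Lip g(·,·,ε)` for `g` restricted to `x ∈ E` and `ε ∈ [0, ε₀)`, as an
extended nonnegative number. -/
noncomputable def lipNorm [MetricSpace M] {F : Type*} [NormedAddCommGroup F]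
    (E : Set (Fin d → ℝ)) (ε₀ : ℝ) (g : (Fin d → ℝ) → M → ℝ → F) : ℝ≥0∞ :=
  (⨆ ε ∈ Ico 0 ε₀, ⨆ x ∈ E, ⨆ y : M, ‖g x y ε‖ₑ) +
  ⨆ ε ∈ Ico 0 ε₀, ⨆ x ∈ E, ⨆ x' ∈ E, ⨆ y : M, ⨆ y' : M,
    ‖g x y ε - g x' y' ε‖ₑ / (edist x x' + edist y y')

/-- The Jacobian matrix of `g : ℝ^d → ℝ^d` at `x`; as a function of two indices it carries the maximum
norm. -/
noncomputable def jac (g : (Fin d → ℝ) → (Fin d → ℝ)) (x : Fin d → ℝ) : Fin d → Fin d → ℝ :=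
  fun i j => fderiv ℝ g x (Pi.single j 1) i

/-- The regularity assumptions on `a : ℝ^d × M × [0, ε₀) → ℝ^d`. Here `ℝ^d = Fin d → ℝ` has the maximum
norm and `E = {x : |x - x₀| ≤ L₁}` is `Metric.closedBall x₀ L₁`. -/
structure IsRegular [MetricSpace M] (a : (Fin d → ℝ) → M → ℝ → (Fin d → ℝ)) (x₀ : Fin d → ℝ)
    (ε₀ L₁ L₂ L₃ : ℝ) : Prop where
  lip : lipNorm univ ε₀ a ≤ ENNReal.ofReal L₁
  differentiableAt : ∀ ε ∈ Ico 0 ε₀, ∀ y, ∀ x ∈ Metric.closedBall x₀ L₁,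
    DifferentiableAt ℝ (fun x' => a x' y ε) x
  lip_deriv : lipNorm (Metric.closedBall x₀ L₁) ε₀ (fun x y ε => jac (fun x' => a x' y ε) x)
    ≤ ENNReal.ofReal L₂
  param : ∀ ε ∈ Ico 0 ε₀, ∀ x ∈ Metric.closedBall x₀ L₁, ∀ y, ‖a x y ε - a x y 0‖ ≤ L₃ * ε

variable [MeasurableSpace M]

/-- `v_{ε,x}(y) = a(x,y,ε) - ∫ a(x,·,ε) dν_ε`. -/
noncomputable def centred (a : (Fin d → ℝ) → M → ℝ → (Fin d → ℝ)) (ν : ℝ → Measure M) (ε : ℝ)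
    (x : Fin d → ℝ) (y : M) : Fin d → ℝ :=
  a x y ε - ∫ z, a x z ε ∂(ν ε)

/-- `δ_{1,ε}(y) = sup_{x ∈ E} sup_{1 ≤ n ≤ 1/ε} ε |∑_{j<n} v_{ε,x}(T_ε^j y)|`. The condition `n ≤ 1/ε`
is written `ε n ≤ 1`; all `n ≥ 1` are allowed for `ε = 0`, and the supremum is `0` if there is no such
`n`. -/
noncomputable def order₁ (a : (Fin d → ℝ) → M → ℝ → (Fin d → ℝ)) (T : ℝ → M → M)
    (ν : ℝ → Measure M) (E : Set (Fin d → ℝ)) (ε : ℝ) (y : M) : ℝ :=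
  sSup {r : ℝ | ∃ x ∈ E, ∃ n : ℕ, 1 ≤ n ∧ ε * n ≤ 1 ∧
    r = ε * ‖∑ j ∈ Finset.range n, centred a ν ε x ((T ε)^[j] y)‖}

/-- `δ_{2,ε}(y) = sup_{x ∈ E} sup_{1 ≤ n ≤ 1/ε} ε |∑_{j<n} (D v_{ε,x})(T_ε^j y)|`, `D = ∂/∂x`. -/
noncomputable def order₂ (a : (Fin d → ℝ) → M → ℝ → (Fin d → ℝ)) (T : ℝ → M → M)
    (ν : ℝ → Measure M) (E : Set (Fin d → ℝ)) (ε : ℝ) (y : M) : ℝ :=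
  sSup {r : ℝ | ∃ x ∈ E, ∃ n : ℕ, 1 ≤ n ∧ ε * n ≤ 1 ∧
    r = ε * ‖∑ j ∈ Finset.range n, jac (fun x' => centred a ν ε x' ((T ε)^[j] y)) x‖}

/-- The order function `δ_ε = δ_{1,ε} + δ_{2,ε}`. -/
noncomputable def orderFunction (a : (Fin d → ℝ) → M → ℝ → (Fin d → ℝ)) (T : ℝ → M → M)
    (ν : ℝ → Measure M) (E : Set (Fin d → ℝ)) (ε : ℝ) (y : M) : ℝ :=
  order₁ a T ν E ε y + order₂ a T ν E ε y

end Averaging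

end FastSlow

/-! Fix the slow variable `x`. A mean-zero Lipschitz observable `v` on `M` is summed over one return
to give the induced observable `V`, with `|V| ≤ H τ`. The induced map `F` has full branches with
bounded distortion, so its transfer operator preserves a cone of log-Lipschitz functions.
Subtracting a fixed fraction of the integral after each application stays in the cone, so the
operator forgets its argument exponentially fast, with a rate depending only on `lam`, `η`, `C₁` and
the diameter bound (`IsFullBranch.isLogLip_transfer_sub`,
`IsFullBranch.abs_iterate_transfer_sub_le`). This yields an `F`-invariant probability `σ` with
density bounded above and below on a set of full base measure, and a decomposition `V = φ + χ ∘ F -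
χ` with `χ` bounded almost everywhere and `φ` a reverse martingale difference in `L^p`
(`IsFullBranch.exists_coboundary`, `IsInducingScheme.exists_induced_system`).

A Burkholder-type moment bound and Doob's inequality, both obtained from one-step pointwise
inequalities, bound the `p`-th moment of the maximal sum of `N` terms by a constant times `N ^ κ`,
where `κ = max (p / 2) 1` (`exists_integral_tailMax_rpow_le`).

By ergodicity the projection of the tower over `σ` is a multiple of `ν`. Integrating over a fibre of
the tower brings in a factor `τ`, so Young's inequality leaves only moments of order `p - 1`,
bounded by `N ^ (κ (p - 1) / p)` (`exists_maxBirkhoff_moment_bound`). With `N = ⌊1 / ε⌋` and the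
prefactor `ε ^ (p - 1)` this is the rate `ε ^ ((1 - κ / p) (p - 1))`, which is the pair of exponents
in the conclusion.

The supremum over `x` costs `d` powers. The maximal function is Lipschitz in `x`, so if its supremum
is `s` it exceeds `s / 4` on a ball of radius comparable to `s`. Hence `s ^ (p - 1 + d)` is bounded
by a constant times the integral over `x` of its `(p - 1)`-th power, and Tonelli reduces to fixed
`x` (`lintegral_iSup_rpow_le`). The argument runs coordinatewise for the centred field and for its
Jacobian. -/

namespace FastSlow

/-! ### Pointwise inequalities behind the moment and maximal bounds -/

section SignedPower

/-- The odd extension of `t ↦ t ^ r` from `[0, ∞)` to `ℝ`. -/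
noncomputable def signedPow (r t : ℝ) : ℝ := if 0 ≤ t then t ^ r else -(-t) ^ r

lemma measurable_signedPow (r : ℝ) : Measurable (signedPow r) :=
  Measurable.ite measurableSet_Ici (by fun_prop) (by fun_prop)

lemma abs_signedPow (r t : ℝ) : |signedPow r t| = |t| ^ r := by
  unfold signedPow
  split_ifs with h
  · rw [abs_of_nonneg (Real.rpow_nonneg h r), abs_of_nonneg h]
  · rw [abs_neg, abs_of_nonneg (Real.rpow_nonneg (by linarith) r), abs_of_neg (by linarith)]

lemma rpow_sub_one_mul_self {p t : ℝ} (hp : 1 < p) (ht : 0 ≤ t) : t ^ (p - 1) * t = t ^ p := by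
  rcases ht.eq_or_lt with h0 | h0
  · rw [← h0, Real.zero_rpow (zero_lt_one.trans hp).ne', mul_zero]
  · rw [Real.rpow_sub_one h0.ne']; field_simp

/-- Convexity of the power function, from Bernoulli's inequality at the ratio `b / a`. -/
lemma rpow_tangent_le {p a b : ℝ} (hp : 1 < p) (ha : 0 ≤ a) (hb : 0 ≤ b) :
    a ^ p + p * a ^ (p - 1) * (b - a) ≤ b ^ p := by
  rcases ha.eq_or_lt with rfl | ha
  · rw [Real.zero_rpow (by linarith), Real.zero_rpow (by linarith)]
    simpa using Real.rpow_nonneg hb p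
  · have h := one_add_mul_self_le_rpow_one_add (s := b / a - 1) (by linarith [div_nonneg hb ha.le]) hp.le
    have h1 : 1 + (b / a - 1) = b / a := by ring
    rw [h1, Real.div_rpow hb ha.le, le_div_iff₀ (Real.rpow_pos_of_pos ha p)] at h
    have h2 : a ^ p = a ^ (p - 1) * a := by
      rw [Real.rpow_sub_one ha.ne']; field_simp
    calc _ = (1 + p * (b / a - 1)) * a ^ p := by rw [h2]; field_simp
      _ ≤ _ := h

lemma abs_rpow_tangent_le {p a b : ℝ} (hp : 1 < p) :
    |a| ^ p + p * signedPow (p - 1) a * (b - a) ≤ |b| ^ p := by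
  have h := rpow_tangent_le hp (abs_nonneg a) (abs_nonneg b)
  refine le_trans ?_ h
  unfold signedPow
  split_ifs with h0
  · rw [abs_of_nonneg h0]
    have := Real.rpow_nonneg h0 (p - 1)
    gcongr
    exact le_abs_self b
  · rw [abs_of_neg (not_le.1 h0)]
    have : 0 ≤ (-a) ^ (p - 1) := Real.rpow_nonneg (by linarith) (p - 1)
    have h3 : 0 ≤ p * (-a) ^ (p - 1) * (|b| + b) :=
      mul_nonneg (mul_nonneg (by linarith) this) (by linarith [neg_abs_le b])
    nlinarith

/-- For equal signs this is subadditivity of `t ^ r`, with constant `1`; the factor `2` is needed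
when `a` and `b` have opposite signs. -/
lemma abs_signedPow_sub_le_of_le_one {r : ℝ} (hr : 0 < r) (hr1 : r ≤ 1) (a b : ℝ) :
    |signedPow r a - signedPow r b| ≤ 2 * |a - b| ^ r := by
  have key : ∀ a b : ℝ, 0 ≤ a → 0 ≤ b → |a ^ r - b ^ r| ≤ 2 * |a - b| ^ r := by
    intro a b ha hb
    wlog hab : b ≤ a generalizing a b
    · rw [abs_sub_comm, abs_sub_comm a b]; exact this b a hb ha (by linarith)
    have h := Real.rpow_add_le_add_rpow (p := r) (sub_nonneg.2 hab) hb hr.le hr1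
    have h1 := Real.rpow_le_rpow hb hab hr.le
    have h2 := Real.rpow_nonneg (sub_nonneg.2 hab) r
    rw [sub_add_cancel] at h
    rw [abs_of_nonneg (by linarith), abs_of_nonneg (by linarith)]
    linarith
  have key2 : ∀ a b : ℝ, 0 ≤ a → 0 ≤ b → a ^ r + b ^ r ≤ 2 * (a + b) ^ r := by
    intro a b ha hb
    have h1 : a ^ r ≤ (a + b) ^ r := Real.rpow_le_rpow ha (by linarith) hr.le
    have h2 : b ^ r ≤ (a + b) ^ r := Real.rpow_le_rpow hb (by linarith) hr.le
    linarith
  unfold signedPow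
  split_ifs with h1 h2 h2
  · exact key a b h1 h2
  · rw [sub_neg_eq_add, abs_of_nonneg (add_nonneg (Real.rpow_nonneg h1 r)
      (Real.rpow_nonneg (by linarith) r)), abs_of_nonneg (by linarith : 0 ≤ a - b)]
    exact key2 a (-b) h1 (by linarith)
  · have h3 := Real.rpow_nonneg h2 r
    have h4 : 0 ≤ (-a) ^ r := Real.rpow_nonneg (by linarith) r
    rw [← abs_neg, abs_of_nonneg (by linarith), abs_of_neg (by linarith : a - b < 0)]
    have := key2 (-a) b (by linarith) h2
    rw [show -(a - b) = -a + b by ring]; linarith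
  · have := key (-a) (-b) (by linarith) (by linarith)
    rw [← abs_neg, ← abs_neg (a - b)]
    rw [show -(-(-a) ^ r - -(-b) ^ r) = (-a) ^ r - (-b) ^ r by ring, show -(a - b) = -a - -b by ring]
    exact this

lemma abs_signedPow_sub_le_of_one_lt {r : ℝ} (hr : 1 < r) (a b : ℝ) :
    |signedPow r a - signedPow r b| ≤ r * |a - b| * max |a| |b| ^ (r - 1) := by
  have key : ∀ a b : ℝ, 0 ≤ a → 0 ≤ b → |a ^ r - b ^ r| ≤ r * |a - b| * max a b ^ (r - 1) := by
    intro a b ha hb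
    wlog hab : b ≤ a generalizing a b
    · rw [abs_sub_comm, abs_sub_comm a b, max_comm]; exact this b a hb ha (by linarith)
    have h := rpow_tangent_le hr ha hb
    have h1 := Real.rpow_le_rpow hb hab (by linarith : 0 ≤ r)
    rw [abs_of_nonneg (by linarith), abs_of_nonneg (by linarith), max_eq_left hab]
    linarith
  have key2 : ∀ a b : ℝ, 0 ≤ a → 0 ≤ b → a ^ r + b ^ r ≤ r * (a + b) * max a b ^ (r - 1) := by
    have h0 : ∀ a b : ℝ, 0 ≤ a → 0 ≤ b → a ^ r ≤ a * max a b ^ (r - 1) := by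
      intro a b ha hb
      rcases ha.eq_or_lt with rfl | ha
      · rw [Real.zero_rpow (by linarith), zero_mul]
      · rw [show a ^ r = a * a ^ (r - 1) by rw [Real.rpow_sub_one ha.ne']; field_simp]
        refine mul_le_mul_of_nonneg_left ?_ ha.le
        exact Real.rpow_le_rpow ha.le (le_max_left a b) (by linarith)
    intro a b ha hb
    have h1 := h0 a b ha hb
    have h2 := h0 b a hb ha
    rw [max_comm] at h2
    have h3 : 0 ≤ (a + b) * max a b ^ (r - 1) :=
      mul_nonneg (by linarith) (Real.rpow_nonneg (ha.trans (le_max_left a b)) _)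
    nlinarith
  unfold signedPow
  split_ifs with h1 h2 h2
  · rw [abs_of_nonneg h1, abs_of_nonneg h2]; exact key a b h1 h2
  · rw [sub_neg_eq_add, abs_of_nonneg (add_nonneg (Real.rpow_nonneg h1 r)
      (Real.rpow_nonneg (by linarith) r)), abs_of_nonneg (by linarith : 0 ≤ a - b),
      abs_of_nonneg h1, abs_of_neg (not_le.1 h2)]
    exact key2 a (-b) h1 (by linarith)
  · have h3 := Real.rpow_nonneg h2 r
    have h4 : 0 ≤ (-a) ^ r := Real.rpow_nonneg (by linarith) r
    rw [← abs_neg, abs_of_nonneg (by linarith), abs_of_neg (by linarith : a - b < 0),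
      abs_of_nonneg h2, abs_of_neg (not_le.1 h1)]
    have := key2 (-a) b (by linarith) h2
    rw [show -(a - b) = -a + b by ring]; linarith
  · have := key (-a) (-b) (by linarith) (by linarith)
    rw [abs_of_neg (not_le.1 h1), abs_of_neg (not_le.1 h2), ← abs_neg, ← abs_neg (a - b)]
    rw [show -(-(-a) ^ r - -(-b) ^ r) = (-a) ^ r - (-b) ^ r by ring, show -(a - b) = -a - -b by ring]
    exact this

/-- The tangent inequality is taken at `s + x`, which gives an upper bound. Its slope is then
replaced by the slope at `s`, so that the linear term has a coefficient depending on `s` only and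
can be orthogonal to `x`. -/
lemma abs_add_rpow_le_aux {p : ℝ} (hp : 1 < p) (s x : ℝ) :
    |s + x| ^ p ≤ |s| ^ p + p * signedPow (p - 1) s * x
      + p * (|signedPow (p - 1) (s + x) - signedPow (p - 1) s| * |x|) := by
  have h := abs_rpow_tangent_le (a := s + x) (b := s) hp
  rw [← abs_mul]
  have h2 := le_abs_self ((signedPow (p - 1) (s + x) - signedPow (p - 1) s) * x)
  nlinarith

/-- The exponent governing the growth of `p`-th moments of sums of `n` martingale differences. -/
noncomputable def momentExponent (p : ℝ) : ℝ := max (p / 2) 1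

/-- The remainder is of size `x² (|s| + |x|) ^ (p - 2)`. When `|s|` exceeds a multiple of `√n |x|`
it is absorbed into `n⁻¹ |s| ^ p`; otherwise it is at most a multiple of `n ^ (p / 2 - 1) |x| ^ p`.
-/
lemma abs_add_rpow_le_of_two_lt {p : ℝ} (hp : 2 < p) {n : ℝ} (hn : 1 ≤ n) (s x : ℝ) :
    p * (|signedPow (p - 1) (s + x) - signedPow (p - 1) s| * |x|) ≤ n⁻¹ * |s| ^ p +
      p ^ 2 * (2 * (p * 2 ^ p)) ^ (p - 2) * n ^ (p / 2 - 1) * |x| ^ p := by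
  have h0 := abs_signedPow_sub_le_of_one_lt (r := p - 1) (by linarith) (s + x) s
  rw [add_sub_cancel_left, show p - 1 - 1 = p - 2 by ring] at h0
  have hmax : max |s + x| |s| ≤ |s| + |x| :=
    max_le (abs_add_le s x) (by linarith [abs_nonneg x])
  have h1 : p * (|signedPow (p - 1) (s + x) - signedPow (p - 1) s| * |x|) ≤
      p ^ 2 * (|x| ^ 2 * (|s| + |x|) ^ (p - 2)) := by
    calc _ ≤ p * (((p - 1) * |x| * max |s + x| |s| ^ (p - 2)) * |x|) := by gcongr
      _ ≤ p * ((p * |x| * (|s| + |x|) ^ (p - 2)) * |x|) := by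
          gcongr
          linarith
      _ = _ := by ring
  refine h1.trans ?_
  -- Large enough that `p ^ 2 * 2 ^ (p - 2) ≤ c ^ 2`, which makes the absorbed coefficient at most
  -- `1`.
  set c : ℝ := p * 2 ^ p with hc
  have h2p : (1 : ℝ) ≤ 2 ^ p := Real.one_le_rpow (by norm_num) (by linarith)
  have hc1 : 1 ≤ c := by nlinarith
  have hpow : ∀ t : ℝ, 0 ≤ t → t ^ 2 * t ^ (p - 2) = t ^ p := by
    intro t ht
    rcases ht.eq_or_lt with rfl | ht
    · rw [Real.zero_rpow (by linarith), Real.zero_rpow (by linarith)]; ring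
    · rw [← Real.rpow_natCast, ← Real.rpow_add ht]; congr 1; push_cast; ring
  set A : ℝ := c * Real.sqrt n with hA
  have hsn : 1 ≤ Real.sqrt n := Real.one_le_sqrt.2 hn
  have hA1 : 1 ≤ A := by nlinarith
  have hn0 : 0 < n := by linarith
  have hsqn : Real.sqrt n ^ (p - 2) = n ^ (p / 2 - 1) := by
    rw [Real.sqrt_eq_rpow, ← Real.rpow_mul hn0.le]; congr 1; ring
  rcases le_total |s| (A * |x|) with hle | hle
  · have h2 : |s| + |x| ≤ 2 * A * |x| := by nlinarith [abs_nonneg x]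
    have h3 : (|s| + |x|) ^ (p - 2) ≤ (2 * A * |x|) ^ (p - 2) :=
      Real.rpow_le_rpow (by positivity) h2 (by linarith)
    have h4 : (2 * A * |x|) ^ (p - 2) = (2 * c) ^ (p - 2) * n ^ (p / 2 - 1) * |x| ^ (p - 2) := by
      rw [Real.mul_rpow (by positivity) (abs_nonneg x), hA, ← mul_assoc 2 c,
        Real.mul_rpow (by positivity) (by positivity), hsqn]
    calc p ^ 2 * (|x| ^ 2 * (|s| + |x|) ^ (p - 2))
        ≤ p ^ 2 * (|x| ^ 2 * ((2 * c) ^ (p - 2) * n ^ (p / 2 - 1) * |x| ^ (p - 2))) := by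
          rw [← h4]; gcongr
      _ = p ^ 2 * (2 * c) ^ (p - 2) * n ^ (p / 2 - 1) * (|x| ^ 2 * |x| ^ (p - 2)) := by ring
      _ = p ^ 2 * (2 * c) ^ (p - 2) * n ^ (p / 2 - 1) * |x| ^ p := by rw [hpow _ (abs_nonneg x)]
      _ ≤ _ := by
          have : 0 ≤ n⁻¹ * |s| ^ p := by positivity
          linarith
  · have h2 : |s| + |x| ≤ 2 * |s| := by nlinarith [abs_nonneg x]
    have h3 : (|s| + |x|) ^ (p - 2) ≤ (2 * |s|) ^ (p - 2) :=
      Real.rpow_le_rpow (by positivity) h2 (by linarith)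
    have h5 : |x| ^ 2 ≤ |s| ^ 2 / (c ^ 2 * n) := by
      rw [le_div_iff₀ (by positivity)]
      have : (A * |x|) ^ 2 ≤ |s| ^ 2 := by gcongr
      rw [hA, mul_pow, mul_pow, Real.sq_sqrt hn0.le] at this
      linarith
    have h6 : (2 : ℝ) ^ (p - 2) ≤ 2 ^ p := Real.rpow_le_rpow_of_exponent_le (by norm_num) (by linarith)
    calc p ^ 2 * (|x| ^ 2 * (|s| + |x|) ^ (p - 2))
        ≤ p ^ 2 * (|s| ^ 2 / (c ^ 2 * n) * (2 * |s|) ^ (p - 2)) := by gcongr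
      _ = p ^ 2 * 2 ^ (p - 2) / c ^ 2 * (n⁻¹ * (|s| ^ 2 * |s| ^ (p - 2))) := by
          rw [Real.mul_rpow (by norm_num) (abs_nonneg s)]; field_simp
      _ = p ^ 2 * 2 ^ (p - 2) / c ^ 2 * (n⁻¹ * |s| ^ p) := by rw [hpow _ (abs_nonneg s)]
      _ ≤ 1 * (n⁻¹ * |s| ^ p) := by
          gcongr
          rw [div_le_one (by positivity), hc, mul_pow]
          gcongr
          nlinarith
      _ ≤ _ := by
          have : 0 ≤ p ^ 2 * (2 * c) ^ (p - 2) * n ^ (p / 2 - 1) * |x| ^ p := by positivity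
          linarith

/-- Designed for iteration `n` times: the factor `1 + n⁻¹` compounds to at most `e`, the linear term
integrates to zero, and `n` copies of the last term add up to order `n ^ momentExponent p`. -/
lemma exists_abs_add_rpow_le {p : ℝ} (hp : 1 < p) : ∃ C : ℝ, 0 < C ∧ ∀ n : ℝ, 1 ≤ n → ∀ s x : ℝ,
    |s + x| ^ p ≤ (1 + n⁻¹) * |s| ^ p + p * (signedPow (p - 1) s * x)
      + C * n ^ (momentExponent p - 1) * |x| ^ p := by
  rcases le_or_gt p 2 with h2 | h2
  · refine ⟨2 * p, by linarith, fun n hn s x => ?_⟩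
    have h := abs_add_rpow_le_aux hp s x
    have h1 := abs_signedPow_sub_le_of_le_one (r := p - 1) (by linarith) (by linarith) (s + x) s
    rw [add_sub_cancel_left] at h1
    have h3 : |x| ^ (p - 1) * |x| = |x| ^ p := rpow_sub_one_mul_self hp (abs_nonneg x)
    have h4 : p * (|signedPow (p - 1) (s + x) - signedPow (p - 1) s| * |x|) ≤ 2 * p * |x| ^ p := by
      calc _ ≤ p * (2 * |x| ^ (p - 1) * |x|) := by gcongr
        _ = 2 * p * (|x| ^ (p - 1) * |x|) := by ring
        _ = _ := by rw [h3]
    have h5 : momentExponent p - 1 = 0 := by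
      rw [momentExponent, max_eq_right (by linarith)]; ring
    rw [h5, Real.rpow_zero]
    have h6 : 0 ≤ n⁻¹ * |s| ^ p := by positivity
    linarith
  · refine ⟨p ^ 2 * (2 * (p * 2 ^ p)) ^ (p - 2), by positivity, fun n hn s x => ?_⟩
    have h := abs_add_rpow_le_aux hp s x
    have h1 := abs_add_rpow_le_of_two_lt h2 hn s x
    rw [momentExponent, max_eq_left (by linarith)]
    linarith

/-- One step of the Bellman function `(p - 1) m ^ p - p m ^ (p - 1) |s|` for Doob's inequality. -/
lemma doob_bellman_step {p : ℝ} (hp : 1 < p) {s x m : ℝ} (hm : 0 ≤ m) :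
    (p - 1) * max |s + x| m ^ p - p * (max |s + x| m ^ (p - 1) * |s + x|) ≤
      (p - 1) * m ^ p - p * (m ^ (p - 1) * |s|) - p * (m ^ (p - 1) * signedPow 0 s * x) := by
  have hsgn : |s| + signedPow 0 s * x ≤ |s + x| := by
    unfold signedPow
    split_ifs with h
    · rw [abs_of_nonneg h]; simpa using le_abs_self (s + x)
    · rw [abs_of_neg (not_le.1 h)]; simpa using (by linarith [neg_abs_le (s + x)] : -s + -x ≤ |s + x|)
  have hmp : 0 ≤ m ^ (p - 1) := Real.rpow_nonneg hm _
  -- For fixed `t = |s + x|` the function `M ↦ (p - 1) M ^ p - p M ^ (p - 1) t` is minimal at `M =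
  -- t`, so raising the running maximum from `m` to `t` lowers it; this is the tangent inequality at
  -- `m`.
  have h1 : (p - 1) * max |s + x| m ^ p - p * (max |s + x| m ^ (p - 1) * |s + x|) ≤
      (p - 1) * m ^ p - p * (m ^ (p - 1) * |s + x|) := by
    rcases le_total |s + x| m with h | h
    · rw [max_eq_right h]
    · rw [max_eq_left h]
      have h2 := rpow_tangent_le hp hm (abs_nonneg (s + x))
      have h3 : ∀ t : ℝ, 0 ≤ t → t ^ (p - 1) * t = t ^ p := fun t => rpow_sub_one_mul_self hp
      rw [h3 _ (abs_nonneg _)]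
      nlinarith [h3 m hm]
  have h2 := mul_le_mul_of_nonneg_left hsgn (mul_nonneg (by linarith : 0 ≤ p) hmp)
  nlinarith

lemma exists_doob_young {p : ℝ} (hp : 1 < p) : ∃ C : ℝ, 0 < C ∧ ∀ m s : ℝ, 0 ≤ m → 0 ≤ s →
    p * (m ^ (p - 1) * s) ≤ (p - 1) / 2 * m ^ p + C * s ^ p := by
  -- The threshold at which `p * s` equals `(p - 1) / 2 * m`; above it the product is absorbed in
  -- the `m ^ p` term.
  set c : ℝ := 2 * p / (p - 1) with hc
  have hp1 : 0 < p - 1 := by linarith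
  have hc0 : 0 < c := by positivity
  refine ⟨p * c ^ (p - 1), by positivity, fun m s hm hs => ?_⟩
  have h3 : ∀ t : ℝ, 0 ≤ t → t ^ (p - 1) * t = t ^ p := fun t => rpow_sub_one_mul_self hp
  have hmp : 0 ≤ m ^ (p - 1) := Real.rpow_nonneg hm _
  have hm' : 0 ≤ m ^ p := Real.rpow_nonneg hm _
  have hs' : 0 ≤ s ^ p := Real.rpow_nonneg hs _
  rcases le_total (c * s) m with h | h
  · have : p * s ≤ (p - 1) / 2 * m := by
      have := mul_le_mul_of_nonneg_left h (by linarith : 0 ≤ (p - 1) / 2)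
      have h4 : (p - 1) / 2 * (c * s) = p * s := by rw [hc]; field_simp
      linarith
    have h5 := mul_le_mul_of_nonneg_left this hmp
    have h6 := h3 m hm
    have : 0 ≤ p * c ^ (p - 1) * s ^ p := by positivity
    nlinarith
  · have h4 : m ^ (p - 1) ≤ (c * s) ^ (p - 1) := Real.rpow_le_rpow hm h hp1.le
    rw [Real.mul_rpow hc0.le hs] at h4
    have h5 : m ^ (p - 1) * s ≤ c ^ (p - 1) * s ^ p := by
      rw [← h3 s hs, ← mul_assoc]; gcongr
    have : 0 ≤ (p - 1) / 2 * m ^ p := by positivity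
    nlinarith

end SignedPower

/-! ### Moment and maximal inequalities for reverse martingale differences -/

section ReverseMartingale

lemma abs_add_rpow_le_two {p : ℝ} (hp : 0 ≤ p) (a b : ℝ) :
    |a + b| ^ p ≤ 2 ^ p * (|a| ^ p + |b| ^ p) := by
  have h1 : |a + b| ≤ 2 * max |a| |b| :=
    (abs_add_le a b).trans (by linarith [le_max_left |a| |b|, le_max_right |a| |b|])
  calc |a + b| ^ p ≤ (2 * max |a| |b|) ^ p := Real.rpow_le_rpow (abs_nonneg _) h1 hp
    _ = 2 ^ p * max |a| |b| ^ p :=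
        Real.mul_rpow (by norm_num) ((abs_nonneg a).trans (le_max_left _ _))
    _ ≤ _ := by
        gcongr
        rcases max_choice |a| |b| with h | h <;> rw [h]
        · linarith [Real.rpow_nonneg (abs_nonneg b) p]
        · linarith [Real.rpow_nonneg (abs_nonneg a) p]

lemma rpow_sub_one_mul_le {p a b : ℝ} (hp : 1 < p) (ha : 0 ≤ a) (hb : 0 ≤ b) :
    a ^ (p - 1) * b ≤ a ^ p + b ^ p := by
  rcases le_total a b with h | h
  · have h1 : a ^ (p - 1) ≤ b ^ (p - 1) := Real.rpow_le_rpow ha h (by linarith)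
    have h2 := mul_le_mul_of_nonneg_right h1 hb
    rw [rpow_sub_one_mul_self hp hb] at h2
    linarith [Real.rpow_nonneg ha p]
  · have h2 := mul_le_mul_of_nonneg_left h (Real.rpow_nonneg ha (p - 1))
    rw [rpow_sub_one_mul_self hp ha] at h2
    linarith [Real.rpow_nonneg hb p]

variable {Ω : Type*} {F : Ω → Ω} {φ : Ω → ℝ} {p : ℝ}

/-- `max_{k ≤ n} |∑_{k ≤ j < n} φ (F^j y)|`. -/
noncomputable def tailMax (F : Ω → Ω) (φ : Ω → ℝ) : ℕ → Ω → ℝ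
  | 0 => fun _ => 0
  | n + 1 => fun y => max |birkhoffSum F φ (n + 1) y| (tailMax F φ n (F y))

lemma tailMax_nonneg (n : ℕ) (y : Ω) : 0 ≤ tailMax F φ n y := by
  cases n with
  | zero => exact le_rfl
  | succ n => exact (abs_nonneg _).trans (le_max_left _ _)

lemma abs_birkhoffSum_le_tailMax (n : ℕ) (y : Ω) : |birkhoffSum F φ n y| ≤ tailMax F φ n y := by
  cases n with
  | zero => simp [tailMax]
  | succ n => exact le_max_left _ _

lemma abs_birkhoffSum_iterate_le_tailMax (k n : ℕ) (y : Ω) :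
    |birkhoffSum F φ n (F^[k] y)| ≤ tailMax F φ (k + n) y := by
  induction k generalizing y with
  | zero => simpa using abs_birkhoffSum_le_tailMax n y
  | succ k ih =>
    rw [Function.iterate_succ_apply, Nat.add_right_comm]
    exact (ih (F y)).trans (le_max_right _ _)

/-- An initial sum is the full sum minus a tail. Tails are the natural object here: prepending `φ y`
to a function of `F y` is a martingale step, whereas appending a term to an initial sum is not. -/
lemma abs_birkhoffSum_le_two_mul_tailMax {k n : ℕ} (hkn : k ≤ n) (y : Ω) :
    |birkhoffSum F φ k y| ≤ 2 * tailMax F φ n y := by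
  obtain ⟨l, rfl⟩ := Nat.exists_eq_add_of_le hkn
  have h1 := abs_birkhoffSum_le_tailMax (F := F) (φ := φ) (k + l) y
  have h2 := abs_birkhoffSum_iterate_le_tailMax (F := F) (φ := φ) k l y
  have h3 : birkhoffSum F φ k y = birkhoffSum F φ (k + l) y - birkhoffSum F φ l (F^[k] y) := by
    rw [birkhoffSum_add]; ring
  rw [h3]
  exact (abs_sub _ _).trans (by linarith)

variable [MeasurableSpace Ω] {μ : Measure Ω}

lemma integrable_abs_add_rpow (hp : 0 ≤ p) {f g : Ω → ℝ} (hf : Measurable f) (hg : Measurable g)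
    (hfi : Integrable (fun y => |f y| ^ p) μ) (hgi : Integrable (fun y => |g y| ^ p) μ) :
    Integrable (fun y => |f y + g y| ^ p) μ := by
  refine ((hfi.add hgi).const_mul (2 ^ p)).mono' ((hf.add hg).abs.pow_const p).aestronglyMeasurable
    (ae_of_all _ fun y => ?_)
  rw [Real.norm_of_nonneg (Real.rpow_nonneg (abs_nonneg _) p)]
  exact abs_add_rpow_le_two hp _ _

/-- Hölder pairing of `L^(p/(p-1))` with `L^p`, through `a ^ (p - 1) * b ≤ a ^ p + b ^ p`. -/
lemma integrable_of_abs_le_rpow_sub_one (hp : 1 < p) {w s x : Ω → ℝ} (hw : Measurable w)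
    (hx : Measurable x) (hws : ∀ y, |w y| ≤ |s y| ^ (p - 1))
    (hsi : Integrable (fun y => |s y| ^ p) μ) (hxi : Integrable (fun y => |x y| ^ p) μ) :
    Integrable (fun y => w y * x y) μ := by
  refine (hsi.add hxi).mono' (by fun_prop) (ae_of_all _ fun y => ?_)
  rw [Real.norm_eq_abs, abs_mul]
  exact (mul_le_mul_of_nonneg_right (hws y) (abs_nonneg _)).trans
    (rpow_sub_one_mul_le hp (abs_nonneg _) (abs_nonneg _))

lemma measurable_birkhoffSum (hF : Measurable F) (hφ : Measurable φ) (n : ℕ) :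
    Measurable (birkhoffSum F φ n) :=
  Finset.measurable_fun_sum _ fun k _ => hφ.comp (hF.iterate k)

lemma measurable_tailMax (hF : Measurable F) (hφ : Measurable φ) (n : ℕ) :
    Measurable (tailMax F φ n) := by
  induction n with
  | zero => exact measurable_const
  | succ n ih =>
    exact (measurable_birkhoffSum hF hφ (n + 1)).abs.max (ih.comp hF)

lemma integrable_birkhoffSum_rpow (hp : 1 < p) (hF : MeasurePreserving F μ μ) (hφ : Measurable φ)
    (hφp : Integrable (fun y => |φ y| ^ p) μ) (n : ℕ) :
    Integrable (fun y => |birkhoffSum F φ n y| ^ p) μ := by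
  induction n with
  | zero => simp [Real.zero_rpow (by linarith : p ≠ 0)]
  | succ n ih =>
    simp_rw [birkhoffSum_succ']
    exact integrable_abs_add_rpow (by linarith) hφ
      ((measurable_birkhoffSum hF.measurable hφ n).comp hF.measurable) hφp
      (hF.integrable_comp_of_integrable ih)

lemma integrable_tailMax_rpow (hp : 1 < p) (hF : MeasurePreserving F μ μ) (hφ : Measurable φ)
    (hφp : Integrable (fun y => |φ y| ^ p) μ) (n : ℕ) :
    Integrable (fun y => tailMax F φ n y ^ p) μ := by
  induction n with
  | zero => simp [tailMax, Real.zero_rpow (by linarith : p ≠ 0)]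
  | succ n ih =>
    refine ((integrable_birkhoffSum_rpow hp hF hφ hφp (n + 1)).add
      (hF.integrable_comp_of_integrable ih)).mono'
      ((measurable_tailMax hF.measurable hφ (n + 1)).pow_const p).aestronglyMeasurable
      (ae_of_all _ fun y => ?_)
    rw [Real.norm_of_nonneg (Real.rpow_nonneg (tailMax_nonneg _ _) p)]
    have h1 := Real.rpow_nonneg (abs_nonneg (birkhoffSum F φ (n + 1) y)) p
    have h2 := Real.rpow_nonneg (tailMax_nonneg (F := F) (φ := φ) n (F y)) p
    simp only [Pi.add_apply, Function.comp_apply]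
    change max _ _ ^ p ≤ _
    rcases max_choice |birkhoffSum F φ (n + 1) y| (tailMax F φ n (F y)) with h | h <;> rw [h] <;>
      linarith

/-- The `L^p` moments of sums of reverse martingale differences. -/
lemma exists_integral_birkhoffSum_rpow_le (hp : 1 < p) : ∃ C : ℝ, 0 < C ∧
    ∀ {Ω : Type*} [MeasurableSpace Ω] {μ : Measure Ω} {F : Ω → Ω} {φ : Ω → ℝ},
      MeasurePreserving F μ μ → Measurable φ → Integrable (fun y => |φ y| ^ p) μ →
      (∀ w : Ω → ℝ, Measurable w → Integrable (fun y => w (F y) * φ y) μ →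
        ∫ y, w (F y) * φ y ∂μ = 0) → ∀ N : ℕ, 1 ≤ N →
      ∫ y, |birkhoffSum F φ N y| ^ p ∂μ ≤ C * N ^ momentExponent p * ∫ y, |φ y| ^ p ∂μ := by
  obtain ⟨C, hC, hstep⟩ := exists_abs_add_rpow_le hp
  refine ⟨3 * C, by positivity, ?_⟩
  intro Ω _ μ F φ hF hφ hφp horth N hN
  have hN1 : (1 : ℝ) ≤ N := by exact_mod_cast hN
  set A := ∫ y, |φ y| ^ p ∂μ with hA
  have hA0 : 0 ≤ A := integral_nonneg fun y => by positivity
  set B := C * (N : ℝ) ^ (momentExponent p - 1) with hB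
  have hB0 : 0 ≤ B := by positivity
  -- The weight `N⁻¹` is fixed throughout the induction on `n`. Since `S_{n+1} = φ + S_n ∘ F`, the
  -- coefficient of the linear term is a function of `F y`, and orthogonality removes it.
  have hind : ∀ n : ℕ, ∫ y, |birkhoffSum F φ n y| ^ p ∂μ ≤ (1 + (N : ℝ)⁻¹) ^ n * (n * (B * A)) := by
    intro n
    induction n with
    | zero => simp [Real.zero_rpow (by linarith : p ≠ 0)]
    | succ n ih =>
      set s : Ω → ℝ := birkhoffSum F φ n with hs
      have hsm : Measurable s := measurable_birkhoffSum hF.measurable hφ n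
      have hsi := integrable_birkhoffSum_rpow hp hF hφ hφp n
      have hsi' : Integrable (fun y => |s (F y)| ^ p) μ := hF.integrable_comp_of_integrable hsi
      have hsI : ∫ y, |s (F y)| ^ p ∂μ = ∫ y, |s y| ^ p ∂μ := by
        rw [← integral_map (f := fun z => |s z| ^ p) hF.aemeasurable
          (hsm.abs.pow_const p).aestronglyMeasurable, hF.map_eq]
      have hw : Integrable (fun y => signedPow (p - 1) (s (F y)) * φ y) μ :=
        integrable_of_abs_le_rpow_sub_one hp
          ((measurable_signedPow _).comp (hsm.comp hF.measurable)) hφ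
          (fun y => (abs_signedPow _ _).le) hsi' hφp
      have h0 : ∫ y, signedPow (p - 1) (s (F y)) * φ y ∂μ = 0 :=
        horth (fun z => signedPow (p - 1) (s z)) ((measurable_signedPow _).comp hsm) hw
      have h1 : ∫ y, |birkhoffSum F φ (n + 1) y| ^ p ∂μ ≤
          ∫ y, ((1 + (N : ℝ)⁻¹) * |s (F y)| ^ p + p * (signedPow (p - 1) (s (F y)) * φ y)
            + B * |φ y| ^ p) ∂μ := by
        refine integral_mono (integrable_birkhoffSum_rpow hp hF hφ hφp (n + 1))
          (((hsi'.const_mul _).add (hw.const_mul p)).add (hφp.const_mul B)) fun y => ?_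
        simp only [birkhoffSum_succ']
        rw [add_comm (φ y)]
        exact hstep N hN1 _ _
      have hi : Integrable (fun y => (1 + (N : ℝ)⁻¹) * |s (F y)| ^ p
          + p * (signedPow (p - 1) (s (F y)) * φ y)) μ := (hsi'.const_mul _).add (hw.const_mul p)
      rw [integral_add hi (hφp.const_mul B), integral_add (hsi'.const_mul _) (hw.const_mul p), integral_const_mul, integral_const_mul,
        integral_const_mul, h0, hsI, ← hA] at h1
      have hN0 : (0 : ℝ) ≤ (N : ℝ)⁻¹ := by positivity
      have h2 : (1 : ℝ) ≤ (1 + (N : ℝ)⁻¹) ^ (n + 1) := one_le_pow₀ (by linarith)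
      calc _ ≤ _ := h1
        _ ≤ (1 + (N : ℝ)⁻¹) * ((1 + (N : ℝ)⁻¹) ^ n * (n * (B * A))) + p * 0
            + (1 + (N : ℝ)⁻¹) ^ (n + 1) * (B * A) := by
            have : B * A ≤ (1 + (N : ℝ)⁻¹) ^ (n + 1) * (B * A) :=
              le_mul_of_one_le_left (by positivity) h2
            gcongr
        _ = _ := by push_cast; ring
  have hexp : (1 + (N : ℝ)⁻¹) ^ N ≤ 3 := by
    calc (1 + (N : ℝ)⁻¹) ^ N ≤ (Real.exp (N : ℝ)⁻¹) ^ N := by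
          gcongr
          rw [add_comm]; exact Real.add_one_le_exp _
      _ = Real.exp 1 := by
          rw [← Real.exp_nat_mul, mul_inv_cancel₀ (by positivity)]
      _ ≤ 3 := by linarith [Real.exp_one_lt_d9]
  calc _ ≤ _ := hind N
    _ ≤ 3 * (N * (B * A)) := by gcongr
    _ = 3 * C * (N * (N : ℝ) ^ (momentExponent p - 1)) * A := by rw [hB]; ring
    _ = _ := by
        rw [Real.rpow_sub_one (by positivity)]; field_simp

/-- The `L^p` maximal inequality for reverse martingale differences. -/
theorem exists_integral_tailMax_rpow_le (hp : 1 < p) : ∃ C : ℝ, 0 < C ∧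
    ∀ {Ω : Type*} [MeasurableSpace Ω] {μ : Measure Ω} {F : Ω → Ω} {φ : Ω → ℝ},
      MeasurePreserving F μ μ → Measurable φ → Integrable (fun y => |φ y| ^ p) μ →
      (∀ w : Ω → ℝ, Measurable w → Integrable (fun y => w (F y) * φ y) μ →
        ∫ y, w (F y) * φ y ∂μ = 0) → ∀ N : ℕ, 1 ≤ N →
      ∫ y, tailMax F φ N y ^ p ∂μ ≤ C * N ^ momentExponent p * ∫ y, |φ y| ^ p ∂μ := by
  obtain ⟨C, hC, hmom⟩ := exists_integral_birkhoffSum_rpow_le hp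
  obtain ⟨K, hK, hyoung⟩ := exists_doob_young hp
  have hp1 : 0 < p - 1 := by linarith
  refine ⟨2 * K / (p - 1) * C, by positivity, ?_⟩
  intro Ω _ μ F φ hF hφ hφp horth N hN
  have hSi := integrable_birkhoffSum_rpow hp hF hφ hφp
  have hDi := integrable_tailMax_rpow hp hF hφ hφp
  have hSm := measurable_birkhoffSum hF.measurable hφ
  have hDm := measurable_tailMax hF.measurable hφ
  have hDi' : ∀ n, Integrable (fun y => |tailMax F φ n y| ^ p) μ := fun n => by
    simpa only [abs_of_nonneg (tailMax_nonneg _ _)] using hDi n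
  have hDS : ∀ n, Integrable (fun y => tailMax F φ n y ^ (p - 1) * |birkhoffSum F φ n y|) μ :=
    fun n => integrable_of_abs_le_rpow_sub_one hp ((hDm n).pow_const _) (hSm n).abs
      (fun y => by
        rw [abs_of_nonneg (Real.rpow_nonneg (tailMax_nonneg _ _) _),
          abs_of_nonneg (tailMax_nonneg _ _)])
      (hDi' n) (by simpa only [abs_abs] using hSi n)
  -- The integral of the Bellman function starts at `0` and does not increase with `n`. Young's
  -- inequality then absorbs half of the `tailMax` term.
  have hW : ∀ n : ℕ, ∫ y, ((p - 1) * tailMax F φ n y ^ p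
      - p * (tailMax F φ n y ^ (p - 1) * |birkhoffSum F φ n y|)) ∂μ ≤ 0 := by
    intro n
    induction n with
    | zero => simp [tailMax, Real.zero_rpow (by linarith : p ≠ 0)]
    | succ n ih =>
      set W : Ω → ℝ := fun z => (p - 1) * tailMax F φ n z ^ p
        - p * (tailMax F φ n z ^ (p - 1) * |birkhoffSum F φ n z|) with hWdef
      have hWi : Integrable W μ := ((hDi n).const_mul _).sub ((hDS n).const_mul _)
      have hWm : Measurable W := by
        have := hDm n
        have := hSm n
        fun_prop
      have hWF : ∫ y, W (F y) ∂μ = ∫ y, W y ∂μ := by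
        rw [← integral_map (f := W) hF.aemeasurable hWm.aestronglyMeasurable, hF.map_eq]
      set w : Ω → ℝ := fun z => tailMax F φ n z ^ (p - 1) * signedPow 0 (birkhoffSum F φ n z)
      have hwm : Measurable w := ((hDm n).pow_const _).mul ((measurable_signedPow 0).comp (hSm n))
      have hwi : Integrable (fun y => w (F y) * φ y) μ := by
        refine integrable_of_abs_le_rpow_sub_one hp (hwm.comp hF.measurable) hφ
          (s := fun y => tailMax F φ n (F y)) (fun y => ?_)
          (hF.integrable_comp_of_integrable (hDi' n)) hφp
        simp only [w]
        rw [abs_mul, abs_signedPow, Real.rpow_zero, mul_one,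
          abs_of_nonneg (Real.rpow_nonneg (tailMax_nonneg _ _) _),
          abs_of_nonneg (tailMax_nonneg _ _)]
      have hWi' : Integrable (fun y => W (F y)) μ := hF.integrable_comp_of_integrable hWi
      calc _ ≤ ∫ y, (W (F y) - p * (w (F y) * φ y)) ∂μ := by
            refine integral_mono (((hDi (n + 1)).const_mul _).sub ((hDS (n + 1)).const_mul _))
              (hWi'.sub (hwi.const_mul p)) fun y => ?_
            have h := doob_bellman_step hp (s := birkhoffSum F φ n (F y)) (x := φ y)
              (tailMax_nonneg (F := F) (φ := φ) n (F y))
            simp only [tailMax, birkhoffSum_succ']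
            rw [add_comm (φ y)]
            exact h
        _ = ∫ y, W y ∂μ := by
            rw [integral_sub hWi' (hwi.const_mul p), integral_const_mul, horth w hwm hwi, hWF]
            ring
        _ ≤ 0 := ih
  have h1 := hW N
  rw [integral_sub ((hDi N).const_mul _) ((hDS N).const_mul _), integral_const_mul,
    integral_const_mul] at h1
  have h2 : p * ∫ y, tailMax F φ N y ^ (p - 1) * |birkhoffSum F φ N y| ∂μ ≤
      (p - 1) / 2 * ∫ y, tailMax F φ N y ^ p ∂μ + K * ∫ y, |birkhoffSum F φ N y| ^ p ∂μ := by
    rw [← integral_const_mul, ← integral_const_mul, ← integral_const_mul,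
      ← integral_add ((hDi N).const_mul _) ((hSi N).const_mul _)]
    exact integral_mono ((hDS N).const_mul _) (((hDi N).const_mul _).add ((hSi N).const_mul _))
      fun y => hyoung _ _ (tailMax_nonneg _ _) (abs_nonneg _)
  have h3 := hmom hF hφ hφp horth N hN
  have h4 : (p - 1) / 2 * ∫ y, tailMax F φ N y ^ p ∂μ ≤
      K * (C * N ^ momentExponent p * ∫ y, |φ y| ^ p ∂μ) := by
    have := mul_le_mul_of_nonneg_left h3 hK.le
    linarith
  calc ∫ y, tailMax F φ N y ^ p ∂μ
      = 2 / (p - 1) * ((p - 1) / 2 * ∫ y, tailMax F φ N y ^ p ∂μ) := by field_simp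
    _ ≤ 2 / (p - 1) * (K * (C * N ^ momentExponent p * ∫ y, |φ y| ^ p ∂μ)) := by gcongr
    _ = _ := by ring

end ReverseMartingale

/-! ### Cone contraction for the transfer operator of a full-branch map -/

section FullBranch

variable {M : Type*} {ι : Type*}

/-- The transfer operator `u ↦ ∑ᵢ gᵢ · (u ∘ sᵢ)` of a system with inverse branches `sᵢ` and
weights `gᵢ`. -/
noncomputable def transfer (s : ι → M → M) (g : ι → M → ℝ) (u : M → ℝ) (y : M) : ℝ :=
  ∑' i, g i y * u (s i y)

/-- A full-branch map `F` with inverse branches `sᵢ` defined on a set `Z` of full measure, inverse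
Jacobians `gᵢ` with bounded distortion, and a bounded gauge `ρ` contracted by the branches. -/
structure IsFullBranch [MeasurableSpace M] (μ : Measure M) (F : M → M) (Z : Set M)
    (s : ι → M → M) (g : ι → M → ℝ) (ρ : M → M → ℝ) (θ C₁ R : ℝ) : Prop where
  measurableSet : MeasurableSet Z
  ae_mem : ∀ᵐ y ∂μ, y ∈ Z
  measurable_map : Measurable F
  measurable_branch : ∀ i, Measurable (s i)
  measurable_weight : ∀ i, Measurable (g i)
  branch_mem : ∀ i, ∀ y ∈ Z, s i y ∈ Z
  map_branch : ∀ i, ∀ y ∈ Z, F (s i y) = y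
  weight_nonneg : ∀ i y, 0 ≤ g i y
  weight_eq_zero : ∀ i, ∀ y ∉ Z, g i y = 0
  sum_eq : Measure.sum (fun i => (μ.withDensity fun y => ENNReal.ofReal (g i y)).map (s i)) = μ
  gauge_nonneg : ∀ y y', 0 ≤ ρ y y'
  gauge_symm : ∀ y y', ρ y y' = ρ y' y
  gauge_le : ∀ y y', ρ y y' ≤ R
  gauge_branch : ∀ i, ∀ y ∈ Z, ∀ y' ∈ Z, ρ (s i y) (s i y') ≤ θ * ρ y y'
  weight_le : ∀ i, ∀ y ∈ Z, ∀ y' ∈ Z, g i y ≤ g i y' * Real.exp (C₁ * ρ y y')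
  contraction_nonneg : 0 ≤ θ
  contraction_lt_one : θ < 1
  distortion_pos : 0 < C₁

/-- Nonnegative functions whose logarithm is `b`-Lipschitz on `Z` with respect to `ρ`. -/
structure IsLogLip [MeasurableSpace M] (Z : Set M) (ρ : M → M → ℝ) (b : ℝ) (u : M → ℝ) : Prop where
  measurable : Measurable u
  nonneg : ∀ y ∈ Z, 0 ≤ u y
  le_mul_exp : ∀ y ∈ Z, ∀ y' ∈ Z, u y ≤ u y' * Real.exp (b * ρ y y')

/-- Measurable functions that are bounded on `Z`. -/
def IsBddMeas [MeasurableSpace M] (Z : Set M) (u : M → ℝ) : Prop :=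
  Measurable u ∧ ∃ B, ∀ y ∈ Z, |u y| ≤ B

/-- The log-Lipschitz constant of the cone preserved by the transfer operator. -/
noncomputable def coneConst (θ C₁ : ℝ) : ℝ := 2 * C₁ / (1 - θ)

/-- The gap of the contraction of the transfer operator. -/
noncomputable def gapConst (θ C₁ R : ℝ) : ℝ := (1 - θ) / 2 * Real.exp (-(coneConst θ C₁ * R))

/-- Convexity of `exp` between `0` and `t / (1 - c)` with weights `c` and `1 - c`. Consequently,
removing a constant of relative size at most `k` from a log-Lipschitz function inflates its constant
by at most `1 / (1 - k)`. -/
lemma exp_sub_le {t c k : ℝ} (ht : 0 ≤ t) (hc : 0 ≤ c) (hk : k < 1) (hck : c ≤ k) :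
    Real.exp t - c ≤ (1 - c) * Real.exp (t / (1 - k)) := by
  have h1 : (1 - c) * Real.exp (t / (1 - c)) ≤ (1 - c) * Real.exp (t / (1 - k)) := by
    have : 0 < 1 - k := by linarith
    have : 0 ≤ 1 - c := by linarith
    gcongr
  have h2 := convexOn_exp.2 (mem_univ (0 : ℝ)) (mem_univ (t / (1 - c))) hc
    (by linarith : 0 ≤ 1 - c) (by ring)
  have h3 : c • (0 : ℝ) + (1 - c) • (t / (1 - c)) = t := by
    have : 1 - c ≠ 0 := by linarith
    simp only [smul_eq_mul]
    field_simp
    ring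
  rw [h3, Real.exp_zero, smul_eq_mul, smul_eq_mul] at h2
  linarith

variable [MeasurableSpace M] {μ : Measure M} {F : M → M} {Z : Set M}
  {s : ι → M → M} {g : ι → M → ℝ} {ρ : M → M → ℝ} {θ C₁ R : ℝ}

lemma IsBddMeas.add {u w : M → ℝ} (hu : IsBddMeas Z u) (hw : IsBddMeas Z w) :
    IsBddMeas Z (u + w) := by
  obtain ⟨hum, B, hB⟩ := hu
  obtain ⟨hwm, B', hB'⟩ := hw
  exact ⟨hum.add hwm, B + B', fun y hy => (abs_add_le _ _).trans (add_le_add (hB y hy) (hB' y hy))⟩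

lemma IsBddMeas.sub {u w : M → ℝ} (hu : IsBddMeas Z u) (hw : IsBddMeas Z w) :
    IsBddMeas Z (u - w) := by
  obtain ⟨hum, B, hB⟩ := hu
  obtain ⟨hwm, B', hB'⟩ := hw
  exact ⟨hum.sub hwm, B + B', fun y hy => (abs_sub _ _).trans (add_le_add (hB y hy) (hB' y hy))⟩

lemma isBddMeas_const (c : ℝ) : IsBddMeas Z (fun _ => c) :=
  ⟨measurable_const, |c|, fun _ _ => le_rfl⟩

namespace IsFullBranch

variable (h : IsFullBranch μ F Z s g ρ θ C₁ R)
include h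

lemma coneConst_pos : 0 < coneConst θ C₁ :=
  div_pos (mul_pos two_pos h.distortion_pos) (by linarith [h.contraction_lt_one])

/-- `coneConst` is chosen to make this true: one application of the operator shrinks the cone
constant by the factor `(1 + θ) / 2`, and the slack pays for a later subtraction. -/
lemma add_mul_coneConst : C₁ + coneConst θ C₁ * θ = coneConst θ C₁ * ((1 + θ) / 2) := by
  have : 1 - θ ≠ 0 := by linarith [h.contraction_lt_one]
  unfold coneConst
  field_simp
  ring

lemma add_mul_coneConst_le : C₁ + coneConst θ C₁ * θ ≤ coneConst θ C₁ := by
  rw [h.add_mul_coneConst]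
  nlinarith [h.coneConst_pos, h.contraction_lt_one]

lemma gapConst_pos : 0 < gapConst θ C₁ R :=
  mul_pos (by linarith [h.contraction_lt_one]) (Real.exp_pos _)

variable [IsProbabilityMeasure μ]

lemma nonempty : Z.Nonempty := h.ae_mem.exists

lemma gauge_bound_nonneg : 0 ≤ R := by
  obtain ⟨y, -⟩ := h.nonempty
  exact (h.gauge_nonneg y y).trans (h.gauge_le y y)

lemma gapConst_lt_one : gapConst θ C₁ R < 1 := by
  have h1 : Real.exp (-(coneConst θ C₁ * R)) ≤ 1 := by
    rw [Real.exp_le_one_iff]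
    nlinarith [h.coneConst_pos, h.gauge_bound_nonneg]
  unfold gapConst
  nlinarith [h.contraction_lt_one, h.contraction_nonneg, Real.exp_pos (-(coneConst θ C₁ * R))]

lemma integrable_of_isBddMeas {u : M → ℝ} (hu : IsBddMeas Z u) : Integrable u μ := by
  obtain ⟨hum, B, hB⟩ := hu
  exact Integrable.of_bound hum.aestronglyMeasurable B (h.ae_mem.mono hB)

lemma isBddMeas_of_isLogLip {b : ℝ} (hb : 0 ≤ b) {u : M → ℝ} (hu : IsLogLip Z ρ b u) :
    IsBddMeas Z u := by
  obtain ⟨y', hy'⟩ := h.nonempty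
  refine ⟨hu.measurable, u y' * Real.exp (b * R), fun y hy => ?_⟩
  rw [abs_of_nonneg (hu.nonneg y hy)]
  have := hu.nonneg y' hy'
  have := h.gauge_le y y'
  exact (hu.le_mul_exp y hy y' hy').trans (by gcongr)

lemma le_exp_mul_integral {b : ℝ} (hb : 0 ≤ b) {u : M → ℝ} (hu : IsLogLip Z ρ b u) {y : M}
    (hy : y ∈ Z) : u y ≤ Real.exp (b * R) * ∫ z, u z ∂μ := by
  have hi := h.integrable_of_isBddMeas (h.isBddMeas_of_isLogLip hb hu)
  have h1 : ∫ _, u y ∂μ ≤ ∫ z, Real.exp (b * R) * u z ∂μ := by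
    refine integral_mono_ae (integrable_const _) (hi.const_mul _) (h.ae_mem.mono fun z hz => ?_)
    have := hu.nonneg z hz
    have := h.gauge_le y z
    change u y ≤ Real.exp (b * R) * u z
    rw [mul_comm]
    exact (hu.le_mul_exp y hy z hz).trans (by gcongr)
  simpa [integral_const_mul] using h1

lemma exp_neg_mul_integral_le {b : ℝ} (hb : 0 ≤ b) {u : M → ℝ} (hu : IsLogLip Z ρ b u) {y : M}
    (hy : y ∈ Z) : Real.exp (-(b * R)) * ∫ z, u z ∂μ ≤ u y := by
  have hi := h.integrable_of_isBddMeas (h.isBddMeas_of_isLogLip hb hu)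
  have h1 : ∫ z, u z ∂μ ≤ ∫ _, Real.exp (b * R) * u y ∂μ := by
    refine integral_mono_ae hi (integrable_const _) (h.ae_mem.mono fun z hz => ?_)
    have := hu.nonneg y hy
    have := h.gauge_le z y
    change u z ≤ Real.exp (b * R) * u y
    rw [mul_comm]
    exact (hu.le_mul_exp z hz y hy).trans (by gcongr)
  have h2 : ∫ z, u z ∂μ ≤ Real.exp (b * R) * u y := by simpa using h1
  rw [Real.exp_neg, inv_mul_le_iff₀ (Real.exp_pos _)]
  exact h2

omit [IsProbabilityMeasure μ] in
lemma isLogLip_weight (i : ι) : IsLogLip Z ρ C₁ (g i) :=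
  ⟨h.measurable_weight i, fun y _ => h.weight_nonneg i y, h.weight_le i⟩

lemma weight_le_integral (i : ι) {y : M} (hy : y ∈ Z) :
    g i y ≤ Real.exp (C₁ * R) * ∫ z, g i z ∂μ :=
  h.le_exp_mul_integral h.distortion_pos.le (h.isLogLip_weight i) hy

lemma integrable_weight (i : ι) : Integrable (g i) μ :=
  h.integrable_of_isBddMeas (h.isBddMeas_of_isLogLip h.distortion_pos.le (h.isLogLip_weight i))

omit [IsProbabilityMeasure μ] in
lemma lintegral_eq_tsum {f : M → ℝ≥0∞} (hf : Measurable f) :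
    ∫⁻ y, f y ∂μ = ∑' i, ∫⁻ y, ENNReal.ofReal (g i y) * f (s i y) ∂μ := by
  conv_lhs => rw [← h.sum_eq]
  rw [lintegral_sum_measure]
  congr 1 with i
  rw [lintegral_map hf (h.measurable_branch i)]
  exact lintegral_withDensity_eq_lintegral_mul _ (h.measurable_weight i).ennreal_ofReal
    (hf.comp (h.measurable_branch i))

/-- The branch decomposition of `μ` tested on the constant `1`. -/
lemma hasSum_integral_weight : HasSum (fun i => ∫ z, g i z ∂μ) 1 := by
  have h1 := h.lintegral_eq_tsum (f := fun _ => 1) measurable_const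
  simp only [lintegral_const, measure_univ, mul_one] at h1
  have h2 : ∀ i, ∫⁻ y, ENNReal.ofReal (g i y) ∂μ = ENNReal.ofReal (∫ z, g i z ∂μ) := fun i =>
    (ofReal_integral_eq_lintegral_ofReal (h.integrable_weight i)
      (ae_of_all _ (h.weight_nonneg i))).symm
  simp_rw [h2] at h1
  have h3 : ∀ i, 0 ≤ ∫ z, g i z ∂μ := fun i => integral_nonneg (h.weight_nonneg i)
  have hs : Summable fun i => ∫ z, g i z ∂μ := by
    have h4 := ENNReal.summable_toReal (h1 ▸ ENNReal.one_ne_top)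
    simpa only [ENNReal.toReal_ofReal (h3 _)] using h4
  rw [← ENNReal.ofReal_tsum_of_nonneg h3 hs] at h1
  have h5 : ∑' i, ∫ z, g i z ∂μ = 1 := by
    have := congrArg ENNReal.toReal h1
    rw [ENNReal.toReal_ofReal (tsum_nonneg h3)] at this
    simpa using this.symm
  exact h5 ▸ hs.hasSum

/-- Distortion bounds each weight on `Z` by a multiple of its integral, and the integrals are
summable; off `Z` all weights vanish. -/
lemma summable_weight {u : M → ℝ} (hu : IsBddMeas Z u) (y : M) :
    Summable fun i => g i y * u (s i y) := by
  by_cases hy : y ∈ Z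
  · obtain ⟨-, B, hB⟩ := hu
    refine Summable.of_norm_bounded
      ((h.hasSum_integral_weight.summable.mul_left (Real.exp (C₁ * R))).mul_right B) fun i => ?_
    have h1 := h.weight_le_integral i hy
    have h2 := hB _ (h.branch_mem i y hy)
    rw [Real.norm_eq_abs, abs_mul, abs_of_nonneg (h.weight_nonneg i y)]
    exact mul_le_mul h1 h2 (abs_nonneg _) ((h.weight_nonneg i y).trans h1)
  · simp [h.weight_eq_zero _ y hy]

lemma transfer_add {u w : M → ℝ} (hu : IsBddMeas Z u) (hw : IsBddMeas Z w) :
    transfer s g (u + w) = transfer s g u + transfer s g w := by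
  ext y
  simp only [transfer, Pi.add_apply, mul_add]
  exact (h.summable_weight hu y).tsum_add (h.summable_weight hw y)

lemma transfer_sub {u w : M → ℝ} (hu : IsBddMeas Z u) (hw : IsBddMeas Z w) :
    transfer s g (u - w) = transfer s g u - transfer s g w := by
  ext y
  simp only [transfer, Pi.sub_apply, mul_sub]
  exact (h.summable_weight hu y).tsum_sub (h.summable_weight hw y)

omit [IsProbabilityMeasure μ] in
lemma measurable_transfer [Countable ι] {u : M → ℝ} (hu : Measurable u) :
    Measurable (transfer s g u) :=
  Measurable.tsum fun i => (h.measurable_weight i).mul (hu.comp (h.measurable_branch i))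

lemma isBddMeas_transfer [Countable ι] {u : M → ℝ} (hu : IsBddMeas Z u) :
    IsBddMeas Z (transfer s g u) := by
  refine ⟨h.measurable_transfer hu.1, ?_⟩
  obtain ⟨hum, B, hB⟩ := hu
  refine ⟨∑' i, Real.exp (C₁ * R) * (∫ z, g i z ∂μ) * B, fun y hy => ?_⟩
  rw [← Real.norm_eq_abs]
  refine tsum_of_norm_bounded ((h.hasSum_integral_weight.summable.mul_left
    (Real.exp (C₁ * R))).mul_right B).hasSum fun i => ?_
  have h1 := h.weight_le_integral i hy
  have h2 := hB _ (h.branch_mem i y hy)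
  rw [Real.norm_eq_abs, abs_mul, abs_of_nonneg (h.weight_nonneg i y)]
  exact mul_le_mul h1 h2 (abs_nonneg _) ((h.weight_nonneg i y).trans h1)

lemma isBddMeas_iterate [Countable ι] {u : M → ℝ} (hu : IsBddMeas Z u) (n : ℕ) :
    IsBddMeas Z ((transfer s g)^[n] u) := by
  induction n with
  | zero => exact hu
  | succ n ih =>
    rw [Function.iterate_succ_apply']
    exact h.isBddMeas_transfer ih

lemma iterate_transfer_sub [Countable ι] {u w : M → ℝ} (hu : IsBddMeas Z u) (hw : IsBddMeas Z w)
    (n : ℕ) :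
    (transfer s g)^[n] (u - w) = (transfer s g)^[n] u - (transfer s g)^[n] w := by
  induction n with
  | zero => rfl
  | succ n ih =>
    simp only [Function.iterate_succ_apply', ih]
    exact h.transfer_sub (h.isBddMeas_iterate hu n) (h.isBddMeas_iterate hw n)

omit [IsProbabilityMeasure μ] in
lemma hasSum_integral_branch {f : M → ℝ} (hfm : Measurable f) (hf : Integrable f μ) :
    (∀ i, Integrable (fun y => g i y * f (s i y)) μ) ∧
      HasSum (fun i => ∫ y, g i y * f (s i y) ∂μ) (∫ y, f y ∂μ) := by
  have hf' := hf
  rw [← h.sum_eq] at hf'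
  have h1 := hasSum_integral_measure hf'
  rw [h.sum_eq] at h1
  have hgt : ∀ i, ∀ᵐ y ∂μ, ENNReal.ofReal (g i y) < ∞ := fun i =>
    ae_of_all _ fun y => ENNReal.ofReal_lt_top
  have heq : ∀ i, (fun y => (ENNReal.ofReal (g i y)).toReal • f (s i y))
      = fun y => g i y * f (s i y) := fun i => by
    ext y; rw [ENNReal.toReal_ofReal (h.weight_nonneg i y), smul_eq_mul]
  constructor
  · intro i
    have h2 : Integrable f ((μ.withDensity fun y => ENNReal.ofReal (g i y)).map (s i)) :=
      hf'.mono_measure (Measure.le_sum _ i)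
    rw [integrable_map_measure hfm.aestronglyMeasurable (h.measurable_branch i).aemeasurable,
      integrable_withDensity_iff_integrable_smul' (h.measurable_weight i).ennreal_ofReal (hgt i)]
      at h2
    rw [← heq]
    exact h2
  · have h3 : ∀ i, ∫ y, f y ∂((μ.withDensity fun y => ENNReal.ofReal (g i y)).map (s i))
        = ∫ y, g i y * f (s i y) ∂μ := fun i => by
      rw [integral_map (h.measurable_branch i).aemeasurable hfm.aestronglyMeasurable,
        integral_withDensity_eq_integral_toReal_smul (h.measurable_weight i).ennreal_ofReal (hgt i),
        heq]
    simpa only [h3] using h1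

omit [IsProbabilityMeasure μ] in
lemma integral_transfer [Countable ι] {f : M → ℝ} (hfm : Measurable f) (hf : Integrable f μ) :
    ∫ y, transfer s g f y ∂μ = ∫ y, f y ∂μ := by
  obtain ⟨h1, h2⟩ := h.hasSum_integral_branch hfm hf
  obtain ⟨-, h4⟩ := h.hasSum_integral_branch hfm.norm hf.norm
  have h5 : ∀ i y, ‖g i y * f (s i y)‖ = g i y * ‖f (s i y)‖ := fun i y => by
    rw [norm_mul, Real.norm_of_nonneg (h.weight_nonneg i y)]
  have h6 := hasSum_integral_of_summable_integral_norm h1 (by simpa only [h5] using h4.summable)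
  exact h6.unique h2

omit [IsProbabilityMeasure μ] in
-- Since `F ∘ sᵢ` is the identity on `Z`, functions of `F x` come out of the operator. Invariance
-- and orthogonality both rest on this.
lemma transfer_comp_mul (w f : M → ℝ) {y : M} (hy : y ∈ Z) :
    transfer s g (fun x => w (F x) * f x) y = w y * transfer s g f y := by
  simp only [transfer, h.map_branch _ y hy]
  rw [← tsum_mul_left]
  congr 1 with i
  ring

lemma isLogLip_transfer [Countable ι] {b : ℝ} (hb : 0 ≤ b) {u : M → ℝ} (hu : IsLogLip Z ρ b u) :
    IsLogLip Z ρ (C₁ + b * θ) (transfer s g u) := by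
  have hbdd := h.isBddMeas_of_isLogLip hb hu
  refine ⟨h.measurable_transfer hu.measurable, fun y hy => tsum_nonneg fun i =>
    mul_nonneg (h.weight_nonneg i y) (hu.nonneg _ (h.branch_mem i y hy)), fun y hy y' hy' => ?_⟩
  rw [transfer, transfer, ← tsum_mul_right]
  refine (h.summable_weight hbdd y).tsum_le_tsum (fun i => ?_)
    ((h.summable_weight hbdd y').mul_right _)
  have h0 := hu.nonneg _ (h.branch_mem i y' hy')
  have h1 := h.weight_le i y hy y' hy'
  have h2 := hu.le_mul_exp _ (h.branch_mem i y hy) _ (h.branch_mem i y' hy')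
  have h3 := h.gauge_branch i y hy y' hy'
  have h4 : u (s i y) ≤ u (s i y') * Real.exp (b * θ * ρ y y') := by
    refine h2.trans ?_
    rw [mul_assoc]
    gcongr
  calc g i y * u (s i y)
      ≤ (g i y' * Real.exp (C₁ * ρ y y')) * (u (s i y') * Real.exp (b * θ * ρ y y')) := by
        refine mul_le_mul h1 h4 (hu.nonneg _ (h.branch_mem i y hy)) ?_
        exact mul_nonneg (h.weight_nonneg i y') (Real.exp_pos _).le
    _ = _ := by rw [add_mul, Real.exp_add]; ring

omit [IsProbabilityMeasure μ] in
lemma isLogLip_mono {b b' : ℝ} (hbb : b ≤ b') {u : M → ℝ} (hu : IsLogLip Z ρ b u) :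
    IsLogLip Z ρ b' u := by
  refine ⟨hu.measurable, hu.nonneg, fun y hy y' hy' => (hu.le_mul_exp y hy y' hy').trans ?_⟩
  have := hu.nonneg y' hy'
  have := h.gauge_nonneg y y'
  gcongr

lemma isLogLip_transfer_coneConst [Countable ι] {u : M → ℝ}
    (hu : IsLogLip Z ρ (coneConst θ C₁) u) : IsLogLip Z ρ (coneConst θ C₁) (transfer s g u) :=
  h.isLogLip_mono h.add_mul_coneConst_le (h.isLogLip_transfer h.coneConst_pos.le hu)

omit [IsProbabilityMeasure μ] in
lemma integral_nonneg_of_isLogLip {b : ℝ} {u : M → ℝ} (hu : IsLogLip Z ρ b u) :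
    0 ≤ ∫ z, u z ∂μ :=
  integral_nonneg_of_ae (h.ae_mem.mono hu.nonneg)

/-- The source of the spectral gap. The transferred function is at least `exp (-(b R)) * ∫ u` on
`Z`, so the subtracted constant is at most the fraction `(1 - θ) / 2` of it. By `exp_sub_le` the
constant `b (1 + θ) / 2` grows by at most the factor `1 / (1 - (1 - θ) / 2)`, which brings it back
to exactly `b`. -/
lemma isLogLip_transfer_sub [Countable ι] {u : M → ℝ} (hu : IsLogLip Z ρ (coneConst θ C₁) u) :
    IsLogLip Z ρ (coneConst θ C₁)
      (transfer s g u - fun _ => gapConst θ C₁ R * ∫ z, u z ∂μ) := by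
  have hL := h.isLogLip_transfer h.coneConst_pos.le hu
  rw [h.add_mul_coneConst] at hL
  have hL' := h.isLogLip_transfer_coneConst hu
  set b := coneConst θ C₁ with hb
  have hθ := h.contraction_lt_one
  have hθ0 := h.contraction_nonneg
  have hI : ∫ z, transfer s g u z ∂μ = ∫ z, u z ∂μ := h.integral_transfer hu.measurable
    (h.integrable_of_isBddMeas (h.isBddMeas_of_isLogLip h.coneConst_pos.le hu))
  have hI0 := h.integral_nonneg_of_isLogLip hu
  have hlow : ∀ y ∈ Z, gapConst θ C₁ R * ∫ z, u z ∂μ ≤ (1 - θ) / 2 * transfer s g u y := by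
    intro y hy
    have h1 := h.exp_neg_mul_integral_le h.coneConst_pos.le hL' hy
    rw [hI] at h1
    rw [gapConst, mul_assoc]
    gcongr
  set c := gapConst θ C₁ R * ∫ z, u z ∂μ with hc
  have hc0 : 0 ≤ c := mul_nonneg h.gapConst_pos.le hI0
  refine ⟨hL.measurable.sub measurable_const, fun y hy => ?_, fun y hy y' hy' => ?_⟩
  · have := hlow y hy
    have := hL.nonneg y hy
    simp only [Pi.sub_apply]
    nlinarith
  · simp only [Pi.sub_apply]
    have h1 := hL.le_mul_exp y hy y' hy'
    have h2 := hlow y' hy'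
    rcases (hL.nonneg y' hy').eq_or_lt with h0 | h0
    · rw [← h0] at h1 h2 ⊢
      have : c = 0 := by linarith
      rw [this]
      linarith
    · set v := transfer s g u y'
      have h3 := exp_sub_le (t := b * ((1 + θ) / 2) * ρ y y') (c := c / v) (k := (1 - θ) / 2)
        (mul_nonneg (mul_nonneg h.coneConst_pos.le (by linarith)) (h.gauge_nonneg _ _))
        (by positivity) (by linarith) (by rw [div_le_iff₀ h0]; exact h2)
      have h4 : b * ((1 + θ) / 2) * ρ y y' / (1 - (1 - θ) / 2) = b * ρ y y' := by
        have : (1 + θ) ≠ 0 := by linarith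
        rw [show 1 - (1 - θ) / 2 = (1 + θ) / 2 by ring]
        field_simp
      rw [h4] at h3
      have h5 := mul_le_mul_of_nonneg_left h3 h0.le
      have h6 : v * (Real.exp (b * ((1 + θ) / 2) * ρ y y') - c / v)
          = v * Real.exp (b * ((1 + θ) / 2) * ρ y y') - c := by field_simp
      have h7 : v * ((1 - c / v) * Real.exp (b * ρ y y')) = (v - c) * Real.exp (b * ρ y y') := by
        field_simp
      rw [h6, h7] at h5
      linarith

/-- Exponential loss of memory for the transfer operator on the cone. -/
theorem abs_iterate_transfer_sub_le [Countable ι] (n : ℕ) {u w : M → ℝ}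
    (hu : IsLogLip Z ρ (coneConst θ C₁) u) (hw : IsLogLip Z ρ (coneConst θ C₁) w)
    (huw : ∫ z, u z ∂μ = ∫ z, w z ∂μ) {y : M} (hy : y ∈ Z) :
    |(transfer s g)^[n] u y - (transfer s g)^[n] w y| ≤
      Real.exp (coneConst θ C₁ * R) * (1 - gapConst θ C₁ R) ^ n * ∫ z, u z ∂μ := by
  induction n generalizing u w with
  | zero =>
    have h1 := h.le_exp_mul_integral h.coneConst_pos.le hu hy
    have h2 := h.le_exp_mul_integral h.coneConst_pos.le hw hy
    have h3 := hu.nonneg y hy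
    have h4 := hw.nonneg y hy
    rw [← huw] at h2
    simp only [Function.iterate_zero, id_eq, pow_zero, mul_one]
    rw [abs_le]
    constructor <;> linarith
  | succ n ih =>
    have hub := h.isBddMeas_of_isLogLip h.coneConst_pos.le hu
    have hwb := h.isBddMeas_of_isLogLip h.coneConst_pos.le hw
    have hu1 := h.isLogLip_transfer_sub hu
    have hw1 := h.isLogLip_transfer_sub hw
    have hint : ∀ v : M → ℝ, IsBddMeas Z v →
        ∫ z, (transfer s g v - fun _ => gapConst θ C₁ R * ∫ z, v z ∂μ : M → ℝ) z ∂μ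
          = (1 - gapConst θ C₁ R) * ∫ z, v z ∂μ := by
      intro v hv
      simp only [Pi.sub_apply]
      rw [integral_sub (h.integrable_of_isBddMeas (h.isBddMeas_transfer hv)) (integrable_const _),
        h.integral_transfer hv.1 (h.integrable_of_isBddMeas hv)]
      simp
      ring
    have h1 := ih hu1 hw1 (by rw [hint u hub, hint w hwb, huw])
    rw [hint u hub] at h1
    -- Equal integrals mean that the same constant is removed from both functions: their difference
    -- is unchanged while their common integral drops by the factor `1 - gapConst`.
    have hsub : ∀ v : M → ℝ, ∀ c : ℝ, IsBddMeas Z v → (transfer s g)^[n] (v - fun _ => c)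
        = (transfer s g)^[n] v - (transfer s g)^[n] (fun _ => c) := fun v c hv =>
      h.iterate_transfer_sub hv (isBddMeas_const c) n
    rw [hsub _ _ (h.isBddMeas_transfer hub), hsub _ _ (h.isBddMeas_transfer hwb), huw,
      Pi.sub_apply, Pi.sub_apply, sub_sub_sub_cancel_right] at h1
    rw [Function.iterate_succ_apply, Function.iterate_succ_apply, huw]
    refine h1.trans (le_of_eq ?_)
    ring

/-- Solution of `X - L X = U` by a Neumann series. -/
lemma exists_sub_transfer_eq [Countable ι] {U : M → ℝ} (hU : IsBddMeas Z U) {K : ℝ}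
    (hK : ∀ n, ∀ y ∈ Z, |(transfer s g)^[n] U y| ≤ K * (1 - gapConst θ C₁ R) ^ n) :
    ∃ X : M → ℝ, Measurable X ∧ (∀ y ∈ Z, |X y| ≤ K / gapConst θ C₁ R) ∧
      (∀ y ∈ Z, X y - transfer s g X y = U y) ∧
      ∀ y ∈ Z, HasSum (fun n => (transfer s g)^[n] U y) (X y) := by
  have hγ0 : 0 ≤ 1 - gapConst θ C₁ R := by linarith [h.gapConst_lt_one]
  have hγ1 : 1 - gapConst θ C₁ R < 1 := by linarith [h.gapConst_pos]
  have hgeo : HasSum (fun n => K * (1 - gapConst θ C₁ R) ^ n) (K / gapConst θ C₁ R) := by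
    have := (hasSum_geometric_of_lt_one hγ0 hγ1).mul_left K
    rwa [sub_sub_cancel, ← div_eq_mul_inv] at this
  have hsum : ∀ y ∈ Z, Summable fun n => (transfer s g)^[n] U y := fun y hy =>
    Summable.of_norm_bounded hgeo.summable fun n => hK n y hy
  refine ⟨fun y => ∑' n, (transfer s g)^[n] U y,
    Measurable.tsum fun n => (h.isBddMeas_iterate hU n).1,
    fun y hy => (Real.norm_eq_abs _).symm.le.trans
      (tsum_of_norm_bounded (f := fun n => (transfer s g)^[n] U y) hgeo fun n => hK n y hy),
    fun y hy => ?_,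
    fun y hy => (hsum y hy).hasSum⟩
  have h1 : transfer s g (fun y => ∑' n, (transfer s g)^[n] U y) y
      = ∑' n, (transfer s g)^[n + 1] U y := by
    simp only [transfer]
    simp_rw [← tsum_mul_left]
    rw [Summable.tsum_comm]
    · congr 1 with n
      rw [Function.iterate_succ_apply']
      rfl
    · have h2 : Summable fun i => g i y := by
        simpa using h.summable_weight (isBddMeas_const (Z := Z) 1) y
      have h0 : ∀ i, 0 ≤ g i y := fun i => h.weight_nonneg i y
      have h3 : ∀ n, 0 ≤ K * (1 - gapConst θ C₁ R) ^ n := fun n =>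
        (abs_nonneg _).trans (hK n y hy)
      refine Summable.of_norm_bounded
        (g := fun q : ℕ × ι => K * (1 - gapConst θ C₁ R) ^ q.1 * g q.2 y)
        (hgeo.summable.mul_of_nonneg h2 h3 h0) fun q => ?_
      simp only [Function.uncurry]
      rw [Real.norm_eq_abs, abs_mul, abs_of_nonneg (h0 _), mul_comm (g _ _)]
      exact mul_le_mul_of_nonneg_right (hK _ _ (h.branch_mem _ y hy)) (h0 _)
  simp only [h1]
  rw [(hsum y hy).tsum_eq_zero_add]
  simp

end IsFullBranch

end FullBranch

/-! ### Invariant density and martingale-coboundary decomposition -/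

section InvariantDensity

variable {M : Type*} {ι : Type*} [MeasurableSpace M] {μ : Measure M} {F : M → M} {Z : Set M}
  {s : ι → M → M} {g : ι → M → ℝ} {ρ : M → M → ℝ} {θ C₁ R : ℝ}

/-- `h` is a positive invariant density in the cone of log-Lipschitz functions. -/
structure IsInvariantDensity (μ : Measure M) (Z : Set M) (s : ι → M → M) (g : ι → M → ℝ)
    (ρ : M → M → ℝ) (θ C₁ : ℝ) (h : M → ℝ) : Prop where
  isLogLip : IsLogLip Z ρ (coneConst θ C₁) h
  pos : ∀ y, 0 < h y
  integral_eq_one : ∫ y, h y ∂μ = 1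
  transfer_eq : ∀ y ∈ Z, transfer s g h y = h y

lemma isLogLip_const (hρ : ∀ y y', 0 ≤ ρ y y') {b c : ℝ} (hb : 0 ≤ b) (hc : 0 ≤ c) :
    IsLogLip Z ρ b (fun _ => c) :=
  ⟨measurable_const, fun _ _ => hc, fun y _ y' _ =>
    le_mul_of_one_le_right hc (Real.one_le_exp (mul_nonneg hb (hρ y y')))⟩

namespace IsFullBranch

variable [IsProbabilityMeasure μ] [Countable ι] (hF : IsFullBranch μ F Z s g ρ θ C₁ R)
include hF

lemma integral_iterate_transfer {u : M → ℝ} (hu : IsBddMeas Z u) (n : ℕ) :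
    ∫ y, (transfer s g)^[n] u y ∂μ = ∫ y, u y ∂μ := by
  induction n with
  | zero => rfl
  | succ n ih =>
    have hn := hF.isBddMeas_iterate hu n
    rw [Function.iterate_succ_apply', hF.integral_transfer hn.1 (hF.integrable_of_isBddMeas hn), ih]

lemma isLogLip_iterate {u : M → ℝ} (hu : IsLogLip Z ρ (coneConst θ C₁) u) (n : ℕ) :
    IsLogLip Z ρ (coneConst θ C₁) ((transfer s g)^[n] u) := by
  induction n with
  | zero => exact hu
  | succ n ih =>
    rw [Function.iterate_succ_apply']
    exact hF.isLogLip_transfer_coneConst ih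

/-- Write `L` for the operator. Telescoping gives `L^n 1 = 1 + ∑_{k<n} L^k (L 1 - 1)`, which
converges geometrically to `1 + X` with `X - L X = L 1 - 1`; hence `1 + X` is fixed. Cone membership
passes to the limit. -/
theorem exists_isInvariantDensity : ∃ h : M → ℝ, IsInvariantDensity μ Z s g ρ θ C₁ h := by
  set b := coneConst θ C₁ with hb
  have hb0 : 0 < b := hF.coneConst_pos
  set e : M → ℝ := fun _ => 1 with he
  have heb : IsBddMeas Z e := isBddMeas_const 1
  have hel : IsLogLip Z ρ b e := isLogLip_const hF.gauge_nonneg hb0.le zero_le_one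
  have hLe := hF.isLogLip_transfer_coneConst hel
  have hLeb := hF.isBddMeas_transfer heb
  have hI : ∫ y, transfer s g e y ∂μ = ∫ y, e y ∂μ :=
    hF.integral_transfer heb.1 (hF.integrable_of_isBddMeas heb)
  have hI1 : ∫ y, e y ∂μ = 1 := by simp [he]
  have hdec : ∀ n, ∀ y ∈ Z, |(transfer s g)^[n] (transfer s g e - e) y| ≤
      Real.exp (b * R) * (1 - gapConst θ C₁ R) ^ n := by
    intro n y hy
    have h1 := hF.abs_iterate_transfer_sub_le n hLe hel hI hy
    rw [hI, hI1, mul_one] at h1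
    rw [hF.iterate_transfer_sub hLeb heb]
    exact h1
  obtain ⟨X, hXm, hXb, hX, hXs⟩ := hF.exists_sub_transfer_eq (hLeb.sub heb) hdec
  have hlim : ∀ y ∈ Z, Tendsto (fun n => (transfer s g)^[n] e y) atTop (𝓝 (1 + X y)) := by
    intro y hy
    have h1 := ((hXs y hy).tendsto_sum_nat).const_add 1
    refine h1.congr fun n => ?_
    have h2 : ∀ k, (transfer s g)^[k] (transfer s g e - e) y
        = (transfer s g)^[k + 1] e y - (transfer s g)^[k] e y := by
      intro k
      rw [hF.iterate_transfer_sub hLeb heb, ← Function.iterate_succ_apply]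
      rfl
    simp_rw [h2]
    rw [Finset.sum_range_sub (fun k => (transfer s g)^[k] e y)]
    simp [he]
  classical
  -- The value `1` off `Z` makes `h` positive everywhere, so that division by `h` is unproblematic.
  set h : M → ℝ := Z.piecewise (fun y => 1 + X y) e with hh
  have hhZ : ∀ y ∈ Z, h y = 1 + X y := fun y hy => Set.piecewise_eq_of_mem _ _ _ hy
  have hit := fun n => hF.isLogLip_iterate hel n
  have hlog : IsLogLip Z ρ b h := by
    refine ⟨Measurable.piecewise hF.measurableSet (hXm.const_add 1) measurable_const,
      fun y hy => ?_, fun y hy y' hy' => ?_⟩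
    · rw [hhZ y hy]
      exact ge_of_tendsto' (hlim y hy) fun n => (hit n).nonneg y hy
    · rw [hhZ y hy, hhZ y' hy']
      exact le_of_tendsto_of_tendsto' (hlim y hy) ((hlim y' hy').mul_const _)
        fun n => (hit n).le_mul_exp y hy y' hy'
  have hint : ∫ y, h y ∂μ = 1 := by
    have h1 : Tendsto (fun n => ∫ y, (transfer s g)^[n] e y ∂μ) atTop (𝓝 (∫ y, h y ∂μ)) := by
      refine tendsto_integral_of_dominated_convergence (fun _ => Real.exp (b * R))
        (fun n => (hit n).measurable.aestronglyMeasurable) (integrable_const _)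
        (fun n => hF.ae_mem.mono fun y hy => ?_) (hF.ae_mem.mono fun y hy => ?_)
      · rw [Real.norm_of_nonneg ((hit n).nonneg y hy)]
        have h2 := hF.le_exp_mul_integral hb0.le (hit n) hy
        rwa [hF.integral_iterate_transfer heb, hI1, mul_one] at h2
      · rw [hhZ y hy]
        exact hlim y hy
    simp_rw [hF.integral_iterate_transfer heb, hI1] at h1
    exact tendsto_nhds_unique h1 tendsto_const_nhds
  refine ⟨h, hlog, fun y => ?_, hint, fun y hy => ?_⟩
  · by_cases hy : y ∈ Z
    · have h1 := hF.exp_neg_mul_integral_le hb0.le hlog hy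
      rw [hint, mul_one] at h1
      exact (Real.exp_pos _).trans_le h1
    · rw [hh, Set.piecewise_eq_of_notMem _ _ _ hy]
      exact one_pos
  · have h1 : transfer s g h y = transfer s g (e + X) y := by
      simp only [transfer]
      congr 1 with i
      rw [hhZ _ (hF.branch_mem i y hy)]
      rfl
    rw [h1, hF.transfer_add heb ⟨hXm, _, hXb⟩, hhZ y hy]
    have h2 := hX y hy
    simp only [Pi.sub_apply, Pi.add_apply, he] at h2 ⊢
    linarith

/-- Adding `c = (1 + b⁻¹) H` makes `U` at least `b⁻¹ H` on `Z`, and a function with Lipschitz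
constant `H` and this lower bound is `b`-log-Lipschitz. It is then compared with the constant `c`,
which has the same integral because `U` has mean zero. -/
lemma abs_iterate_transfer_le {U : M → ℝ} (hU : Measurable U) {H : ℝ}
    (hUb : ∀ y ∈ Z, |U y| ≤ H) (hUl : ∀ y ∈ Z, ∀ y' ∈ Z, U y - U y' ≤ H * ρ y y')
    (hU0 : ∫ y, U y ∂μ = 0) (n : ℕ) {y : M} (hy : y ∈ Z) :
    |(transfer s g)^[n] U y| ≤ Real.exp (coneConst θ C₁ * R) * (1 + (coneConst θ C₁)⁻¹) * H
      * (1 - gapConst θ C₁ R) ^ n := by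
  set b := coneConst θ C₁ with hb
  have hb0 : 0 < b := hF.coneConst_pos
  have hH : 0 ≤ H := (abs_nonneg _).trans (hUb y hy)
  set c : ℝ := (1 + b⁻¹) * H with hc
  have hc0 : 0 ≤ c := by positivity
  have hUbd : IsBddMeas Z U := ⟨hU, H, hUb⟩
  have hcb : IsBddMeas Z (fun _ : M => c) := isBddMeas_const c
  have hcl : IsLogLip Z ρ b (fun _ => c) := isLogLip_const hF.gauge_nonneg hb0.le hc0
  have hlow : ∀ y ∈ Z, b⁻¹ * H ≤ U y + c := fun z hz => by
    have := (abs_le.1 (hUb z hz)).1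
    rw [hc]
    linarith
  have hul : IsLogLip Z ρ b (U + fun _ => c) := by
    refine ⟨hU.add measurable_const, fun z hz => ?_, fun z hz z' hz' => ?_⟩
    · exact (by positivity : 0 ≤ b⁻¹ * H).trans (hlow z hz)
    · simp only [Pi.add_apply]
      have h1 := hlow z' hz'
      have h2 := hUl z hz z' hz'
      have h3 := Real.add_one_le_exp (b * ρ z z')
      have h4 := hF.gauge_nonneg z z'
      have h5 : H * ρ z z' ≤ (U z' + c) * (b * ρ z z') := by
        calc H * ρ z z' = (b⁻¹ * H) * (b * ρ z z') := by field_simp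
          _ ≤ _ := by gcongr
      have h6 : 0 ≤ U z' + c := (by positivity : 0 ≤ b⁻¹ * H).trans h1
      have h7 := mul_le_mul_of_nonneg_left h3 h6
      linarith
  have hint : ∫ z, (U + fun _ => c : M → ℝ) z ∂μ = c := by
    simp only [Pi.add_apply]
    rw [integral_add (hF.integrable_of_isBddMeas hUbd) (integrable_const _), hU0]
    simp
  have h1 := hF.abs_iterate_transfer_sub_le n hul hcl (by rw [hint]; simp) hy
  have h2 : U = (U + fun _ => c) - fun _ => c := by ext z; simp
  rw [hint] at h1
  rw [h2, hF.iterate_transfer_sub (hUbd.add hcb) hcb]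
  refine h1.trans (le_of_eq ?_)
  rw [hc]
  ring

end IsFullBranch

/-- The constant in the bound for the coboundary of the martingale decomposition. -/
noncomputable def coboundaryConst (θ C₁ R : ℝ) : ℝ :=
  Real.exp (coneConst θ C₁ * R) * (Real.exp (coneConst θ C₁ * R) * (1 + (coneConst θ C₁)⁻¹) *
    (Real.exp ((C₁ + coneConst θ C₁) * R) * (1 + coneConst θ C₁ * Real.exp (coneConst θ C₁ * R)))
      / gapConst θ C₁ R)

namespace IsFullBranch

variable [IsProbabilityMeasure μ] [Countable ι] (hF : IsFullBranch μ F Z s g ρ θ C₁ R)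
include hF

/-- Martingale-coboundary decomposition of an unbounded observable `V`, whose oscillation on the
range of the branch `sᵢ` is controlled by `tᵢ`. -/
theorem exists_coboundary {h : M → ℝ} (hh : IsInvariantDensity μ Z s g ρ θ C₁ h) {V : M → ℝ}
    (hV : Measurable V) {t : ι → ℝ} (ht0 : ∀ i, 0 ≤ t i)
    (hVb : ∀ i, ∀ y ∈ Z, |V (s i y)| ≤ t i)
    (hVl : ∀ i, ∀ y ∈ Z, ∀ y' ∈ Z, |V (s i y) - V (s i y')| ≤ t i * ρ y y')
    (htsum : Summable fun i => (∫ z, g i z ∂μ) * t i)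
    (hVi : Integrable (fun y => h y * V y) μ) (hV0 : ∫ y, h y * V y ∂μ = 0) :
    ∃ χ : M → ℝ, Measurable χ ∧
      (∀ y ∈ Z, |χ y| ≤ coboundaryConst θ C₁ R * ∑' i, (∫ z, g i z ∂μ) * t i) ∧
      ∀ y ∈ Z, transfer s g (fun x => h x * (V x + χ x - χ (F x))) y = 0 := by
  set b := coneConst θ C₁ with hb
  have hb0 : 0 < b := hF.coneConst_pos
  set Q := ∑' i, (∫ z, g i z ∂μ) * t i with hQ
  have hw0 : ∀ i, 0 ≤ ∫ z, g i z ∂μ := fun i => integral_nonneg (hF.weight_nonneg i)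
  have hhub : ∀ y ∈ Z, h y ≤ Real.exp (b * R) := fun y hy => by
    simpa [hh.integral_eq_one] using hF.le_exp_mul_integral hb0.le hh.isLogLip hy
  have hhlb : ∀ y ∈ Z, Real.exp (-(b * R)) ≤ h y := fun y hy => by
    simpa [hh.integral_eq_one] using hF.exp_neg_mul_integral_le hb0.le hh.isLogLip hy
  have hhb : IsBddMeas Z h := hF.isBddMeas_of_isLogLip hb0.le hh.isLogLip
  have hR := hF.gauge_bound_nonneg
  set K := Real.exp ((C₁ + b) * R) with hK
  have hq0 : ∀ i y, 0 ≤ g i y * h (s i y) := fun i y =>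
    mul_nonneg (hF.weight_nonneg i y) (hh.pos _).le
  have hqK : ∀ i, ∀ y ∈ Z, g i y * h (s i y) ≤ K * ∫ z, g i z ∂μ := by
    intro i y hy
    calc g i y * h (s i y) ≤ (Real.exp (C₁ * R) * ∫ z, g i z ∂μ) * Real.exp (b * R) :=
          mul_le_mul (hF.weight_le_integral i hy) (hhub _ (hF.branch_mem i y hy)) (hh.pos _).le
            (mul_nonneg (Real.exp_pos _).le (hw0 i))
      _ = _ := by rw [hK, add_mul, Real.exp_add]; ring
  have hqe : ∀ i, ∀ y ∈ Z, ∀ y' ∈ Z,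
      g i y * h (s i y) ≤ g i y' * h (s i y') * Real.exp (b * ρ y y') := by
    intro i y hy y' hy'
    have h3 := hF.gauge_branch i y hy y' hy'
    have h4 : h (s i y) ≤ h (s i y') * Real.exp (b * θ * ρ y y') := by
      refine (hh.isLogLip.le_mul_exp _ (hF.branch_mem i y hy) _ (hF.branch_mem i y' hy')).trans ?_
      have := (hh.pos (s i y')).le
      rw [mul_assoc]
      gcongr
    have h5 := hF.gauge_nonneg y y'
    have h6 := hF.add_mul_coneConst_le
    calc g i y * h (s i y)
        ≤ (g i y' * Real.exp (C₁ * ρ y y')) * (h (s i y') * Real.exp (b * θ * ρ y y')) :=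
          mul_le_mul (hF.weight_le i y hy y' hy') h4 (hh.pos _).le
            (mul_nonneg (hF.weight_nonneg i y') (Real.exp_pos _).le)
      _ = g i y' * h (s i y') * Real.exp ((C₁ + b * θ) * ρ y y') := by
          rw [add_mul, Real.exp_add]; ring
      _ ≤ _ := by
          have := hq0 i y'
          gcongr
  have hqd' : ∀ i, ∀ y ∈ Z, ∀ y' ∈ Z, g i y * h (s i y) - g i y' * h (s i y') ≤
      K * (∫ z, g i z ∂μ) * (b * Real.exp (b * R) * ρ y y') := by
    intro i y hy y' hy'
    have h1 := hqe i y hy y' hy'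
    -- This is `e^t - 1 ≤ t e^t` with the gauge in the exponential replaced by its bound `R`.
    have h2 : Real.exp (b * ρ y y') - 1 ≤ b * Real.exp (b * R) * ρ y y' := by
      have h3 := Real.add_one_le_exp (-(b * ρ y y'))
      have h4 : Real.exp (b * ρ y y') ≤ Real.exp (b * R) := by
        have := hF.gauge_le y y'
        gcongr
      have h5 : Real.exp (b * ρ y y') * Real.exp (-(b * ρ y y')) = 1 := by
        rw [← Real.exp_add]; simp
      have h6 := mul_le_mul_of_nonneg_left h3 (Real.exp_pos (b * ρ y y')).le
      have h7 := mul_le_mul_of_nonneg_right h4 (mul_nonneg hb0.le (hF.gauge_nonneg y y'))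
      nlinarith
    have h8 := mul_le_mul_of_nonneg_left h2 (hq0 i y')
    have h9 := mul_le_mul_of_nonneg_right (hqK i y' hy')
      (mul_nonneg (mul_nonneg hb0.le (Real.exp_pos (b * R)).le) (hF.gauge_nonneg y y'))
    linarith
  have hqd : ∀ i, ∀ y ∈ Z, ∀ y' ∈ Z, |g i y * h (s i y) - g i y' * h (s i y')| ≤
      K * (∫ z, g i z ∂μ) * (b * Real.exp (b * R) * ρ y y') := fun i y hy y' hy' => by
    refine abs_le.2 ⟨?_, hqd' i y hy y' hy'⟩
    have := hqd' i y' hy' y hy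
    rw [hF.gauge_symm] at this
    linarith
  have hsumV : ∀ y ∈ Z, Summable fun i => g i y * (h (s i y) * V (s i y)) := by
    intro y hy
    refine Summable.of_norm_bounded (htsum.mul_left K) fun i => ?_
    rw [← mul_assoc, Real.norm_eq_abs, abs_mul, abs_of_nonneg (hq0 i y), ← mul_assoc]
    exact mul_le_mul (hqK i y hy) (hVb i y hy) (abs_nonneg _) ((hq0 i y).trans (hqK i y hy))
  -- `V` need not be bounded, but one transfer averages it: the weights are dominated by their
  -- integrals, and `∑ (∫ gᵢ) tᵢ` is finite.
  set U := transfer s g (fun x => h x * V x) with hU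
  set H := K * (1 + b * Real.exp (b * R)) * Q with hH
  have hUb : ∀ y ∈ Z, |U y| ≤ K * Q := by
    intro y hy
    rw [← Real.norm_eq_abs]
    refine tsum_of_norm_bounded (htsum.hasSum.mul_left K) fun i => ?_
    rw [← mul_assoc, Real.norm_eq_abs, abs_mul, abs_of_nonneg (hq0 i y), ← mul_assoc]
    exact mul_le_mul (hqK i y hy) (hVb i y hy) (abs_nonneg _) ((hq0 i y).trans (hqK i y hy))
  have hQ0 : 0 ≤ Q := tsum_nonneg fun i => mul_nonneg (hw0 i) (ht0 i)
  have hUb' : ∀ y ∈ Z, |U y| ≤ H := fun y hy => (hUb y hy).trans (by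
    rw [hH]
    have : 0 ≤ K * (b * Real.exp (b * R)) * Q := by positivity
    linarith)
  have hUl : ∀ y ∈ Z, ∀ y' ∈ Z, U y - U y' ≤ H * ρ y y' := by
    intro y hy y' hy'
    rw [hU, transfer, transfer, ← (hsumV y hy).tsum_sub (hsumV y' hy')]
    refine (le_abs_self _).trans ?_
    rw [← Real.norm_eq_abs]
    have hs := htsum.hasSum.mul_left (K * (1 + b * Real.exp (b * R)) * ρ y y')
    rw [← hQ, show K * (1 + b * Real.exp (b * R)) * ρ y y' * Q = H * ρ y y' by rw [hH]; ring] at hs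
    refine tsum_of_norm_bounded hs fun i => ?_
    have e1 : g i y * (h (s i y) * V (s i y)) - g i y' * (h (s i y') * V (s i y'))
        = g i y * h (s i y) * (V (s i y) - V (s i y'))
          + (g i y * h (s i y) - g i y' * h (s i y')) * V (s i y') := by ring
    rw [e1, Real.norm_eq_abs]
    refine (abs_add_le _ _).trans ?_
    rw [abs_mul (g i y * h (s i y)), abs_mul (g i y * h (s i y) - _), abs_of_nonneg (hq0 i y)]
    have h1 := mul_le_mul (hqK i y hy) (hVl i y hy y' hy') (abs_nonneg _)
      ((hq0 i y).trans (hqK i y hy))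
    have h2 := mul_le_mul (hqd i y hy y' hy') (hVb i y' hy') (abs_nonneg _)
      ((abs_nonneg _).trans (hqd i y hy y' hy'))
    refine (add_le_add h1 h2).trans (le_of_eq ?_)
    ring
  have hhVm : Measurable fun y => h y * V y := hh.isLogLip.measurable.mul hV
  have hUm : Measurable U := hF.measurable_transfer hhVm
  have hU0 : ∫ y, U y ∂μ = 0 := (hF.integral_transfer hhVm hVi).trans hV0
  obtain ⟨X, hXm, hXb, hX, -⟩ := hF.exists_sub_transfer_eq ⟨hUm, H, hUb'⟩
    (fun n y hy => hF.abs_iterate_transfer_le hUm hUb' hUl hU0 n hy)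
  have hXbdd : IsBddMeas Z X := ⟨hXm, _, hXb⟩
  have hχb : ∀ y ∈ Z, |X y / h y| ≤ coboundaryConst θ C₁ R * Q := by
    intro y hy
    rw [abs_div, abs_of_pos (hh.pos y), div_le_iff₀ (hh.pos y)]
    refine (hXb y hy).trans ?_
    have h1 : 1 ≤ Real.exp (b * R) * h y := by
      have h2 := mul_le_mul_of_nonneg_left (hhlb y hy) (Real.exp_pos (b * R)).le
      rwa [← Real.exp_add, add_neg_cancel, Real.exp_zero] at h2
    have h3 : 0 ≤ Real.exp (b * R) * (1 + b⁻¹) * H / gapConst θ C₁ R := by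
      have := hF.gapConst_pos
      positivity
    calc _ ≤ Real.exp (b * R) * (1 + b⁻¹) * H / gapConst θ C₁ R * (Real.exp (b * R) * h y) :=
          le_mul_of_one_le_right h3 h1
      _ = _ := by rw [coboundaryConst, hH]; ring
  -- With `χ = X / h`, the pull-out property and `L h = h` give `L (h · χ ∘ F) = X`, so the
  -- transferred sum equals `U + L X - X = 0`.
  refine ⟨fun y => X y / h y, hXm.div hh.isLogLip.measurable, hχb, fun y hy => ?_⟩
  have hterm : ∀ i, g i y * (h (s i y) * (V (s i y) + X (s i y) / h (s i y) - X (F (s i y)) /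
      h (F (s i y)))) = g i y * (h (s i y) * V (s i y)) + g i y * X (s i y)
        - (X y / h y) * (g i y * h (s i y)) := by
    intro i
    rw [hF.map_branch i y hy]
    have := (hh.pos (s i y)).ne'
    field_simp
  have hs1 := hF.summable_weight hXbdd y
  have hs2 := (hF.summable_weight hhb y).mul_left (X y / h y)
  simp only [transfer]
  simp_rw [hterm]
  rw [((hsumV y hy).add hs1).tsum_sub hs2, (hsumV y hy).tsum_add hs1, tsum_mul_left]
  have h1 : ∑' i, g i y * h (s i y) = h y := hh.transfer_eq y hy
  have h2 := hX y hy
  have h3 : ∑' i, g i y * (h (s i y) * V (s i y)) = U y := rfl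
  have h4 : ∑' i, g i y * X (s i y) = transfer s g X y := rfl
  rw [h1, h3, h4, div_mul_cancel₀ _ (hh.pos y).ne']
  linarith

omit [Countable ι] [IsProbabilityMeasure μ] in
lemma ae_withDensity {h : M → ℝ} {P : M → Prop} (hP : ∀ y ∈ Z, P y) :
    ∀ᵐ y ∂(μ.withDensity fun y => ENNReal.ofReal (h y)), P y :=
  (withDensity_absolutelyContinuous _ _).ae_le (hF.ae_mem.mono hP)

omit hF [Countable ι] [IsProbabilityMeasure μ] in
lemma integral_withDensity_ofReal {h : M → ℝ} (hm : Measurable h) (hpos : ∀ y, 0 < h y)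
    (f : M → ℝ) :
    ∫ y, f y ∂(μ.withDensity fun y => ENNReal.ofReal (h y)) = ∫ y, h y * f y ∂μ := by
  rw [integral_withDensity_eq_integral_toReal_smul hm.ennreal_ofReal
    (ae_of_all _ fun y => ENNReal.ofReal_lt_top)]
  simp_rw [ENNReal.toReal_ofReal (hpos _).le, smul_eq_mul]

omit hF [Countable ι] [IsProbabilityMeasure μ] in
lemma integrable_withDensity_ofReal_iff {h : M → ℝ} (hm : Measurable h) (hpos : ∀ y, 0 < h y)
    (f : M → ℝ) : Integrable f (μ.withDensity fun y => ENNReal.ofReal (h y)) ↔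
      Integrable (fun y => h y * f y) μ := by
  rw [integrable_withDensity_iff_integrable_smul' hm.ennreal_ofReal
    (ae_of_all _ fun y => ENNReal.ofReal_lt_top)]
  simp_rw [ENNReal.toReal_ofReal (hpos _).le, smul_eq_mul]

omit [Countable ι] in
lemma isProbabilityMeasure_withDensity {h : M → ℝ} (hh : IsInvariantDensity μ Z s g ρ θ C₁ h) :
    IsProbabilityMeasure (μ.withDensity fun y => ENNReal.ofReal (h y)) := by
  constructor
  rw [withDensity_apply _ MeasurableSet.univ, Measure.restrict_univ,
    ← ofReal_integral_eq_lintegral_ofReal (hF.integrable_of_isBddMeas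
      (hF.isBddMeas_of_isLogLip hF.coneConst_pos.le hh.isLogLip))
      (ae_of_all _ fun y => (hh.pos y).le), hh.integral_eq_one, ENNReal.ofReal_one]

/-- Transfer preserves integrals and `L (w ∘ F · h) = w · h`; the indicator functions `w` give the
claim. -/
theorem measurePreserving_withDensity {h : M → ℝ} (hh : IsInvariantDensity μ Z s g ρ θ C₁ h) :
    MeasurePreserving F (μ.withDensity fun y => ENNReal.ofReal (h y))
      (μ.withDensity fun y => ENNReal.ofReal (h y)) := by
  have := hF.isProbabilityMeasure_withDensity hh
  refine ⟨hF.measurable_map, ?_⟩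
  ext B hB
  rw [Measure.map_apply hF.measurable_map hB]
  have hreal : ∀ A, MeasurableSet A → (μ.withDensity fun y => ENNReal.ofReal (h y)).real A
      = ∫ y, A.indicator (fun _ => (1 : ℝ)) y * h y ∂μ := by
    intro A hA
    rw [← integral_indicator_one hA, integral_withDensity_ofReal hh.isLogLip.measurable hh.pos]
    simp_rw [mul_comm]
    rfl
  rw [← measureReal_eq_measureReal_iff, hreal _ hB, hreal _ (hF.measurable_map hB)]
  set w : M → ℝ := B.indicator fun _ => (1 : ℝ) with hw
  have hwm : Measurable w := measurable_const.indicator hB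
  have hwb : ∀ y, |w y| ≤ 1 := fun y => by
    by_cases hy : y ∈ B <;> simp [hw, hy]
  have h1 : ∀ y, (F ⁻¹' B).indicator (fun _ => (1 : ℝ)) y = w (F y) := fun y => rfl
  simp_rw [h1]
  have hwh : IsBddMeas Z fun y => w (F y) * h y := by
    obtain ⟨-, K, hK⟩ := hF.isBddMeas_of_isLogLip hF.coneConst_pos.le hh.isLogLip
    refine ⟨(hwm.comp hF.measurable_map).mul hh.isLogLip.measurable, K, fun y hy => ?_⟩
    rw [abs_mul]
    exact (mul_le_of_le_one_left (abs_nonneg _) (hwb _)).trans (hK y hy)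
  rw [← hF.integral_transfer hwh.1 (hF.integrable_of_isBddMeas hwh)]
  refine integral_congr_ae (hF.ae_mem.mono fun y hy => ?_)
  change transfer s g (fun x => w (F x) * h x) y = w y * h y
  rw [hF.transfer_comp_mul w h hy, hh.transfer_eq y hy]

omit [IsProbabilityMeasure μ] in
-- The condition `L (h φ) = 0` says that `φ` has zero conditional expectation given `F`, that is,
-- `φ` is a reverse martingale difference.
theorem integral_comp_mul_eq_zero {h : M → ℝ} (hh : IsInvariantDensity μ Z s g ρ θ C₁ h)
    {φ w : M → ℝ} (hφ : Measurable φ) (hw : Measurable w)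
    (hφ0 : ∀ y ∈ Z, transfer s g (fun x => h x * φ x) y = 0)
    (hi : Integrable (fun y => w (F y) * φ y) (μ.withDensity fun y => ENNReal.ofReal (h y))) :
    ∫ y, w (F y) * φ y ∂(μ.withDensity fun y => ENNReal.ofReal (h y)) = 0 := by
  have hm := hh.isLogLip.measurable
  rw [integrable_withDensity_ofReal_iff hm hh.pos] at hi
  rw [integral_withDensity_ofReal hm hh.pos]
  have e : (fun y => h y * (w (F y) * φ y)) = fun y => w (F y) * (h y * φ y) := by
    ext y; ring
  rw [e] at hi ⊢
  rw [← hF.integral_transfer (f := fun y => w (F y) * (h y * φ y))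
    ((hw.comp hF.measurable_map).mul (hm.mul hφ)) hi, ← integral_zero M ℝ (μ := μ)]
  refine integral_congr_ae (hF.ae_mem.mono fun y hy => ?_)
  change transfer s g (fun x => w (F x) * (h x * φ x)) y = 0
  rw [hF.transfer_comp_mul w _ hy, hφ0 y hy, mul_zero]

end IsFullBranch

end InvariantDensity

/-! ### From an inducing scheme to a full-branch system -/

section Scheme

variable {M : Type*} [MetricSpace M] [MeasurableSpace M]

lemma standardBorelSpace_of_measurableEquiv {X X' : Type*} [MeasurableSpace X]
    [MeasurableSpace X'] [StandardBorelSpace X'] (e : X ≃ᵐ X') : StandardBorelSpace X := by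
  let := upgradeStandardBorel X'
  refine ⟨TopologicalSpace.induced e inferInstance, ?_, e.toEquiv.polishSpace_induced⟩
  refine @BorelSpace.mk X (TopologicalSpace.induced e inferInstance) _ ?_
  refine Eq.trans ?_ borel_comap.symm
  rw [← BorelSpace.measurable_eq (α := X')]
  exact e.measurableEmbedding.comap_eq.symm

/-- The space is σ-compact, so its image in the completion, a Polish space, is a countable union of
compact sets and hence Borel. Standardness is used so that injective measurable images are
measurable. -/
lemma standardBorelSpace_of_locallyCompact (M : Type*) [MetricSpace M] [LocallyCompactSpace M]
    [TopologicalSpace.SeparableSpace M] [MeasurableSpace M] [BorelSpace M] :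
    StandardBorelSpace M := by
  have : SecondCountableTopology M := UniformSpace.secondCountable_of_separable M
  borelize (UniformSpace.Completion M)
  let e : M → UniformSpace.Completion M := (↑)
  have he : Topology.IsEmbedding e := UniformSpace.Completion.coe_isometry.isEmbedding
  have hr : MeasurableSet (range e) := by
    have : range e = ⋃ n, e '' compactCovering M n := by
      rw [← image_iUnion, iUnion_compactCovering, image_univ]
    rw [this]
    exact MeasurableSet.iUnion fun n =>
      ((isCompact_compactCovering M n).image he.continuous).measurableSet
  have hme : MeasurableEmbedding e := he.measurableEmbedding hr
  have : StandardBorelSpace (range e) := hr.standardBorel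
  exact standardBorelSpace_of_measurableEquiv hme.equivRange

variable {m : Measure M} {T : M → M} {Y : Set M} {α : Set (Set M)} {τ τ' : M → ℕ}
  {lam η C₀ C₁ : ℝ}

omit [MetricSpace M] in
lemma measurable_inducedMap (hT : Measurable T) (hτ : Measurable τ) :
    Measurable (inducedMap T τ) := by
  have h1 : Measurable fun q : ℕ × M => T^[q.1] q.2 :=
    measurable_from_prod_countable_right fun n => hT.iterate n
  exact h1.comp (hτ.prodMk measurable_id)

namespace IsInducingScheme

lemma ae_mem_sUnion (hs : IsInducingScheme m T Y α τ lam η C₀ C₁) :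
    ∀ᵐ x ∂(m.restrict Y), x ∈ ⋃₀ α := by
  rw [ae_restrict_iff' hs.measurableSet_base, ae_iff]
  convert! hs.cover using 2
  ext x
  simp

lemma measurableSet_sUnion (hs : IsInducingScheme m T Y α τ lam η C₀ C₁) :
    MeasurableSet (⋃₀ α) :=
  MeasurableSet.sUnion hs.countable hs.measurableSet_elem

/-- Allows the return time to be altered off the partition elements, where it may be neither
measurable nor positive. -/
lemma congr (hs : IsInducingScheme m T Y α τ lam η C₀ C₁) (h : ∀ A ∈ α, ∀ x ∈ A, τ' x = τ x) :
    IsInducingScheme m T Y α τ' lam η C₀ C₁ := by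
  have hF : ∀ A ∈ α, ∀ x ∈ A, inducedMap T τ' x = inducedMap T τ x := fun A hA x hx => by
    rw [inducedMap, inducedMap, h A hA x hx]
  have hI : ∀ A ∈ α, ∀ B ⊆ A, inducedMap T τ' '' B = inducedMap T τ '' B := fun A hA B hB =>
    image_congr fun x hx => hF A hA x (hB hx)
  refine { hs with
    one_le_time := fun A hA x hx => by rw [h A hA x hx]; exact hs.one_le_time A hA x hx
    time_const := fun A hA x hx y hy => by
      rw [h A hA x hx, h A hA y hy]; exact hs.time_const A hA x hx y hy
    time_integrable := ?_
    mapsTo := fun A hA x hx => by rw [hF A hA x hx]; exact hs.mapsTo A hA hx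
    injOn := fun A hA x hx y hy hxy => by
      rw [hF A hA x hx, hF A hA y hy] at hxy; exact hs.injOn A hA hx hy hxy
    onto := fun A hA => by rw [hI A hA A subset_rfl]; exact hs.onto A hA
    expand := fun A hA x hx y hy => by
      rw [hF A hA x hx, hF A hA y hy]; exact hs.expand A hA x hx y hy
    intermediate := fun A hA x hx y hy l hl => by
      rw [h A hA x hx] at hl
      rw [hF A hA x hx, hF A hA y hy]; exact hs.intermediate A hA x hx y hy l hl
    distortion := ?_ }
  · refine Integrable.congr hs.time_integrable (hs.ae_mem_sUnion.mono fun x hx => ?_)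
    obtain ⟨A, hA, hxA⟩ := hx
    simp only [h A hA x hxA]
  · obtain ⟨ζ, hζ, hd⟩ := hs.distortion
    refine ⟨ζ, hζ, fun A hA => ⟨(hd A hA).1, fun B hB hBA => ?_, fun x hx y hy => ?_⟩⟩
    · rw [hI A hA B hBA]; exact (hd A hA).2.1 B hB hBA
    · rw [hF A hA x hx, hF A hA y hy]; exact (hd A hA).2.2 x hx y hy

/-- The return time, replaced by `1` off the partition elements. -/
lemma exists_measurable_time (hs : IsInducingScheme m T Y α τ lam η C₀ C₁) :
    ∃ τ' : M → ℕ, Measurable τ' ∧ (∀ x, 1 ≤ τ' x) ∧ ∀ A ∈ α, ∀ x ∈ A, τ' x = τ x := by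
  classical
  refine ⟨fun x => if x ∈ ⋃₀ α then τ x else 1, ?_, fun x => ?_, fun A hA x hx =>
    if_pos ⟨A, hA, hx⟩⟩
  · refine measurable_to_countable' fun n => ?_
    have : (fun x => if x ∈ ⋃₀ α then τ x else 1) ⁻¹' {n} =
        (⋃ A ∈ {A ∈ α | ∀ x ∈ A, τ x = n}, A) ∪ {x | x ∉ ⋃₀ α ∧ 1 = n} := by
      ext x
      simp only [mem_preimage, mem_singleton_iff, mem_union, mem_iUnion, mem_ofPred_eq]
      by_cases hx : x ∈ ⋃₀ α
      · obtain ⟨A, hA, hxA⟩ := hx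
        have hx' : x ∈ ⋃₀ α := ⟨A, hA, hxA⟩
        rw [if_pos hx']
        simp only [hx', not_true_eq_false, false_and, or_false]
        constructor
        · intro h
          exact ⟨A, ⟨hA, fun y hy => (hs.time_const A hA y hy x hxA).trans h⟩, hxA⟩
        · rintro ⟨B, ⟨-, hB⟩, hxB⟩
          exact hB x hxB
      · rw [if_neg hx]
        simp only [hx, not_false_eq_true, true_and]
        constructor
        · exact fun h => Or.inr h
        · rintro (⟨B, ⟨hB, -⟩, hxB⟩ | h)
          · exact absurd ⟨B, hB, hxB⟩ hx
          · exact h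
    rw [this]
    refine MeasurableSet.union (MeasurableSet.biUnion (hs.countable.mono (sep_subset _ _))
      fun A hA => hs.measurableSet_elem A hA.1) ?_
    by_cases hn : 1 = n
    · simp only [hn, and_true]
      exact hs.measurableSet_sUnion.compl
    · simp [hn]
  · simp only
    split_ifs with hx
    · obtain ⟨A, hA, hxA⟩ := hx
      exact hs.one_le_time A hA x hxA
    · exact le_rfl

section Branches

variable [StandardBorelSpace M] [BorelSpace M]

lemma measurableSet_image (hs : IsInducingScheme m T Y α τ lam η C₀ C₁) (hT : Measurable T)
    (hτ : Measurable τ) {A B : Set M} (hA : A ∈ α) (hB : MeasurableSet B) (hBA : B ⊆ A) :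
    MeasurableSet (inducedMap T τ '' B) :=
  hB.image_of_measurable_injOn (measurable_inducedMap hT hτ) ((hs.injOn A hA).mono hBA)

/-- A set of full measure in the base, each point of which has a preimage in this set along every
branch. -/
lemma exists_full_preimages (hs : IsInducingScheme m T Y α τ lam η C₀ C₁) (hT : Measurable T)
    (hτ : Measurable τ) : ∃ Z ⊆ Y, MeasurableSet Z ∧ m (Y \ Z) = 0 ∧
      ∀ A ∈ α, ∀ y ∈ Z, ∃ x ∈ A ∩ Z, inducedMap T τ x = y := by
  set F := inducedMap T τ with hF
  -- Each stage keeps the points that have, along every branch, a preimage in the previous stage;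
  -- the set sought is the intersection of the stages.
  let W : ℕ → Set M := fun n => Nat.rec Y (fun _ S => S ∩ ⋂ A ∈ α, F '' (A ∩ S)) n
  have hW1 : ∀ n, W (n + 1) = W n ∩ ⋂ A ∈ α, F '' (A ∩ W n) := fun n => rfl
  have hWY : ∀ n, W n ⊆ Y := fun n => by
    induction n with
    | zero => exact subset_rfl
    | succ n ih => rw [hW1]; exact inter_subset_left.trans ih
  have hWm : ∀ n, MeasurableSet (W n) := fun n => by
    induction n with
    | zero => exact hs.measurableSet_base
    | succ n ih =>
      rw [hW1]
      exact ih.inter (MeasurableSet.biInter hs.countable fun A hA =>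
        hs.measurableSet_image hT hτ hA ((hs.measurableSet_elem A hA).inter ih) inter_subset_left)
  obtain ⟨ζ, -, hζ⟩ := hs.distortion
  have hW0 : ∀ n, m (Y \ W n) = 0 := fun n => by
    induction n with
    | zero =>
      change m (Y \ Y) = 0
      rw [sdiff_self, measure_empty]
    | succ n ih =>
      rw [hW1, sdiff_inter, measure_union_null_iff]
      refine ⟨ih, ?_⟩
      simp only [sdiff_iInter]
      rw [measure_biUnion_null_iff hs.countable]
      intro A hA
      have hsub : Y \ F '' (A ∩ W n) ⊆ (Y \ F '' A) ∪ F '' (A \ W n) := by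
        rintro y ⟨hyY, hy⟩
        by_cases h : y ∈ F '' A
        · obtain ⟨x, hx, rfl⟩ := h
          exact Or.inr ⟨x, ⟨hx, fun hxW => hy ⟨x, ⟨hx, hxW⟩, rfl⟩⟩, rfl⟩
        · exact Or.inl ⟨hyY, h⟩
      refine measure_mono_null hsub (measure_union_null (hs.onto A hA) ?_)
      -- The density formula shows that `F` maps null subsets of a partition element to null sets.
      rw [(hζ A hA).2.1 (A \ W n) ((hs.measurableSet_elem A hA).diff (hWm n)) sdiff_subset]
      exact setLIntegral_measure_zero _ _
        (measure_mono_null (sdiff_subset_sdiff_left (hs.elem_subset A hA)) ih)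
  refine ⟨⋂ n, W n, iInter_subset_of_subset 0 (hWY 0), MeasurableSet.iInter hWm, ?_, ?_⟩
  · rw [sdiff_iInter, measure_iUnion_null_iff]
    exact hW0
  · intro A hA y hy
    rw [mem_iInter] at hy
    have h1 : ∀ n, ∃ x ∈ A ∩ W n, F x = y := fun n => by
      have := hy (n + 1)
      rw [hW1] at this
      exact mem_iInter₂.1 this.2 A hA
    choose x hx hxy using h1
    refine ⟨x 0, ⟨(hx 0).1, mem_iInter.2 fun n => ?_⟩, hxy 0⟩
    -- By injectivity on `A`, the preimages found at the different stages are one point, which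
    -- therefore lies in every stage.
    rw [hs.injOn A hA (hx 0).1 (hx n).1 ((hxy 0).trans (hxy n).symm)]
    exact (hx n).2

omit [StandardBorelSpace M] [BorelSpace M] in
lemma map_withDensity_eq (hs : IsInducingScheme m T Y α τ lam η C₀ C₁) (hT : Measurable T)
    (hτ : Measurable τ) {ζ : M → ℝ} {A : Set M} (hA : A ∈ α)
    (hζ : ∀ B, MeasurableSet B → B ⊆ A →
      m (inducedMap T τ '' B) = ∫⁻ x in B, ENNReal.ofReal (ζ x)⁻¹ ∂m) :
    ((m.restrict A).withDensity fun x => ENNReal.ofReal (ζ x)⁻¹).map (inducedMap T τ)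
      = m.restrict Y := by
  have hF := measurable_inducedMap hT hτ
  have hAm := hs.measurableSet_elem A hA
  have h1 : m.restrict Y = m.restrict (inducedMap T τ '' A) := by
    refine Measure.restrict_congr_set ?_
    refine EventuallyLE.antisymm (ae_le_set.2 (hs.onto A hA)) (ae_le_set.2 ?_)
    rw [sdiff_eq_bot_iff.2 (image_subset_iff.2 (hs.mapsTo A hA))]
    exact measure_empty
  rw [h1]
  ext B hB
  rw [Measure.map_apply hF hB, withDensity_apply _ (hF hB), Measure.restrict_restrict (hF hB),
    ← hζ _ ((hF hB).inter hAm) inter_subset_right, Measure.restrict_apply hB, inter_comm B,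
    ← image_inter_preimage, inter_comm]

omit [StandardBorelSpace M] [BorelSpace M] in
-- The substitution `y = F x` on `A` brings in the factor `ζ⁻¹`, which cancels the weight `ζ ∘ s` at
-- `y = F x` because `s (F x) = x`.
lemma lintegral_branch (hs : IsInducingScheme m T Y α τ lam η C₀ C₁) (hT : Measurable T)
    (hτ : Measurable τ) {ζ : M → ℝ} (hζm : Measurable ζ) {A : Set M} (hA : A ∈ α)
    (hζ0 : ∀ x ∈ A, 0 < ζ x)
    (hζ : ∀ B, MeasurableSet B → B ⊆ A →
      m (inducedMap T τ '' B) = ∫⁻ x in B, ENNReal.ofReal (ζ x)⁻¹ ∂m)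
    {Z : Set M} (hZm : MeasurableSet Z) (hZ0 : m (Y \ Z) = 0) {s : M → M} (hsm : Measurable s)
    (hs1 : ∀ y ∈ Z, s y ∈ A ∧ inducedMap T τ (s y) = y) {B : Set M} (hB : MeasurableSet B) :
    ∫⁻ y in Y, (s ⁻¹' B).indicator (fun y => ENNReal.ofReal (Z.indicator (ζ ∘ s) y)) y ∂m
      = m (A ∩ B) := by
  have hF := measurable_inducedMap hT hτ
  have hAm := hs.measurableSet_elem A hA
  have hfm : Measurable ((s ⁻¹' B).indicator
      fun y => ENNReal.ofReal (Z.indicator (ζ ∘ s) y)) :=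
    (((hζm.comp hsm).indicator hZm).ennreal_ofReal).indicator (hsm hB)
  rw [← hs.map_withDensity_eq hT hτ hA hζ, lintegral_map hfm hF,
    lintegral_withDensity_eq_lintegral_mul (m.restrict A)
      (f := fun x => ENNReal.ofReal (ζ x)⁻¹) hζm.inv.ennreal_ofReal
      (g := fun x => (s ⁻¹' B).indicator (fun y => ENNReal.ofReal (Z.indicator (ζ ∘ s) y))
        (inducedMap T τ x)) (hfm.comp hF)]
  -- As `ζ⁻¹` is positive on `A`, no set of positive measure in `A` can be mapped into the null set
  -- `Y \ Z`.
  have hN : m (A ∩ (inducedMap T τ) ⁻¹' (Y \ Z)) = 0 := by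
    set N := A ∩ (inducedMap T τ) ⁻¹' (Y \ Z) with hNdef
    have hNm : MeasurableSet N := hAm.inter (hF (hs.measurableSet_base.diff hZm))
    have h1 : ∫⁻ x in N, ENNReal.ofReal (ζ x)⁻¹ ∂m = 0 := by
      rw [← hζ N hNm inter_subset_left]
      refine measure_mono_null ?_ hZ0
      rintro _ ⟨x, hx, rfl⟩
      exact hx.2
    rw [lintegral_eq_zero_iff (f := fun x => ENNReal.ofReal (ζ x)⁻¹) hζm.inv.ennreal_ofReal] at h1
    have h2 : ∀ᵐ x ∂(m.restrict N), False := by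
      filter_upwards [h1, ae_restrict_mem hNm] with x hx hxN
      have := inv_pos.2 (hζ0 x hxN.1)
      simp only [Pi.zero_apply, ENNReal.ofReal_eq_zero] at hx
      exact absurd this (not_lt.2 hx)
    rw [← Measure.restrict_eq_zero, ← ae_eq_bot]
    exact Filter.eventually_false_iff_eq_bot.1 h2
  have h3 : ∀ᵐ x ∂(m.restrict A), inducedMap T τ x ∈ Z := by
    rw [ae_restrict_iff' hAm, ae_iff]
    refine measure_mono_null ?_ hN
    intro x hx
    simp only [mem_ofPred_eq, Classical.not_imp] at hx
    exact ⟨hx.1, hs.mapsTo A hA hx.1, hx.2⟩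
  have h4 : ∫⁻ x in A, ((fun x => ENNReal.ofReal (ζ x)⁻¹) * fun x => (s ⁻¹' B).indicator
      (fun y => ENNReal.ofReal (Z.indicator (ζ ∘ s) y)) (inducedMap T τ x)) x ∂m
      = ∫⁻ x in A, B.indicator (fun _ => 1) x ∂m := by
    refine lintegral_congr_ae ?_
    filter_upwards [h3, ae_restrict_mem hAm] with x hxZ hxA
    have hsx : s (inducedMap T τ x) = x :=
      hs.injOn A hA (hs1 _ hxZ).1 hxA (hs1 _ hxZ).2
    simp only [Pi.mul_apply]
    by_cases hxB : x ∈ B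
    · rw [indicator_of_mem (by rw [mem_preimage, hsx]; exact hxB), indicator_of_mem hxZ,
        indicator_of_mem hxB, Function.comp_apply, hsx,
        ← ENNReal.ofReal_mul (inv_pos.2 (hζ0 x hxA)).le, inv_mul_cancel₀ (hζ0 x hxA).ne',
        ENNReal.ofReal_one]
    · rw [indicator_of_notMem (by rw [mem_preimage, hsx]; exact hxB), indicator_of_notMem hxB,
        mul_zero]
  refine h4.trans ?_
  rw [lintegral_indicator hB, setLIntegral_const, one_mul, Measure.restrict_apply hB, inter_comm]

/-- The normalised base measure. -/
noncomputable def _root_.FastSlow.baseMeasure (m : Measure M) (Y : Set M) : Measure M :=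
  (m Y)⁻¹ • m.restrict Y

/-- The gauge is `dist ^ η`, the quantity in the distortion bound; expansion by `lam` contracts it
by `lam ^ (-η)` along inverse branches, and the weights are the densities `ζ` on the branches. -/
theorem exists_isFullBranch (hs : IsInducingScheme m T Y α τ lam η C₀ C₁) (hT : Measurable T)
    (hτ : Measurable τ) (hlam : 1 < lam) (hη : 0 < η) (hC₁ : 1 ≤ C₁) {D : ℝ}
    (hD : ∀ x y : M, dist x y ≤ D) :
    ∃ (Z : Set M) (s : α → M → M) (g : α → M → ℝ),
      IsFullBranch (baseMeasure m Y) (inducedMap T τ) Z s g (fun x y => dist x y ^ η) (lam ^ (-η))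
        C₁ (D ^ η) ∧ ∀ A : α, ∀ y ∈ Z, s A y ∈ (A : Set M) := by
  classical
  have hF := measurable_inducedMap hT hτ
  obtain ⟨Z, hZY, hZm, hZ0, hZ⟩ := hs.exists_full_preimages hT hτ
  obtain ⟨ζ, hζm, hζ⟩ := hs.distortion
  have : Countable α := hs.countable.to_subtype
  choose! x hx hxy using hZ
  -- The identity off `Z` is a filler that keeps the branches measurable; the weights are set to `0`
  -- there.
  let s : α → M → M := fun A => Z.piecewise (x A) id
  have hsZ : ∀ A : α, ∀ y ∈ Z, s A y = x A y := fun A y hy => piecewise_eq_of_mem _ _ _ hy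
  have hsA : ∀ A : α, ∀ y ∈ Z, s A y ∈ (A : Set M) := fun A y hy => by
    rw [hsZ A y hy]; exact (hx A A.2 y hy).1
  have hsF : ∀ A : α, ∀ y ∈ Z, inducedMap T τ (s A y) = y := fun A y hy => by
    rw [hsZ A y hy]; exact hxy A A.2 y hy
  have hsm : ∀ A : α, Measurable (s A) := by
    intro A B hB
    -- Preimages under an inverse branch are images under `F`, which are measurable because `F` is
    -- injective on `A`.
    have : s A ⁻¹' B = (Z ∩ inducedMap T τ '' (A ∩ B)) ∪ (Zᶜ ∩ B) := by
      ext y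
      simp only [mem_preimage, mem_union, mem_inter_iff, mem_compl_iff]
      by_cases hy : y ∈ Z
      · simp only [hy, true_and, not_true_eq_false, false_and, or_false]
        constructor
        · exact fun h => ⟨s A y, ⟨hsA A y hy, h⟩, hsF A y hy⟩
        · rintro ⟨z, ⟨hzA, hzB⟩, hzy⟩
          rwa [hs.injOn A A.2 (hsA A y hy) hzA ((hsF A y hy).trans hzy.symm)]
      · have : s A y = y := piecewise_eq_of_notMem _ _ _ hy
        simp [hy, this]
    rw [this]
    exact (hZm.inter (hs.measurableSet_image hT hτ A.2
      ((hs.measurableSet_elem A A.2).inter hB) inter_subset_left)).union (hZm.compl.inter hB)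
  have hη' : 0 < lam := by linarith
  refine ⟨Z, s, fun A => Z.indicator (ζ ∘ s A), ?_, hsA⟩
  refine
    { measurableSet := hZm
      ae_mem := ?_
      measurable_map := hF
      measurable_branch := hsm
      measurable_weight := fun A => (hζm.comp (hsm A)).indicator hZm
      branch_mem := fun A y hy => by rw [hsZ A y hy]; exact (hx A A.2 y hy).2
      map_branch := hsF
      weight_nonneg := fun A => indicator_nonneg fun y hy => ((hζ A A.2).1 _ (hsA A y hy)).le
      weight_eq_zero := fun A y hy => indicator_of_notMem hy _
      sum_eq := ?_
      gauge_nonneg := fun y y' => by positivity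
      gauge_symm := fun y y' => by simp only [dist_comm]
      gauge_le := fun y y' => Real.rpow_le_rpow dist_nonneg (hD y y') hη.le
      gauge_branch := ?_
      weight_le := ?_
      contraction_nonneg := by positivity
      contraction_lt_one := Real.rpow_lt_one_of_one_lt_of_neg hlam (by linarith)
      distortion_pos := by linarith }
  · have h1 : ∀ᵐ y ∂(m.restrict Y), y ∈ Z := by
      rw [ae_restrict_iff' hs.measurableSet_base, ae_iff]
      convert! hZ0 using 2
      ext y
      simp
    exact Measure.smul_absolutelyContinuous.ae_le h1
  · ext B hB
    have h1 : ∀ A : α, ((baseMeasure m Y).withDensity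
        fun y => ENNReal.ofReal (Z.indicator (ζ ∘ s A) y)).map (s A) B
        = (m Y)⁻¹ * m (A ∩ B) := by
      intro A
      rw [Measure.map_apply (hsm A) hB, withDensity_apply _ (hsm A hB),
        ← lintegral_indicator (hsm A hB), baseMeasure, lintegral_smul_measure,
        hs.lintegral_branch hT hτ hζm A.2 (hζ A A.2).1 (hζ A A.2).2.1 hZm hZ0 (hsm A)
          (fun y hy => ⟨hsA A y hy, hsF A y hy⟩) hB]
      rfl
    rw [Measure.sum_apply _ hB]
    simp_rw [h1]
    rw [ENNReal.tsum_mul_left, baseMeasure, Measure.smul_apply, smul_eq_mul]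
    congr 1
    have h2 : m.restrict Y B = m.restrict Y (B ∩ ⋃₀ α) := by
      refine (measure_inter_conull' ?_).symm
      exact measure_mono_null (fun y hy => hy.2) (mem_ae_iff.1 hs.ae_mem_sUnion)
    rw [h2, Measure.restrict_apply (hB.inter hs.measurableSet_sUnion)]
    have h3 : B ∩ ⋃₀ α ∩ Y = ⋃ A : α, (A : Set M) ∩ B := by
      ext y
      simp only [mem_inter_iff, mem_sUnion, mem_iUnion, Subtype.exists, exists_prop]
      constructor
      · rintro ⟨⟨hyB, A, hA, hyA⟩, -⟩
        exact ⟨A, hA, hyA, hyB⟩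
      · rintro ⟨A, hA, hyA, hyB⟩
        exact ⟨⟨hyB, A, hA, hyA⟩, hs.elem_subset A hA hyA⟩
    rw [h3, measure_iUnion]
    · intro A A' hAA'
      have := hs.disjoint A.2 A'.2 (fun h => hAA' (Subtype.ext h))
      exact this.mono inter_subset_left inter_subset_left
    · exact fun A => (hs.measurableSet_elem A A.2).inter hB
  · intro A y hy y' hy'
    have h1 := hs.expand A A.2 _ (hsA A y hy) _ (hsA A y' hy')
    rw [hsF A y hy, hsF A y' hy'] at h1
    rw [Real.rpow_neg hη'.le, inv_mul_eq_div, le_div_iff₀ (by positivity), mul_comm,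
      ← Real.mul_rpow hη'.le dist_nonneg]
    exact Real.rpow_le_rpow (by positivity) h1 hη.le
  · intro A y hy y' hy'
    have h1 := (hζ A A.2).2.2 _ (hsA A y hy) _ (hsA A y' hy')
    rw [hsF A y hy, hsF A y' hy'] at h1
    have h2 := (hζ A A.2).1 _ (hsA A y hy)
    have h3 := (hζ A A.2).1 _ (hsA A y' hy')
    rw [indicator_of_mem hy, indicator_of_mem hy', Function.comp_apply, Function.comp_apply,
      ← Real.exp_log h2, ← Real.exp_log h3, ← Real.exp_add]
    refine Real.exp_le_exp.2 ?_
    linarith [le_abs_self (Real.log (ζ (s A y)) - Real.log (ζ (s A y')))]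

end Branches

end IsInducingScheme

end Scheme

/-! ### The tower over the induced map and its projection to `M` -/

section Tower

lemma abs_birkhoffSum_le {M : Type*} {T : M → M} {v : M → ℝ} {H : ℝ} (hH : ∀ y, |v y| ≤ H) (n : ℕ) (y : M) :
    |birkhoffSum T v n y| ≤ H * n := by
  refine (Finset.abs_sum_le_sum_abs _ _).trans ?_
  refine (Finset.sum_le_sum fun k _ => hH _).trans (le_of_eq ?_)
  simp [mul_comm]

variable {M : Type*} [MeasurableSpace M] {m σ ν : Measure M} {T : M → M} {τ : M → ℕ}

/-- The projection to `M` of the tower measure over `σ` with roof function `τ`. -/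
noncomputable def towerMeasure (σ : Measure M) (T : M → M) (τ : M → ℕ) : Measure M :=
  Measure.sum fun l : ℕ => (σ.restrict {y | l < τ y}).map T^[l]

lemma lintegral_towerMeasure (hT : Measurable T) (hτ : Measurable τ) {f : M → ℝ≥0∞}
    (hf : Measurable f) : ∫⁻ y, f y ∂(towerMeasure σ T τ)
      = ∫⁻ y, ∑ l ∈ Finset.range (τ y), f (T^[l] y) ∂σ := by
  have hm : ∀ l : ℕ, MeasurableSet {y | l < τ y} := fun l => hτ (measurableSet_Ioi (a := l))
  rw [towerMeasure, lintegral_sum_measure]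
  have h1 : ∀ l : ℕ, ∫⁻ y, f y ∂((σ.restrict {y | l < τ y}).map T^[l])
      = ∫⁻ y, {y | l < τ y}.indicator (fun y => f (T^[l] y)) y ∂σ := fun l => by
    rw [lintegral_map hf (hT.iterate l), lintegral_indicator (hm l)]
  simp_rw [h1]
  rw [← lintegral_tsum (f := fun l y => {y | l < τ y}.indicator (fun y => f (T^[l] y)) y)
    fun l => ((hf.comp (hT.iterate l)).indicator (hm l)).aemeasurable]
  congr 1 with y
  rw [tsum_eq_sum (s := Finset.range (τ y))]
  · refine Finset.sum_congr rfl fun l hl => ?_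
    exact indicator_of_mem (s := {y | l < τ y}) (Finset.mem_range.1 hl) _
  · intro l hl
    exact indicator_of_notMem (s := {y | l < τ y}) (fun h => hl (Finset.mem_range.2 h)) _

lemma towerMeasure_univ (hT : Measurable T) (hτ : Measurable τ) :
    towerMeasure σ T τ univ = ∫⁻ y, τ y ∂σ := by
  rw [← lintegral_one, lintegral_towerMeasure hT hτ measurable_const]
  simp

/-- Along one return the sums of `f` and of `f ∘ T` differ by `f ∘ F - f`, which has zero
`σ`-integral. The two terms are added on opposite sides to avoid subtraction, and finiteness of `σ`
allows them to be cancelled. -/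
lemma measurePreserving_towerMeasure (hT : Measurable T) (hτ : Measurable τ)
    (hF : MeasurePreserving (inducedMap T τ) σ σ) [IsFiniteMeasure σ] :
    MeasurePreserving T (towerMeasure σ T τ) (towerMeasure σ T τ) := by
  refine ⟨hT, ?_⟩
  ext B hB
  set f : M → ℝ≥0∞ := B.indicator 1 with hf
  have hfm : Measurable f := measurable_one.indicator hB
  have h1 : towerMeasure σ T τ B = ∫⁻ y, f y ∂(towerMeasure σ T τ) := (lintegral_indicator_one hB).symm
  have h2 : (towerMeasure σ T τ).map T B = ∫⁻ y, f (T y) ∂(towerMeasure σ T τ) := by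
    rw [← lintegral_map hfm hT, lintegral_indicator_one hB]
  rw [h1, h2, lintegral_towerMeasure hT hτ hfm,
    lintegral_towerMeasure hT hτ (f := fun y => f (T y)) (hfm.comp hT)]
  have h3 : ∀ y, ∑ l ∈ Finset.range (τ y), f (T (T^[l] y)) + f y
      = ∑ l ∈ Finset.range (τ y), f (T^[l] y) + f (inducedMap T τ y) := fun y => by
    rw [inducedMap, ← Finset.sum_range_succ (fun l => f (T^[l] y)), Finset.sum_range_succ']
    simp only [Function.iterate_succ_apply', Function.iterate_zero, id_eq]
  have h4 := congrArg (fun k : M → ℝ≥0∞ => ∫⁻ y, k y ∂σ) (funext h3)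
  rw [lintegral_add_right _ hfm,
    lintegral_add_right (g := fun y => f (inducedMap T τ y)) _ (hfm.comp hF.measurable),
    hF.lintegral_comp hfm] at h4
  refine (ENNReal.add_left_inj ?_).1 h4
  rw [lintegral_indicator_one hB]
  exact measure_ne_top _ _

lemma towerMeasure_absolutelyContinuous (hT : Measure.QuasiMeasurePreserving T m m) (hσ : σ ≪ m) :
    towerMeasure σ T τ ≪ m := by
  refine Measure.absolutelyContinuous_sum_left fun l => ?_
  have h1 := (hT.iterate l)
  exact ((Measure.restrict_le_self.absolutelyContinuous.trans hσ).map h1.measurable).trans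
    h1.absolutelyContinuous

lemma _root_.PreErgodic.of_absolutelyContinuous (h : PreErgodic T m) (hν : ν ≪ m) :
    PreErgodic T ν :=
  ⟨fun _ hs hs' => (h.aeconst_set hs hs').anti hν.ae_le⟩

/-- By ergodicity the projected tower measure is a multiple of `ν`. -/
theorem towerMeasure_eq_smul (hT : QuasiErgodic T m) (hτ : Measurable τ)
    [IsProbabilityMeasure ν] [IsFiniteMeasure σ] (hν : MeasurePreserving T ν ν) (hνm : ν ≪ m)
    (hσm : σ ≪ m) (hF : MeasurePreserving (inducedMap T τ) σ σ) (hfin : ∫⁻ y, τ y ∂σ ≠ ∞) :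
    towerMeasure σ T τ = (∫⁻ y, τ y ∂σ) • ν := by
  have hTm := hT.measurable
  have htm := measurePreserving_towerMeasure hTm hτ hF
  have htac := towerMeasure_absolutelyContinuous (τ := τ) hT.toQuasiMeasurePreserving hσm
  set ω := towerMeasure σ T τ with hω
  have : IsFiniteMeasure ω := ⟨by rw [hω, towerMeasure_univ hTm hτ]; exact hfin.lt_top⟩
  have hsum : MeasurePreserving T (ν + ω) (ν + ω) :=
    ⟨hTm, by rw [Measure.map_add _ _ hTm, hν.map_eq, htm.map_eq]⟩
  -- Both `ν` and the tower measure are invariant and absolutely continuous with respect to the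
  -- ergodic measure `ν + ω`, hence both are multiples of it.
  have herg : Ergodic T (ν + ω) :=
    ⟨hsum, hT.toPreErgodic.of_absolutelyContinuous (Measure.AbsolutelyContinuous.add_left hνm htac)⟩
  obtain ⟨c₁, hc₁⟩ := herg.eq_smul_of_absolutelyContinuous hν
    (Measure.AbsolutelyContinuous.rfl.add_right ω)
  obtain ⟨c₂, hc₂⟩ := herg.eq_smul_of_absolutelyContinuous htm
    (by rw [add_comm]; exact Measure.AbsolutelyContinuous.rfl.add_right ν)
  have h0 : c₁ ≠ 0 := by
    rintro rfl
    have := congrArg (fun ξ => ξ univ) hc₁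
    simp at this
  have h1 : ω = (c₂ * c₁⁻¹) • ν := by
    conv_rhs => rw [hc₁]
    rw [smul_smul, mul_assoc, ENNReal.inv_mul_cancel h0, mul_one]
    · exact hc₂
    · rintro rfl
      have := congrArg (fun ξ => ξ univ) hc₁
      simp at this
  have h2 : ω univ = c₂ * c₁⁻¹ := by rw [h1]; simp
  rw [← towerMeasure_univ hTm hτ, ← hω, h2]
  exact h1

/-- The normalising factor `∫ τ dσ` is at least `1` and may be dropped. -/
lemma lintegral_le_lintegral_sum (hT : Measurable T) (hτ : Measurable τ) (hτ1 : ∀ y, 1 ≤ τ y)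
    [IsProbabilityMeasure σ] (h : towerMeasure σ T τ = (∫⁻ y, τ y ∂σ) • ν) {f : M → ℝ≥0∞}
    (hf : Measurable f) :
    ∫⁻ y, f y ∂ν ≤ ∫⁻ y, ∑ l ∈ Finset.range (τ y), f (T^[l] y) ∂σ := by
  rw [← lintegral_towerMeasure hT hτ hf, h, lintegral_smul_measure, smul_eq_mul]
  refine le_mul_of_one_le_left' ?_
  calc (1 : ℝ≥0∞) = ∫⁻ _, 1 ∂σ := by simp
    _ ≤ _ := lintegral_mono fun y => Nat.one_le_cast.2 (hτ1 y)

lemma measurable_inducedSum (hT : Measurable T) (hτ : Measurable τ) {v : M → ℝ}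
    (hv : Measurable v) : Measurable fun y => birkhoffSum T v (τ y) y := by
  have h1 : Measurable fun q : ℕ × M => birkhoffSum T v q.1 q.2 :=
    measurable_from_prod_countable_right fun n => measurable_birkhoffSum hT hv n
  exact h1.comp (hτ.prodMk measurable_id)

/-- Kac's formula: the induced sum has `σ`-integral `(∫ τ dσ) * ∫ v dν`. Adding `H` makes the
integrand nonnegative, so the formula for nonnegative functions applies; the extra terms cancel. -/
lemma integral_inducedSum_eq_zero (hT : Measurable T) (hτ : Measurable τ)
    [IsProbabilityMeasure ν] (h : towerMeasure σ T τ = (∫⁻ y, τ y ∂σ) • ν)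
    (hτi : Integrable (fun y => (τ y : ℝ)) σ) {v : M → ℝ} (hv : Measurable v) {H : ℝ}
    (hH : ∀ y, |v y| ≤ H) (hv0 : ∫ y, v y ∂ν = 0) :
    Integrable (fun y => birkhoffSum T v (τ y) y) σ ∧
      ∫ y, birkhoffSum T v (τ y) y ∂σ = 0 := by
  have hVi : Integrable (fun y => birkhoffSum T v (τ y) y) σ := by
    refine (hτi.const_mul H).mono' (measurable_inducedSum hT hτ hv).aestronglyMeasurable
      (ae_of_all _ fun y => abs_birkhoffSum_le hH _ y)
  refine ⟨hVi, ?_⟩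
  have hvi : Integrable v ν := Integrable.of_bound hv.aestronglyMeasurable H (ae_of_all _ hH)
  have h0 : ∀ y, 0 ≤ v y + H := fun y => by linarith [(abs_le.1 (hH y)).1]
  have h1 : ∫⁻ y, ENNReal.ofReal (v y + H) ∂(towerMeasure σ T τ)
      = ∫⁻ y, ENNReal.ofReal (birkhoffSum T v (τ y) y + H * τ y) ∂σ := by
    rw [lintegral_towerMeasure hT hτ (hv.add_const H).ennreal_ofReal]
    congr 1 with y
    rw [← ENNReal.ofReal_sum_of_nonneg fun l _ => h0 _, Finset.sum_add_distrib]
    simp [birkhoffSum, mul_comm]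
  have h2 : ∀ y, 0 ≤ birkhoffSum T v (τ y) y + H * τ y := fun y => by
    linarith [(abs_le.1 (abs_birkhoffSum_le (T := T) hH (τ y) y)).1]
  rw [h, lintegral_smul_measure, smul_eq_mul, ← ofReal_integral_eq_lintegral_ofReal
    (f := fun y => v y + H) (hvi.add (integrable_const H)) (ae_of_all _ h0),
    ← ofReal_integral_eq_lintegral_ofReal (f := fun y => birkhoffSum T v (τ y) y + H * τ y)
    (hVi.add (hτi.const_mul H)) (ae_of_all _ h2), integral_add hvi (integrable_const H), hv0,
    integral_add hVi (hτi.const_mul H), integral_const_mul] at h1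
  have h3 : ∫⁻ y, (τ y : ℝ≥0∞) ∂σ = ENNReal.ofReal (∫ y, (τ y : ℝ) ∂σ) := by
    rw [ofReal_integral_eq_lintegral_ofReal hτi (ae_of_all _ fun y => Nat.cast_nonneg _)]
    simp
  have hτ0 : 0 ≤ ∫ y, (τ y : ℝ) ∂σ := integral_nonneg fun y => Nat.cast_nonneg _
  have hH0 : 0 ≤ H := by
    obtain ⟨y⟩ := nonempty_of_isProbabilityMeasure ν
    exact (abs_nonneg _).trans (hH y)
  rw [h3, ← ENNReal.ofReal_mul hτ0, ENNReal.ofReal_eq_ofReal_iff] at h1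
  · simp only [integral_const, probReal_univ, smul_eq_mul, one_mul] at h1
    linarith
  · simp only [integral_const, probReal_univ, smul_eq_mul, one_mul]
    positivity
  · have h4 : 0 ≤ ∫ y, (birkhoffSum T v (τ y) y + H * τ y) ∂σ := integral_nonneg h2
    rwa [integral_add hVi (hτi.const_mul H), integral_const_mul] at h4

end Tower

/-! ### Orbits of `T` cut into successive returns -/

section Path

variable {M : Type*} {T : M → M} {τ : M → ℕ}

lemma iterate_inducedMap (j : ℕ) (y : M) :
    (inducedMap T τ)^[j] y = T^[birkhoffSum (inducedMap T τ) τ j y] y := by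
  induction j generalizing y with
  | zero => simp
  | succ j ih =>
    rw [Function.iterate_succ_apply, ih, birkhoffSum_succ', add_comm, Function.iterate_add_apply]
    rfl

lemma birkhoffSum_inducedSum (v : M → ℝ) (j : ℕ) (y : M) :
    birkhoffSum (inducedMap T τ) (fun z => birkhoffSum T v (τ z) z) j y
      = birkhoffSum T v (birkhoffSum (inducedMap T τ) τ j y) y := by
  induction j generalizing y with
  | zero => simp
  | succ j ih =>
    rw [birkhoffSum_succ', ih, birkhoffSum_succ', birkhoffSum_add]
    rfl

/-- Division with remainder by the successive return times: `j` complete returns and an incomplete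
one of length `r`. -/
lemma exists_eq_birkhoffSum_add (hτ : ∀ y, 1 ≤ τ y) (k : ℕ) (y : M) :
    ∃ j r, r < τ ((inducedMap T τ)^[j] y) ∧ k = birkhoffSum (inducedMap T τ) τ j y + r := by
  induction k using Nat.strong_induction_on generalizing y with
  | _ k ih =>
    rcases lt_or_ge k (τ y) with h | h
    · exact ⟨0, k, by simpa using h, by simp⟩
    · obtain ⟨j, r, hr, hk⟩ := ih (k - τ y) (by have := hτ y; omega) (inducedMap T τ y)
      refine ⟨j + 1, r, by rwa [Function.iterate_succ_apply], ?_⟩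
      rw [birkhoffSum_succ']
      omega

/-- Each return takes at least one step. Hence starting at height `l < τ y` and making `n` steps
completes at most `n` returns. -/
lemma add_le_birkhoffSum_succ (hτ : ∀ y, 1 ≤ τ y) (F : M → M) (j : ℕ) (y : M) :
    τ y + j ≤ birkhoffSum F τ (j + 1) y := by
  rw [birkhoffSum_succ']
  have : j ≤ birkhoffSum F τ j (F y) := by
    calc j = ∑ _k ∈ Finset.range j, 1 := by simp
      _ ≤ _ := Finset.sum_le_sum fun k _ => hτ _
  omega

/-- Birkhoff sums along the orbit of a point of the tower are controlled by the induced sums. -/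
lemma abs_birkhoffSum_iterate_le (hτ : ∀ y, 1 ≤ τ y) {v : M → ℝ} {H : ℝ} (hH : ∀ y, |v y| ≤ H)
    {N n l : ℕ} (hn : n ≤ N) {y : M} (hl : l < τ y) {A B : ℝ}
    (hA : ∀ j ≤ N, |birkhoffSum (inducedMap T τ) (fun z => birkhoffSum T v (τ z) z) j y| ≤ A)
    (hB : ∀ j ≤ N, (τ ((inducedMap T τ)^[j] y) : ℝ) ≤ B) :
    |birkhoffSum T v n (T^[l] y)| ≤ A + 2 * H * B := by
  have hH0 : 0 ≤ H := (abs_nonneg _).trans (hH y)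
  obtain ⟨j, r, hr, hk⟩ := exists_eq_birkhoffSum_add (T := T) hτ (l + n) y
  have hj : j ≤ N := by
    rcases j with _ | j
    · omega
    · have := add_le_birkhoffSum_succ hτ (inducedMap T τ) j y
      omega
  have h1 : birkhoffSum T v n (T^[l] y) = birkhoffSum T v (l + n) y - birkhoffSum T v l y := by
    rw [birkhoffSum_add]; ring
  have h2 : birkhoffSum T v (l + n) y =
      birkhoffSum (inducedMap T τ) (fun z => birkhoffSum T v (τ z) z) j y
        + birkhoffSum T v r ((inducedMap T τ)^[j] y) := by
    rw [hk, birkhoffSum_add, birkhoffSum_inducedSum, iterate_inducedMap]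
  have h3 : |birkhoffSum T v r ((inducedMap T τ)^[j] y)| ≤ H * B := by
    refine (abs_birkhoffSum_le hH _ _).trans ?_
    have : (r : ℝ) ≤ B := le_trans (by exact_mod_cast hr.le) (hB j hj)
    gcongr
  have h4 : |birkhoffSum T v l y| ≤ H * B := by
    refine (abs_birkhoffSum_le hH _ _).trans ?_
    have : (l : ℝ) ≤ B := le_trans (by exact_mod_cast hl.le) (hB 0 (Nat.zero_le _))
    gcongr
  rw [h1, h2]
  have h5 := hA j hj
  rw [abs_le] at *
  constructor <;> linarith

lemma birkhoffSum_coboundary (F : M → M) {V φ χ : M → ℝ}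
    (hV : ∀ y, V y = φ y + χ (F y) - χ y) (j : ℕ) (y : M) :
    birkhoffSum F V j y = birkhoffSum F φ j y + χ (F^[j] y) - χ y := by
  induction j with
  | zero => simp
  | succ j ih =>
    rw [birkhoffSum_succ, birkhoffSum_succ, ih, hV, Function.iterate_succ_apply']
    ring

end Path

/-! ### The invariant measure and decomposition attached to a scheme -/

section InducedSystem

variable {M : Type*} [MetricSpace M] [MeasurableSpace M] {m ν : Measure M} {T : M → M} {Y : Set M}
  {α : Set (Set M)} {τ : M → ℕ} {lam η C₀ C₁ : ℝ}

omit [MetricSpace M] in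
lemma isProbabilityMeasure_baseMeasure [IsFiniteMeasure m] (hY : 0 < m Y) :
    IsProbabilityMeasure (baseMeasure m Y) := by
  constructor
  rw [baseMeasure, Measure.smul_apply, Measure.restrict_apply_univ, smul_eq_mul,
    ENNReal.inv_mul_cancel hY.ne' (measure_ne_top _ _)]

omit [MetricSpace M] in
lemma laverage_eq_lintegral_baseMeasure (f : M → ℝ≥0∞) :
    ⨍⁻ x in Y, f x ∂m = ∫⁻ x, f x ∂(baseMeasure m Y) := by
  rw [laverage, Measure.restrict_apply_univ, baseMeasure]

lemma natCast_le_rpow {p : ℝ} (hp : 1 < p) {n : ℕ} (hn : 1 ≤ n) : (n : ℝ≥0∞) ≤ (n : ℝ≥0∞) ^ p := by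
  have h1 : (1 : ℝ≥0∞) ≤ n := by exact_mod_cast hn
  calc (n : ℝ≥0∞) = (n : ℝ≥0∞) ^ (1 : ℝ) := (ENNReal.rpow_one _).symm
    _ ≤ _ := ENNReal.rpow_le_rpow_of_exponent_le h1 hp.le

/-- The bound on the coboundary in terms of the constants of the scheme. -/
noncomputable def schemeCoboundaryConst (lam η C₀ C₁ D H K : ℝ) : ℝ :=
  coboundaryConst (lam ^ (-η)) C₁ (D ^ η) * (H * C₀ * D ^ (1 - η) * K)

/-- The bound on the density of the invariant measure of the induced map. -/
noncomputable def schemeDensityConst (lam η C₁ D : ℝ) : ℝ :=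
  Real.exp (coneConst (lam ^ (-η)) C₁ * D ^ η)

omit [MeasurableSpace M] in
lemma dist_le_rpow_mul_rpow {D : ℝ} (hD : ∀ x y : M, dist x y ≤ D) (hη : 0 < η) (hη1 : η ≤ 1)
    (x y : M) : dist x y ≤ D ^ (1 - η) * dist x y ^ η := by
  calc dist x y = dist x y ^ ((1 - η) + η) := by rw [sub_add_cancel, Real.rpow_one]
    _ = dist x y ^ (1 - η) * dist x y ^ η :=
        Real.rpow_add_of_nonneg dist_nonneg (by linarith) hη.le
    _ ≤ _ := by
        refine mul_le_mul_of_nonneg_right ?_ (by positivity)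
        exact Real.rpow_le_rpow dist_nonneg (hD x y) (by linarith)

omit [MetricSpace M] in
lemma coboundaryConst_nonneg {ι : Type*} {μ : Measure M} [IsProbabilityMeasure μ]
    {F : M → M} {Z : Set M} {s : ι → M → M} {g : ι → M → ℝ} {ρ : M → M → ℝ} {θ C₁ R : ℝ}
    (h : IsFullBranch μ F Z s g ρ θ C₁ R) : 0 ≤ coboundaryConst θ C₁ R := by
  have := h.coneConst_pos
  have := h.gapConst_pos
  have := h.distortion_pos
  unfold coboundaryConst
  positivity

/-- Assembles the full-branch theory for one scheme with bounds depending only on its constants, on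
`D`, `H` and on `K`: this is what makes the final constant uniform in `ε`. -/
theorem IsInducingScheme.exists_induced_system [StandardBorelSpace M] [BorelSpace M]
    [IsFiniteMeasure m] (hs : IsInducingScheme m T Y α τ lam η C₀ C₁) (hT : QuasiErgodic T m)
    (hτ : Measurable τ) (hτ1 : ∀ y, 1 ≤ τ y) (hlam : 1 < lam) (hη : 0 < η) (hη1 : η ≤ 1)
    (hC₀ : 1 ≤ C₀) (hC₁ : 1 ≤ C₁) {D : ℝ} (hD1 : 1 ≤ D) (hD : ∀ x y : M, dist x y ≤ D)
    {p : ℝ} (hp : 1 < p) {K : ℝ≥0} (hK : ⨍⁻ x in Y, (τ x : ℝ≥0∞) ^ p ∂m ≤ K)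
    [IsProbabilityMeasure ν] (hν : MeasurePreserving T ν ν) (hνm : ν ≪ m) :
    ∃ σ : Measure M, IsProbabilityMeasure σ ∧ MeasurePreserving (inducedMap T τ) σ σ ∧
      ∫⁻ y, (τ y : ℝ≥0∞) ^ p ∂σ ≤ ENNReal.ofReal (schemeDensityConst lam η C₁ D * K) ∧
      towerMeasure σ T τ = (∫⁻ y, τ y ∂σ) • ν ∧
      ∀ (v : M → ℝ) (H : ℝ), (∀ y, |v y| ≤ H) → (∀ y y', |v y - v y'| ≤ H * dist y y') →
        ∫ y, v y ∂ν = 0 →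
        ∃ φ χ : M → ℝ, Measurable φ ∧ Measurable χ ∧
          (∀ y, birkhoffSum T v (τ y) y = φ y + χ (inducedMap T τ y) - χ y) ∧
          (∀ᵐ y ∂σ, |χ y| ≤ schemeCoboundaryConst lam η C₀ C₁ D H K) ∧
          ∀ w : M → ℝ, Measurable w → Integrable (fun y => w (inducedMap T τ y) * φ y) σ →
            ∫ y, w (inducedMap T τ y) * φ y ∂σ = 0 := by
  have hTm := hT.measurable
  obtain ⟨Z, s, g, hF, hsA⟩ := hs.exists_isFullBranch hTm hτ hlam hη hC₁ hD
  have hprob := isProbabilityMeasure_baseMeasure (m := m) hs.base_pos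
  have : Countable α := hs.countable.to_subtype
  set μ := baseMeasure m Y with hμ
  set θ := lam ^ (-η) with hθ
  set R := D ^ η with hR
  obtain ⟨h, hh⟩ := hF.exists_isInvariantDensity
  have hhm := hh.isLogLip.measurable
  have hσprob := hF.isProbabilityMeasure_withDensity hh
  have hσF := hF.measurePreserving_withDensity hh
  have hσμ : (μ.withDensity fun y => ENNReal.ofReal (h y)) ≪ μ := withDensity_absolutelyContinuous _ _
  have hμm : μ ≪ m :=
    Measure.smul_absolutelyContinuous.trans Measure.restrict_le_self.absolutelyContinuous
  have hσint : ∀ f : M → ℝ, Integrable f (μ.withDensity fun y => ENNReal.ofReal (h y)) ↔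
      Integrable (fun y => h y * f y) μ :=
    IsFullBranch.integrable_withDensity_ofReal_iff hhm hh.pos
  have hσeq : ∀ f : M → ℝ, ∫ y, f y ∂(μ.withDensity fun y => ENNReal.ofReal (h y))
      = ∫ y, h y * f y ∂μ := IsFullBranch.integral_withDensity_ofReal hhm hh.pos
  have horth := fun (φ w : M → ℝ) hφ hw => hF.integral_comp_mul_eq_zero hh (φ := φ) (w := w) hφ hw
  have hσae := fun (P : M → Prop) (hP : ∀ y ∈ Z, P y) => hF.ae_withDensity (h := h) hP
  have hτp : Measurable fun y => (τ y : ℝ≥0∞) ^ p :=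
    ((measurable_from_top (f := fun n : ℕ => (n : ℝ≥0∞))).comp hτ).pow_const p
  rw [laverage_eq_lintegral_baseMeasure] at hK
  have hKσ : ∫⁻ y, (τ y : ℝ≥0∞) ^ p ∂(μ.withDensity fun y => ENNReal.ofReal (h y))
      ≤ ENNReal.ofReal (schemeDensityConst lam η C₁ D * K) := by
    rw [lintegral_withDensity_eq_lintegral_mul _ hhm.ennreal_ofReal hτp]
    calc _ ≤ ∫⁻ y, ENNReal.ofReal (schemeDensityConst lam η C₁ D) * (τ y : ℝ≥0∞) ^ p ∂μ := by
          refine lintegral_mono_ae (hF.ae_mem.mono fun y hy => ?_)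
          simp only [Pi.mul_apply]
          gcongr
          have h1 := hF.le_exp_mul_integral hF.coneConst_pos.le hh.isLogLip hy
          rwa [hh.integral_eq_one, mul_one] at h1
      _ = ENNReal.ofReal (schemeDensityConst lam η C₁ D) * ∫⁻ y, (τ y : ℝ≥0∞) ^ p ∂μ :=
          lintegral_const_mul _ hτp
      _ ≤ ENNReal.ofReal (schemeDensityConst lam η C₁ D) * K := by gcongr
      _ = _ := by
          rw [ENNReal.ofReal_mul (by exact (Real.exp_pos _).le), ENNReal.ofReal_coe_nnreal]
  set σ := μ.withDensity fun y => ENNReal.ofReal (h y) with hσ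
  have hτσ : ∫⁻ y, (τ y : ℝ≥0∞) ∂σ ≠ ∞ := by
    refine ((lintegral_mono fun y => natCast_le_rpow hp (hτ1 y)).trans hKσ).trans_lt
      ENNReal.ofReal_lt_top |>.ne
  have htower : towerMeasure σ T τ = (∫⁻ y, τ y ∂σ) • ν :=
    towerMeasure_eq_smul hT hτ hν hνm (hσμ.trans hμm) hσF hτσ
  have hτreal : Measurable fun y => (τ y : ℝ) :=
    (measurable_from_top (f := fun n : ℕ => (n : ℝ))).comp hτ
  have hτi : Integrable (fun y => (τ y : ℝ)) σ := by
    refine ⟨hτreal.aestronglyMeasurable, ?_⟩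
    rw [hasFiniteIntegral_iff_ofReal (ae_of_all _ fun y => Nat.cast_nonneg _)]
    simpa using hτσ.lt_top
  refine ⟨σ, hσprob, hσF, hKσ, htower, fun v H hH hL hv0 => ?_⟩
  have hH0 : 0 ≤ H := by
    obtain ⟨y⟩ := nonempty_of_isProbabilityMeasure ν
    exact (abs_nonneg _).trans (hH y)
  have hvm : Measurable v := by
    have : LipschitzWith H.toNNReal v := LipschitzWith.of_dist_le_mul fun x y => by
      rw [Real.dist_eq, Real.coe_toNNReal _ hH0]; exact hL x y
    exact this.continuous.measurable
  have hVm := measurable_inducedSum hTm hτ hvm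
  obtain ⟨hVi, hV0⟩ := integral_inducedSum_eq_zero hTm hτ htower hτi hvm hH hv0
  have hne : ∀ A : α, (A : Set M).Nonempty := fun A =>
    nonempty_of_measure_ne_zero (hs.elem_pos A A.2).ne'
  choose x₁ hx₁ using hne
  -- Lipschitz in `dist` becomes Lipschitz in the gauge at the price `D ^ (1 - η)`. Condition (3)
  -- and `τ` summands give oscillation at most `c τ` on a partition element; `c ≥ H` also covers the
  -- sup bound.
  set c := H * C₀ * D ^ (1 - η) with hc
  have hD0 : 1 ≤ D ^ (1 - η) := Real.one_le_rpow hD1 (by linarith)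
  have hHc : H ≤ c := by
    rw [hc, mul_assoc]
    exact le_mul_of_one_le_right hH0 (by nlinarith)
  have hc0 : 0 ≤ c := hH0.trans hHc
  have hτs : ∀ A : α, ∀ y ∈ Z, τ (s A y) = τ (x₁ A) := fun A y hy =>
    hs.time_const A A.2 _ (hsA A y hy) _ (hx₁ A)
  have hw0 : ∀ A : α, 0 ≤ ∫ z, g A z ∂μ := fun A => integral_nonneg (hF.weight_nonneg A)
  -- The sum is `∫ τ` for the normalised base measure, since `τ` is constant on each branch range;
  -- and `τ ≤ τ ^ p`.
  have hsumτ : ∑' A : α, ENNReal.ofReal ((∫ z, g A z ∂μ) * τ (x₁ A)) ≤ K := by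
    have h1 := hF.lintegral_eq_tsum (f := fun y => (τ y : ℝ≥0∞))
      ((measurable_from_top (f := fun n : ℕ => (n : ℝ≥0∞))).comp hτ)
    have h2 : ∀ A : α, ∫⁻ y, ENNReal.ofReal (g A y) * (τ (s A y) : ℝ≥0∞) ∂μ
        = ENNReal.ofReal ((∫ z, g A z ∂μ) * τ (x₁ A)) := by
      intro A
      have h3 : ∫⁻ y, ENNReal.ofReal (g A y) * (τ (s A y) : ℝ≥0∞) ∂μ
          = ∫⁻ y, ENNReal.ofReal (g A y) * (τ (x₁ A) : ℝ≥0∞) ∂μ :=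
        lintegral_congr_ae (hF.ae_mem.mono fun y hy => by simp only [hτs A y hy])
      rw [h3, lintegral_mul_const _ (hF.measurable_weight A).ennreal_ofReal,
        ENNReal.ofReal_mul (hw0 A), ofReal_integral_eq_lintegral_ofReal (hF.integrable_weight A)
        (ae_of_all _ (hF.weight_nonneg A)), ENNReal.ofReal_natCast]
    simp_rw [h2] at h1
    rw [← h1]
    exact (lintegral_mono fun y => natCast_le_rpow hp (hτ1 y)).trans hK
  have hwτ0 : ∀ A : α, 0 ≤ (∫ z, g A z ∂μ) * τ (x₁ A) := fun A =>
    mul_nonneg (hw0 A) (Nat.cast_nonneg _)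
  have hsummable : Summable fun A : α => (∫ z, g A z ∂μ) * τ (x₁ A) := by
    have h1 := ENNReal.summable_toReal (ne_top_of_le_ne_top ENNReal.coe_ne_top hsumτ)
    simpa only [ENNReal.toReal_ofReal (hwτ0 _)] using h1
  have htsumle : ∑' A : α, (∫ z, g A z ∂μ) * τ (x₁ A) ≤ K := by
    rw [← ENNReal.ofReal_tsum_of_nonneg hwτ0 hsummable] at hsumτ
    rw [← ENNReal.ofReal_coe_nnreal] at hsumτ
    exact (ENNReal.ofReal_le_ofReal_iff K.2).1 hsumτ
  have he : ∀ A : α, (∫ z, g A z ∂μ) * (c * τ (x₁ A)) = c * ((∫ z, g A z ∂μ) * τ (x₁ A)) :=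
    fun A => by ring
  obtain ⟨χ, hχm, hχb, hχ0⟩ := hF.exists_coboundary hh hVm (t := fun A => c * τ (x₁ A))
    (fun A => mul_nonneg hc0 (Nat.cast_nonneg _)) (fun A y hy => by
      refine (abs_birkhoffSum_le hH _ _).trans ?_
      rw [hτs A y hy]
      gcongr)
    (fun A y hy y' hy' => by
      have h1 := hs.intermediate A A.2 _ (hsA A y hy) _ (hsA A y' hy')
      rw [hF.map_branch A y hy, hF.map_branch A y' hy', hτs A y hy] at h1
      rw [hτs A y hy, hτs A y' hy', birkhoffSum, birkhoffSum, ← Finset.sum_sub_distrib]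
      refine (Finset.abs_sum_le_sum_abs _ _).trans ?_
      have h2 : ∀ l ∈ Finset.range (τ (x₁ A)), |v (T^[l] (s A y)) - v (T^[l] (s A y'))|
          ≤ c * dist y y' ^ η := by
        intro l hl
        calc _ ≤ H * dist (T^[l] (s A y)) (T^[l] (s A y')) := hL _ _
          _ ≤ H * (C₀ * (D ^ (1 - η) * dist y y' ^ η)) := by
              gcongr
              refine (h1 l (Finset.mem_range.1 hl)).trans ?_
              gcongr
              exact dist_le_rpow_mul_rpow hD hη hη1 y y'
          _ = _ := by rw [hc]; ring
      refine (Finset.sum_le_sum h2).trans (le_of_eq ?_)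
      rw [Finset.sum_const, Finset.card_range, nsmul_eq_mul]
      ring)
    (by simp_rw [he]; exact hsummable.mul_left c) ((hσint _).1 hVi) ((hσeq _).symm.trans hV0)
  have hφm : Measurable fun y => birkhoffSum T v (τ y) y + χ y - χ (inducedMap T τ y) :=
    (hVm.add hχm).sub (hχm.comp hF.measurable_map)
  refine ⟨_, χ, hφm, hχm, fun y => by ring, hσae _ fun y hy => (hχb y hy).trans ?_,
    fun w hw hi => horth _ w hφm hw hχ0 hi⟩
  simp_rw [he]
  rw [tsum_mul_left, schemeCoboundaryConst]
  have := coboundaryConst_nonneg hF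
  gcongr

end InducedSystem

/-! ### Moments of maximal Birkhoff sums at a fixed parameter -/

section MomentBound

/-- `max_{n ≤ N} |∑_{j < n} v (T^j y)|`. -/
noncomputable def maxBirkhoff {M : Type*} (T : M → M) (v : M → ℝ) (N : ℕ) (y : M) : ℝ :=
  (Finset.range (N + 1)).sup' Finset.nonempty_range_add_one fun n => |birkhoffSum T v n y|

lemma abs_birkhoffSum_le_maxBirkhoff {M : Type*} (T : M → M) (v : M → ℝ) {n N : ℕ} (hn : n ≤ N)
    (y : M) : |birkhoffSum T v n y| ≤ maxBirkhoff T v N y :=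
  Finset.le_sup' (fun n => |birkhoffSum T v n y|) (Finset.mem_range.2 (by omega))

lemma maxBirkhoff_nonneg {M : Type*} (T : M → M) (v : M → ℝ) (N : ℕ) (y : M) :
    0 ≤ maxBirkhoff T v N y :=
  (abs_nonneg _).trans (abs_birkhoffSum_le_maxBirkhoff T v (Nat.zero_le N) y)

lemma measurable_maxBirkhoff {M : Type*} [MeasurableSpace M] {T : M → M} (hT : Measurable T)
    {v : M → ℝ} (hv : Measurable v) (N : ℕ) : Measurable (maxBirkhoff T v N) := by
  have h := Finset.measurable_sup' (s := Finset.range (N + 1)) Finset.nonempty_range_add_one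
    (f := fun n y => |birkhoffSum T v n y|) fun n _ => (measurable_birkhoffSum hT hv n).abs
  have h1 : maxBirkhoff T v N = (Finset.range (N + 1)).sup' Finset.nonempty_range_add_one
      (fun n y => |birkhoffSum T v n y|) := by
    funext y
    rw [Finset.sup'_apply, maxBirkhoff]
  rwa [h1]

/-- Young's inequality for `a` and `G / N ^ (κ / p)`. This is the natural scale, as `G ^ p` will
have mean of order `N ^ κ`. -/
lemma mul_rpow_sub_one_le {p κ a G : ℝ} (hp : 1 < p) {N : ℕ} (hN : 1 ≤ N) (ha : 0 ≤ a)
    (hG : 0 ≤ G) :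
    a * G ^ (p - 1) ≤ (N : ℝ) ^ (κ / p * (p - 1)) * (G ^ p / (N : ℝ) ^ κ + a ^ p) := by
  have hN0 : (0 : ℝ) < N := by exact_mod_cast hN
  set b := (N : ℝ) ^ (κ / p) with hb
  have hb0 : 0 < b := by positivity
  have h1 := rpow_sub_one_mul_le hp (div_nonneg hG hb0.le) ha
  have h2 : (G / b) ^ p = G ^ p / (N : ℝ) ^ κ := by
    rw [Real.div_rpow hG hb0.le, hb, ← Real.rpow_mul hN0.le, div_mul_cancel₀ _ (by linarith)]
  have h3 : (G / b) ^ (p - 1) = G ^ (p - 1) / (N : ℝ) ^ (κ / p * (p - 1)) := by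
    rw [Real.div_rpow hG hb0.le, hb, ← Real.rpow_mul hN0.le]
  rw [h2, h3] at h1
  have h4 : 0 < (N : ℝ) ^ (κ / p * (p - 1)) := by positivity
  calc a * G ^ (p - 1) = (N : ℝ) ^ (κ / p * (p - 1)) *
        (G ^ (p - 1) / (N : ℝ) ^ (κ / p * (p - 1)) * a) := by field_simp
    _ ≤ _ := by gcongr

variable {M : Type*} [MetricSpace M] [MeasurableSpace M] [BorelSpace M]

lemma sum_rpow_bound {Ω : Type*} [MeasurableSpace Ω] {σ : Measure Ω} {F : Ω → Ω}
    (hF : MeasurePreserving F σ σ) {f : Ω → ℝ} (hfm : Measurable f) {P : ℝ}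
    (hf : Integrable f σ) (hP : ∫ y, f y ∂σ ≤ P) (n : ℕ) :
    Integrable (fun y => ∑ j ∈ Finset.range n, f (F^[j] y)) σ ∧
      ∫ y, ∑ j ∈ Finset.range n, f (F^[j] y) ∂σ ≤ n * P := by
  have h1 : ∀ j, Integrable (fun y => f (F^[j] y)) σ := fun j =>
    (hF.iterate j).integrable_comp_of_integrable hf
  refine ⟨integrable_finsetSum _ fun j _ => h1 j, ?_⟩
  rw [integral_finsetSum _ fun j _ => h1 j]
  have h2 : ∀ j ∈ Finset.range n, ∫ y, f (F^[j] y) ∂σ ≤ P := fun j _ => by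
    rw [← integral_map (f := f) (hF.iterate j).aemeasurable hfm.aestronglyMeasurable,
      (hF.iterate j).map_eq]
    exact hP
  exact (Finset.sum_le_sum h2).trans (le_of_eq (by simp))

/-- A single function `G` on the base dominates the maximal sums started anywhere on the fibre, and
`∫ G ^ p dσ` is of order `N ^ κ`. Summing over the fibre gives `τ G ^ (p - 1)`: one power of
integrability is spent on `τ`, whence the exponent `p - 1`. -/
theorem exists_maxBirkhoff_moment_bound [StandardBorelSpace M] {lam η C₀ C₁ D p H : ℝ} {K : ℝ≥0}
    (hlam : 1 < lam) (hη : 0 < η) (hη1 : η ≤ 1) (hC₀ : 1 ≤ C₀) (hC₁ : 1 ≤ C₁) (hD1 : 1 ≤ D)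
    (hD : ∀ x y : M, dist x y ≤ D) (hp : 1 < p) (hH0 : 0 ≤ H) :
    ∃ C : ℝ, 0 < C ∧ ∀ (m : Measure M) [IsFiniteMeasure m] (T : M → M) (Y : Set M)
      (α : Set (Set M)) (τ : M → ℕ) (ν : Measure M) [IsProbabilityMeasure ν],
      IsInducingScheme m T Y α τ lam η C₀ C₁ → QuasiErgodic T m →
      ⨍⁻ x in Y, (τ x : ℝ≥0∞) ^ p ∂m ≤ K → MeasurePreserving T ν ν → ν ≪ m →
      ∀ v : M → ℝ, (∀ y, |v y| ≤ H) → (∀ y y', |v y - v y'| ≤ H * dist y y') →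
        ∫ y, v y ∂ν = 0 → ∀ N : ℕ, 1 ≤ N →
        ∫⁻ y, ENNReal.ofReal (maxBirkhoff T v N y ^ (p - 1)) ∂ν
          ≤ ENNReal.ofReal (C * N ^ (momentExponent p / p * (p - 1))) := by
  obtain ⟨C₂, hC₂, hmax⟩ := exists_integral_tailMax_rpow_le hp
  set X := schemeCoboundaryConst lam η C₀ C₁ D H K with hX
  set P := schemeDensityConst lam η C₁ D * K with hP
  have hP0 : 0 ≤ P := mul_nonneg (Real.exp_pos _).le K.2
  set Φ := 2 ^ p * (H ^ p * P + (2 * |X|) ^ p) with hΦ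
  have hΦ0 : 0 ≤ Φ := by positivity
  set Γ := 2 ^ p * (2 ^ p * (C₂ * Φ) + 2 ^ p * ((2 * |X|) ^ p + (2 * H) ^ p * (2 * P))) with hΓ
  have hΓ0 : 0 ≤ Γ := by positivity
  refine ⟨Γ + P + 1, by positivity, ?_⟩
  intro m _ T Y α τ₀ ν _ hs₀ hT hK₀ hν hνm v hvH hvL hv0 N hN
  obtain ⟨τ, hτ, hτ1, hττ⟩ := hs₀.exists_measurable_time
  have hs := hs₀.congr hττ
  have hK : ⨍⁻ x in Y, (τ x : ℝ≥0∞) ^ p ∂m ≤ K := by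
    refine le_trans (le_of_eq (laverage_congr ?_)) hK₀
    filter_upwards [hs₀.ae_mem_sUnion] with x ⟨A, hA, hxA⟩
    rw [hττ A hA x hxA]
  clear hs₀ hττ hK₀
  obtain ⟨σ, hσ, hF, hKσ, htower, hdec⟩ := hs.exists_induced_system hT hτ hτ1 hlam hη hη1 hC₀ hC₁
    hD1 hD hp hK hν hνm
  obtain ⟨φ, χ, hφ, hχ, hV, hχb, horth⟩ := hdec v H hvH hvL hv0
  have hTm := hT.measurable
  have hvm : Measurable v := by
    have : LipschitzWith H.toNNReal v := LipschitzWith.of_dist_le_mul fun x y => by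
      rw [Real.dist_eq, Real.coe_toNNReal _ hH0]; exact hvL x y
    exact this.continuous.measurable
  set F := inducedMap T τ with hFdef
  have hτr : Measurable fun y => (τ y : ℝ) :=
    (measurable_from_top (f := fun n : ℕ => (n : ℝ))).comp hτ
  have hτpm : Measurable fun y => (τ y : ℝ) ^ p := hτr.pow_const p
  have hτp0 : ∀ y, 0 ≤ (τ y : ℝ) ^ p := fun y => by positivity
  have hofτ : ∀ y, ENNReal.ofReal ((τ y : ℝ) ^ p) = (τ y : ℝ≥0∞) ^ p := fun y => by
    rw [← ENNReal.ofReal_rpow_of_nonneg (Nat.cast_nonneg _) (by linarith), ENNReal.ofReal_natCast]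
  have hτi : Integrable (fun y => (τ y : ℝ) ^ p) σ := by
    refine ⟨hτpm.aestronglyMeasurable, ?_⟩
    rw [hasFiniteIntegral_iff_ofReal (ae_of_all _ hτp0)]
    simp_rw [hofτ]
    exact hKσ.trans_lt ENNReal.ofReal_lt_top
  have hτP : ∫ y, (τ y : ℝ) ^ p ∂σ ≤ P := by
    rw [← ENNReal.ofReal_le_ofReal_iff hP0, ofReal_integral_eq_lintegral_ofReal hτi
      (ae_of_all _ hτp0)]
    simp_rw [hofτ]
    exact hKσ
  have hχorb : ∀ᵐ y ∂σ, ∀ j, |χ (F^[j] y)| ≤ |X| := by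
    rw [ae_all_iff]
    intro j
    have h1 : ∀ᵐ y ∂σ, |χ y| ≤ |X| := hχb.mono fun y hy => hy.trans (le_abs_self X)
    exact (hF.iterate j).quasiMeasurePreserving.ae h1
  have hφb : ∀ᵐ y ∂σ, |φ y| ^ p ≤ 2 ^ p * (H ^ p * (τ y : ℝ) ^ p + (2 * |X|) ^ p) := by
    filter_upwards [hχorb] with y hy
    have h1 := abs_birkhoffSum_le (T := T) hvH (τ y) y
    have h2 : φ y = birkhoffSum T v (τ y) y + (χ y - χ (F y)) := by rw [hV y]; ring
    have h3 : |χ y - χ (F y)| ≤ 2 * |X| := by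
      refine (abs_sub _ _).trans ?_
      have := hy 0
      have := hy 1
      simp only [Function.iterate_zero, id_eq, Function.iterate_one] at *
      linarith
    rw [h2]
    refine (abs_add_rpow_le_two (by linarith) _ _).trans ?_
    rw [← Real.mul_rpow hH0 (Nat.cast_nonneg _)]
    gcongr
  have hbi : Integrable (fun y => 2 ^ p * (H ^ p * (τ y : ℝ) ^ p + (2 * |X|) ^ p)) σ :=
    ((hτi.const_mul _).add (integrable_const _)).const_mul _
  have hφi : Integrable (fun y => |φ y| ^ p) σ := by
    refine hbi.mono' (hφ.abs.pow_const p).aestronglyMeasurable (hφb.mono fun y hy => ?_)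
    rwa [Real.norm_of_nonneg (by positivity)]
  have hφΦ : ∫ y, |φ y| ^ p ∂σ ≤ Φ := by
    refine (integral_mono_ae hφi hbi hφb).trans ?_
    rw [integral_const_mul, integral_add (hτi.const_mul _) (integrable_const _),
      integral_const_mul]
    simp only [integral_const, probReal_univ, smul_eq_mul, one_mul]
    rw [hΦ]
    gcongr
  have hDi := integrable_tailMax_rpow hp hF hφ hφi N
  have hDb := hmax hF hφ hφi horth N hN
  obtain ⟨hWi, hWb⟩ := sum_rpow_bound hF hτpm hτi hτP (N + 1)
  set κ := momentExponent p with hκ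
  have hN1 : (1 : ℝ) ≤ N := by exact_mod_cast hN
  have hκ1 : 1 ≤ κ := le_max_right _ _
  have hNκ : (N : ℝ) ≤ (N : ℝ) ^ κ := by
    calc (N : ℝ) = (N : ℝ) ^ (1 : ℝ) := (Real.rpow_one _).symm
      _ ≤ _ := Real.rpow_le_rpow_of_exponent_le hN1 hκ1
  -- `W ^ p⁻¹` dominates the return times met along `N` returns. Invariance of `σ` bounds the mean
  -- of `W` by `(N + 1) P`, which is at most `2 P N ^ κ`.
  set W : M → ℝ := fun y => (∑ j ∈ Finset.range (N + 1), (τ (F^[j] y) : ℝ) ^ p) with hW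
  have hW0 : ∀ y, 0 ≤ W y := fun y => Finset.sum_nonneg fun j _ => hτp0 _
  have hWp : ∀ y, (W y ^ p⁻¹) ^ p = W y := fun y => by
    rw [← Real.rpow_mul (hW0 y), inv_mul_cancel₀ (by linarith), Real.rpow_one]
  have hWj : ∀ y, ∀ j ≤ N, (τ (F^[j] y) : ℝ) ≤ W y ^ p⁻¹ := by
    intro y j hj
    rw [Real.le_rpow_inv_iff_of_pos (Nat.cast_nonneg _) (hW0 y) (by linarith)]
    exact Finset.single_le_sum (f := fun j => (τ (F^[j] y) : ℝ) ^ p) (fun j _ => hτp0 _)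
      (Finset.mem_range.2 (by omega))
  -- Twice the tail maximum for the martingale part, `2 |X|` for the two boundary values of the
  -- coboundary, and the two incomplete returns at the ends of the orbit segment.
  set G : M → ℝ := fun y => 2 * tailMax F φ N y + (2 * |X| + 2 * H * W y ^ p⁻¹) with hG
  have hD0 : ∀ y, 0 ≤ tailMax F φ N y := tailMax_nonneg N
  have hG0 : ∀ y, 0 ≤ G y := fun y => by
    have := hD0 y
    have := Real.rpow_nonneg (hW0 y) p⁻¹
    positivity
  have hGp : ∀ y, G y ^ p ≤ 2 ^ p * (2 ^ p * tailMax F φ N y ^ p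
      + 2 ^ p * ((2 * |X|) ^ p + (2 * H) ^ p * W y)) := by
    intro y
    have h0 := Real.rpow_nonneg (hW0 y) p⁻¹
    have h1 := abs_add_rpow_le_two (p := p) (by linarith) (2 * tailMax F φ N y)
      (2 * |X| + 2 * H * W y ^ p⁻¹)
    have h2 := abs_add_rpow_le_two (p := p) (by linarith) (2 * |X|) (2 * H * W y ^ p⁻¹)
    have h3 := hD0 y
    rw [abs_of_nonneg (hG0 y), abs_of_nonneg (by positivity : 0 ≤ 2 * tailMax F φ N y),
      Real.mul_rpow (by norm_num) h3] at h1
    rw [abs_of_nonneg (by positivity : 0 ≤ 2 * |X|),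
      abs_of_nonneg (by positivity : 0 ≤ 2 * H * W y ^ p⁻¹),
      Real.mul_rpow (x := 2 * H) (by positivity) h0, hWp] at h2
    refine h1.trans ?_
    gcongr
  have hGbi : Integrable (fun y => 2 ^ p * (2 ^ p * tailMax F φ N y ^ p
      + 2 ^ p * ((2 * |X|) ^ p + (2 * H) ^ p * W y))) σ :=
    ((hDi.const_mul _).add (((integrable_const _).add (hWi.const_mul _)).const_mul _)).const_mul _
  have hGm : Measurable G := by
    have h1 := measurable_tailMax hF.measurable hφ N
    have h2 : Measurable W := Finset.measurable_fun_sum _ fun j _ =>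
      hτpm.comp (hF.measurable.iterate j)
    exact (h1.const_mul 2).add (((h2.pow_const _).const_mul _).const_add _)
  have hGi : Integrable (fun y => G y ^ p) σ := by
    refine hGbi.mono' (hGm.pow_const p).aestronglyMeasurable (ae_of_all _ fun y => ?_)
    rw [Real.norm_of_nonneg (Real.rpow_nonneg (hG0 y) p)]
    exact hGp y
  have hGΓ : ∫ y, G y ^ p ∂σ ≤ (N : ℝ) ^ κ * Γ := by
    refine (integral_mono hGi hGbi hGp).trans ?_
    have hWi' : Integrable (fun y => (2 * |X|) ^ p + (2 * H) ^ p * W y) σ :=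
      (integrable_const _).add (hWi.const_mul _)
    rw [integral_const_mul, integral_add (hDi.const_mul _) (hWi'.const_mul _),
      integral_const_mul, integral_const_mul, integral_add (integrable_const _)
      (hWi.const_mul _), integral_const_mul]
    simp only [integral_const, probReal_univ, smul_eq_mul, one_mul]
    have h1 : ∫ y, tailMax F φ N y ^ p ∂σ ≤ (N : ℝ) ^ κ * (C₂ * Φ) := by
      refine hDb.trans ?_
      calc _ ≤ C₂ * (N : ℝ) ^ κ * Φ := by gcongr
        _ = _ := by ring
    have h2 : ∫ y, W y ∂σ ≤ (N : ℝ) ^ κ * (2 * P) := by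
      refine hWb.trans ?_
      push_cast
      nlinarith
    have h3 : (2 * |X|) ^ p ≤ (N : ℝ) ^ κ * (2 * |X|) ^ p :=
      le_mul_of_one_le_left (by positivity) (hN1.trans hNκ)
    calc _ ≤ 2 ^ p * (2 ^ p * ((N : ℝ) ^ κ * (C₂ * Φ)) + 2 ^ p * ((N : ℝ) ^ κ * (2 * |X|) ^ p
          + (2 * H) ^ p * ((N : ℝ) ^ κ * (2 * P)))) := by gcongr
      _ = _ := by rw [hΓ]; ring
  have hpath : ∀ᵐ y ∂σ, ∀ l < τ y, maxBirkhoff T v N (T^[l] y) ≤ G y := by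
    filter_upwards [hχorb] with y hy l hl
    refine Finset.sup'_le _ _ fun n hn => ?_
    have hn' : n ≤ N := by have := Finset.mem_range.1 hn; omega
    have h1 := abs_birkhoffSum_iterate_le hτ1 hvH (T := T) hn' hl
      (A := 2 * tailMax F φ N y + 2 * |X|) (B := W y ^ p⁻¹) (fun j hj => ?_) (hWj y)
    · exact h1.trans (le_of_eq (by rw [hG]; ring))
    · rw [birkhoffSum_coboundary F hV]
      have h2 := abs_birkhoffSum_le_two_mul_tailMax (F := F) (φ := φ) hj y
      have h3 := hy j
      have h4 := hy 0
      simp only [Function.iterate_zero, id_eq] at h4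
      rw [abs_le] at *
      constructor <;> linarith
  have hfm : Measurable fun y => ENNReal.ofReal (maxBirkhoff T v N y ^ (p - 1)) :=
    ((measurable_maxBirkhoff hTm hvm N).pow_const _).ennreal_ofReal
  have hbound : Integrable (fun y => (N : ℝ) ^ (κ / p * (p - 1)) *
      (G y ^ p / (N : ℝ) ^ κ + (τ y : ℝ) ^ p)) σ :=
    ((hGi.div_const _).add hτi).const_mul _
  calc _ ≤ ∫⁻ y, ∑ l ∈ Finset.range (τ y),
          ENNReal.ofReal (maxBirkhoff T v N (T^[l] y) ^ (p - 1)) ∂σ :=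
        lintegral_le_lintegral_sum hTm hτ hτ1 htower hfm
    _ ≤ ∫⁻ y, ENNReal.ofReal ((N : ℝ) ^ (κ / p * (p - 1)) *
          (G y ^ p / (N : ℝ) ^ κ + (τ y : ℝ) ^ p)) ∂σ := by
        refine lintegral_mono_ae (hpath.mono fun y hy => ?_)
        have h1 : ∀ l ∈ Finset.range (τ y), ENNReal.ofReal (maxBirkhoff T v N (T^[l] y) ^ (p - 1))
            ≤ ENNReal.ofReal (G y ^ (p - 1)) := fun l hl => by
          refine ENNReal.ofReal_le_ofReal (Real.rpow_le_rpow (maxBirkhoff_nonneg _ _ _ _)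
            (hy l (Finset.mem_range.1 hl)) (by linarith))
        refine (Finset.sum_le_sum h1).trans ?_
        rw [Finset.sum_const, Finset.card_range, nsmul_eq_mul, ← ENNReal.ofReal_natCast,
          ← ENNReal.ofReal_mul (Nat.cast_nonneg _)]
        exact ENNReal.ofReal_le_ofReal
          (mul_rpow_sub_one_le hp hN (Nat.cast_nonneg _) (hG0 y))
    _ = ENNReal.ofReal (∫ y, (N : ℝ) ^ (κ / p * (p - 1)) *
          (G y ^ p / (N : ℝ) ^ κ + (τ y : ℝ) ^ p) ∂σ) :=
        (ofReal_integral_eq_lintegral_ofReal hbound (ae_of_all _ fun y => by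
          have := Real.rpow_nonneg (hG0 y) p
          positivity)).symm
    _ ≤ _ := by
        refine ENNReal.ofReal_le_ofReal ?_
        rw [integral_const_mul, integral_add (hGi.div_const _) hτi, integral_div, mul_comm]
        refine mul_le_mul_of_nonneg_right ?_ (by positivity)
        have h1 : (∫ y, G y ^ p ∂σ) / (N : ℝ) ^ κ ≤ Γ := by
          rw [div_le_iff₀ (by positivity), mul_comm]
          exact hGΓ
        linarith

end MomentBound

/-! ### Suprema over a finite-dimensional Lipschitz parameter -/

section SupremumOverParameter

variable {M : Type*} [MeasurableSpace M] {d : ℕ} {G : (Fin d → ℝ) → M → ℝ} {B L q : ℝ}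
  {x₀ : Fin d → ℝ}

lemma continuous_of_abs_sub_le {g : (Fin d → ℝ) → ℝ} (hB : 0 ≤ B)
    (hg : ∀ x x', |g x - g x'| ≤ B * dist x x') : Continuous g :=
  (LipschitzWith.of_dist_le_mul (K := ⟨B, hB⟩) fun x x' => hg x x').continuous

/-- By continuity in `x` the supremum may be taken over a countable dense set. -/
lemma measurable_iSup_of_lipschitz (hB : 0 ≤ B) (hGB : ∀ x y, G x y ≤ B)
    (hLip : ∀ x x' y, |G x y - G x' y| ≤ B * dist x x') (hm : ∀ x, Measurable (G x)) :
    Measurable fun y => ⨆ x, G x y := by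
  obtain ⟨S, hSc, hSd⟩ := TopologicalSpace.exists_countable_dense (Fin d → ℝ)
  have := hSc.to_subtype
  have h : (fun y => ⨆ x, G x y) = fun y => ⨆ x : S, G x y := by
    funext y
    refine (hSd.ciSup (continuous_of_abs_sub_le hB fun x x' => hLip x x' y) ⟨B, ?_⟩).symm
    rintro _ ⟨x, rfl⟩
    exact hGB x y
  rw [h]
  exact Measurable.iSup fun x => hm x

omit [MeasurableSpace M] in
-- Near a point where `G` exceeds half the supremum `s`, the Lipschitz bound keeps `G ≥ s / 4` on a
-- ball of radius `s / (4 B)`, whose volume is `(s / (2 B)) ^ d` in the maximum norm. The radius is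
-- at most `1`, which explains the ball of radius `L + 1`.
lemma rpow_iSup_le_lintegral (hB : 1 ≤ B) (hq : 0 < q) (h0 : ∀ x y, 0 ≤ G x y)
    (hGB : ∀ x y, G x y ≤ B) (hLip : ∀ x x' y, |G x y - G x' y| ≤ B * dist x x')
    (hr : ∀ x, ∃ x' ∈ Metric.closedBall x₀ L, ∀ y, G x y = G x' y) (y : M) :
    ENNReal.ofReal ((⨆ x, G x y) ^ (q + d)) ≤ ENNReal.ofReal (4 ^ q * (2 * B) ^ d) *
      ∫⁻ x in Metric.closedBall x₀ (L + 1), ENNReal.ofReal (G x y ^ q) := by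
  set s := ⨆ x, G x y with hs
  have hB0 : 0 < B := by linarith
  have hbdd : BddAbove (range fun x => G x y) := ⟨B, by rintro _ ⟨x, rfl⟩; exact hGB x y⟩
  have hs0 : 0 ≤ s := (h0 x₀ y).trans (le_ciSup hbdd x₀)
  have hsB : s ≤ B := ciSup_le fun x => hGB x y
  rcases hs0.eq_or_lt with hs0 | hs0
  · rw [← hs0, Real.zero_rpow (by positivity), ENNReal.ofReal_zero]
    exact zero_le
  obtain ⟨x₁, hx₁⟩ := exists_lt_of_lt_ciSup (half_lt_self hs0 : s / 2 < ⨆ x, G x y)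
  obtain ⟨x, hx, hxx⟩ := hr x₁
  rw [hxx y] at hx₁
  have hr0 : 0 ≤ s / (4 * B) := by positivity
  have hr1 : s / (4 * B) ≤ 1 := by
    rw [div_le_one (by positivity)]
    linarith
  have hsub : Metric.closedBall x (s / (4 * B)) ⊆ Metric.closedBall x₀ (L + 1) :=
    Metric.closedBall_subset_closedBall' (by
      have := Metric.mem_closedBall.1 hx
      linarith)
  have hlow : ∀ z ∈ Metric.closedBall x (s / (4 * B)),
      ENNReal.ofReal ((s / 4) ^ q) ≤ ENNReal.ofReal (G z y ^ q) := fun z hz => by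
    refine ENNReal.ofReal_le_ofReal (Real.rpow_le_rpow (by positivity) ?_ hq.le)
    have h1 := (abs_le.1 (hLip z x y)).1
    have h2 : B * dist z x ≤ B * (s / (4 * B)) :=
      mul_le_mul_of_nonneg_left (Metric.mem_closedBall.1 hz) hB0.le
    have h3 : B * (s / (4 * B)) = s / 4 := by field_simp
    linarith
  calc ENNReal.ofReal (s ^ (q + d))
      = ENNReal.ofReal (4 ^ q * (2 * B) ^ d) *
          ∫⁻ _ in Metric.closedBall x (s / (4 * B)), ENNReal.ofReal ((s / 4) ^ q) := by
        rw [setLIntegral_const, Real.volume_pi_closedBall _ hr0, Fintype.card_fin,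
          ← ENNReal.ofReal_mul (by positivity), ← ENNReal.ofReal_mul (by positivity),
          Real.div_rpow hs0.le (by norm_num), Real.rpow_add hs0, Real.rpow_natCast]
        congr 1
        have h4 : (4 : ℝ) ^ q ≠ 0 := by positivity
        have h5 : 2 * (s / (4 * B)) = s / (2 * B) := by field_simp; norm_num
        rw [h5, div_pow]
        field_simp
    _ ≤ ENNReal.ofReal (4 ^ q * (2 * B) ^ d) *
          ∫⁻ z in Metric.closedBall x (s / (4 * B)), ENNReal.ofReal (G z y ^ q) := by
        exact mul_le_mul' le_rfl (setLIntegral_mono' measurableSet_closedBall hlow)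
    _ ≤ _ := mul_le_mul' le_rfl (lintegral_mono_set hsub)

/-- A maximal function over a `d`-dimensional parameter on which it depends in a Lipschitz manner
is controlled, at the price of `d` more powers, by its moments at fixed parameters. -/
theorem lintegral_iSup_rpow_le {ν : Measure M} [SFinite ν] (hB : 1 ≤ B) (hL : 0 ≤ L) (hq : 0 < q)
    (h0 : ∀ x y, 0 ≤ G x y) (hGB : ∀ x y, G x y ≤ B)
    (hLip : ∀ x x' y, |G x y - G x' y| ≤ B * dist x x') (hm : ∀ x, Measurable (G x))
    (hr : ∀ x, ∃ x' ∈ Metric.closedBall x₀ L, ∀ y, G x y = G x' y) {c : ℝ≥0∞}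
    (hc : ∀ x ∈ Metric.closedBall x₀ L, ∫⁻ y, ENNReal.ofReal (G x y ^ q) ∂ν ≤ c) :
    ∫⁻ y, ENNReal.ofReal ((⨆ x, G x y) ^ (q + d)) ∂ν
      ≤ ENNReal.ofReal (4 ^ q * (2 * B) ^ d * (2 * (L + 1)) ^ d) * c := by
  have hGm : Measurable (Function.uncurry G) := measurable_uncurry_of_continuous_of_measurable
    (fun y => continuous_of_abs_sub_le (by linarith) fun x x' => hLip x x' y) hm
  have hGm' : Measurable (Function.uncurry fun y x => ENNReal.ofReal (G x y ^ q)) :=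
    ((hGm.comp measurable_swap).pow_const q).ennreal_ofReal
  calc _ ≤ ∫⁻ y, (ENNReal.ofReal (4 ^ q * (2 * B) ^ d) *
        ∫⁻ x in Metric.closedBall x₀ (L + 1), ENNReal.ofReal (G x y ^ q)) ∂ν :=
        lintegral_mono fun y => rpow_iSup_le_lintegral hB hq h0 hGB hLip hr y
    _ = ENNReal.ofReal (4 ^ q * (2 * B) ^ d) *
        ∫⁻ x in Metric.closedBall x₀ (L + 1), ∫⁻ y, ENNReal.ofReal (G x y ^ q) ∂ν := by
        rw [lintegral_const_mul _ (Measurable.lintegral_prod_right hGm'),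
          lintegral_lintegral_swap hGm'.aemeasurable]
    _ ≤ ENNReal.ofReal (4 ^ q * (2 * B) ^ d) *
        ∫⁻ _ in Metric.closedBall x₀ (L + 1), c := by
        gcongr with x
        obtain ⟨x', hx', hxx⟩ := hr x
        simp_rw [hxx]
        exact hc x' hx'
    _ = _ := by
        rw [setLIntegral_const, Real.volume_pi_closedBall _ (by linarith), Fintype.card_fin,
          mul_comm c, ← mul_assoc, ← ENNReal.ofReal_mul (by positivity)]

/-- The coordinatewise retraction of `ℝ^d` onto a ball for the maximum norm. -/
noncomputable def clampBall (x₀ : Fin d → ℝ) (L : ℝ) (x : Fin d → ℝ) : Fin d → ℝ :=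
  fun i => max (min (x i) (x₀ i + L)) (x₀ i - L)

lemma clampBall_mem (hL : 0 ≤ L) (x : Fin d → ℝ) :
    clampBall x₀ L x ∈ Metric.closedBall x₀ L := by
  rw [Metric.mem_closedBall, dist_pi_le_iff hL]
  intro i
  rw [Real.dist_eq, abs_le, clampBall]
  constructor
  · have := le_max_right (min (x i) (x₀ i + L)) (x₀ i - L)
    linarith
  · have : max (min (x i) (x₀ i + L)) (x₀ i - L) ≤ x₀ i + L :=
      max_le (min_le_right _ _) (by linarith)
    linarith

lemma clampBall_of_mem {x : Fin d → ℝ} (hx : x ∈ Metric.closedBall x₀ L) :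
    clampBall x₀ L x = x := by
  funext i
  have h := (dist_le_pi_dist x x₀ i).trans (Metric.mem_closedBall.1 hx)
  rw [Real.dist_eq, abs_le] at h
  rw [clampBall, min_eq_left (by linarith), max_eq_left (by linarith)]

lemma dist_clampBall_le (x x' : Fin d → ℝ) :
    dist (clampBall x₀ L x) (clampBall x₀ L x') ≤ dist x x' := by
  rw [dist_pi_le_iff dist_nonneg]
  intro i
  refine le_trans ?_ (dist_le_pi_dist x x' i)
  rw [Real.dist_eq, Real.dist_eq]
  refine (abs_max_sub_max_le_abs _ _ _).trans ((abs_min_sub_min_le_max _ _ _ _).trans ?_)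
  simp

end SupremumOverParameter

/-! ### Moment bound for one part of the order function -/

section OrderFunction

variable {M F : Type*} [NormedAddCommGroup F] {d : ℕ} {T : M → M}
  {w : (Fin d → ℝ) → M → F} {x₀ : Fin d → ℝ} {B L ε q : ℝ}

/-- The common form of the two parts of the order function. -/
noncomputable def orderSup (T : M → M) (w : (Fin d → ℝ) → M → F) (E : Set (Fin d → ℝ)) (ε : ℝ)
    (y : M) : ℝ :=
  sSup {r : ℝ | ∃ x ∈ E, ∃ n : ℕ, 1 ≤ n ∧ ε * n ≤ 1 ∧
    r = ε * ‖∑ j ∈ Finset.range n, w x (T^[j] y)‖}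

/-- `ε max_{n ≤ 1/ε} |∑_{j < n} u (T^j y)|`. -/
noncomputable def scaledMax (T : M → M) (ε : ℝ) (u : M → F) (y : M) : ℝ :=
  ε * (Finset.range (⌊1 / ε⌋₊ + 1)).sup' Finset.nonempty_range_add_one
    fun n => ‖∑ j ∈ Finset.range n, u (T^[j] y)‖

lemma mul_natCast_le_one (hε : 0 ≤ ε) {n : ℕ} (hn : n ≤ ⌊1 / ε⌋₊) : ε * n ≤ 1 := by
  rcases hε.eq_or_lt with rfl | hε
  · simp
  · have h1 : (n : ℝ) ≤ 1 / ε := (Nat.cast_le.2 hn).trans (Nat.floor_le (by positivity))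
    rwa [le_div_iff₀ hε, mul_comm] at h1

lemma norm_sum_iterate_le {u : M → F} (hu : ∀ y, ‖u y‖ ≤ B) (n : ℕ) (y : M) :
    ‖∑ j ∈ Finset.range n, u (T^[j] y)‖ ≤ n * B := by
  refine (norm_sum_le _ _).trans ((Finset.sum_le_sum fun j _ => hu _).trans (le_of_eq ?_))
  simp

lemma mul_norm_sum_iterate_le {u : M → F} (hu : ∀ y, ‖u y‖ ≤ B) (hB : 0 ≤ B) (hε : 0 ≤ ε) {n : ℕ}
    (hn : ε * n ≤ 1) (y : M) : ε * ‖∑ j ∈ Finset.range n, u (T^[j] y)‖ ≤ B := by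
  calc _ ≤ ε * (n * B) := mul_le_mul_of_nonneg_left (norm_sum_iterate_le hu n y) hε
    _ = ε * n * B := by ring
    _ ≤ 1 * B := mul_le_mul_of_nonneg_right hn hB
    _ = B := one_mul B

lemma exists_scaledMax_eq (T : M → M) (ε : ℝ) (u : M → F) (y : M) : ∃ n ≤ ⌊1 / ε⌋₊,
    scaledMax T ε u y = ε * ‖∑ j ∈ Finset.range n, u (T^[j] y)‖ := by
  obtain ⟨n, hn, h⟩ := Finset.exists_mem_eq_sup' (s := Finset.range (⌊1 / ε⌋₊ + 1))
    Finset.nonempty_range_add_one fun n => ‖∑ j ∈ Finset.range n, u (T^[j] y)‖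
  exact ⟨n, by have := Finset.mem_range.1 hn; omega, by rw [scaledMax, h]⟩

lemma le_scaledMax (hε : 0 ≤ ε) (u : M → F) (y : M) {n : ℕ} (hn : n ≤ ⌊1 / ε⌋₊) :
    ε * ‖∑ j ∈ Finset.range n, u (T^[j] y)‖ ≤ scaledMax T ε u y :=
  mul_le_mul_of_nonneg_left (Finset.le_sup' (fun n => ‖∑ j ∈ Finset.range n, u (T^[j] y)‖)
    (Finset.mem_range.2 (by omega))) hε

lemma scaledMax_nonneg (hε : 0 ≤ ε) (u : M → F) (y : M) : 0 ≤ scaledMax T ε u y := by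
  simpa using le_scaledMax (T := T) hε u y (Nat.zero_le _)

lemma scaledMax_le {u : M → F} (hu : ∀ y, ‖u y‖ ≤ B) (hB : 0 ≤ B) (hε : 0 ≤ ε) (y : M) :
    scaledMax T ε u y ≤ B := by
  obtain ⟨n, hn, h⟩ := exists_scaledMax_eq T ε u y
  rw [h]
  exact mul_norm_sum_iterate_le hu hB hε (mul_natCast_le_one hε hn) y

lemma scaledMax_le_add {u u' : M → F} {b : ℝ} (hu : ∀ y, ‖u y - u' y‖ ≤ b) (hb : 0 ≤ b)
    (hε : 0 ≤ ε) (y : M) : scaledMax T ε u y ≤ scaledMax T ε u' y + b := by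
  obtain ⟨n, hn, h⟩ := exists_scaledMax_eq T ε u y
  have h1 := le_scaledMax (T := T) hε u' y hn
  have h2 := mul_norm_sum_iterate_le (T := T) (u := fun y => u y - u' y) hu hb hε
    (mul_natCast_le_one hε hn) y
  have h3 : ‖∑ j ∈ Finset.range n, u (T^[j] y)‖ ≤ ‖∑ j ∈ Finset.range n, u' (T^[j] y)‖
      + ‖∑ j ∈ Finset.range n, (u (T^[j] y) - u' (T^[j] y))‖ := by
    rw [Finset.sum_sub_distrib]
    exact norm_le_norm_add_norm_sub' _ _
  have h4 := mul_le_mul_of_nonneg_left h3 hε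
  rw [h]
  linarith

lemma measurable_scaledMax [MeasurableSpace M] (hT : Measurable T) {u : M → F}
    (hu : StronglyMeasurable u) : Measurable (scaledMax T ε u) := by
  have h := Finset.measurable_sup' (s := Finset.range (⌊1 / ε⌋₊ + 1)) Finset.nonempty_range_add_one
    (f := fun n y => ‖∑ j ∈ Finset.range n, u (T^[j] y)‖) fun n _ =>
      (Finset.stronglyMeasurable_fun_sum (Finset.range n) fun j _ =>
        hu.comp_measurable (hT.iterate j)).norm.measurable
  have h1 : scaledMax T ε u = fun y => ε * (Finset.range (⌊1 / ε⌋₊ + 1)).sup'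
      Finset.nonempty_range_add_one (fun n y => ‖∑ j ∈ Finset.range n, u (T^[j] y)‖) y := by
    funext y
    rw [Finset.sup'_apply, scaledMax]
  rw [h1]
  exact h.const_mul ε

/-- The bounds on a parametrised observable that the estimate of its order function uses. -/
structure IsLipObservable [MetricSpace M] (w : (Fin d → ℝ) → M → F) (E : Set (Fin d → ℝ))
    (B : ℝ) : Prop where
  norm_le : ∀ x ∈ E, ∀ y, ‖w x y‖ ≤ B
  norm_sub_le : ∀ x ∈ E, ∀ x' ∈ E, ∀ y y', ‖w x y - w x' y'‖ ≤ B * (dist x x' + dist y y')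

/-- Composing with the retraction turns the supremum over the ball into one over all of `ℝ^d`
without increasing Lipschitz constants, so balls centred near the boundary cause no trouble. The
extra term `n = 0` contributes `0`, and for `ε = 0` both sides vanish. -/
lemma orderSup_eq_iSup (hL : 0 ≤ L) (hB : 0 ≤ B) (hε : 0 ≤ ε)
    (hw : ∀ x ∈ Metric.closedBall x₀ L, ∀ y, ‖w x y‖ ≤ B) (y : M) :
    orderSup T w (Metric.closedBall x₀ L) ε y
      = ⨆ x, scaledMax T ε (w (clampBall x₀ L x)) y := by
  have hbdd : BddAbove (range fun x => scaledMax T ε (w (clampBall x₀ L x)) y) :=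
    ⟨B, by rintro _ ⟨x, rfl⟩; exact scaledMax_le (hw _ (clampBall_mem hL x)) hB hε y⟩
  apply le_antisymm
  · refine Real.sSup_le ?_ (Real.iSup_nonneg fun x => scaledMax_nonneg hε _ _)
    rintro _ ⟨x, hx, n, -, hn, rfl⟩
    rcases hε.eq_or_lt with rfl | hε'
    · rw [zero_mul]
      exact Real.iSup_nonneg fun x => scaledMax_nonneg le_rfl _ _
    refine le_trans ?_ (le_ciSup hbdd x)
    simp only [clampBall_of_mem hx]
    refine le_scaledMax hε _ _ (Nat.le_floor ?_)
    rw [le_div_iff₀ hε', mul_comm]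
    exact hn
  · refine ciSup_le fun x => ?_
    obtain ⟨n, hn, h⟩ := exists_scaledMax_eq T ε (w (clampBall x₀ L x)) y
    rw [h]
    rcases Nat.eq_zero_or_pos n with rfl | hn0
    · simp only [Finset.range_zero, Finset.sum_empty, norm_zero, mul_zero]
      refine Real.sSup_nonneg ?_
      rintro _ ⟨x, -, n, -, -, rfl⟩
      positivity
    · refine le_csSup ⟨B, ?_⟩ ⟨_, clampBall_mem hL x, n, hn0, mul_natCast_le_one hε hn, rfl⟩
      rintro _ ⟨x, hx, n, -, hn, rfl⟩
      exact mul_norm_sum_iterate_le (hw x hx) hB hε hn y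

lemma scaledMax_le_of_coordinates {ι : Type*} {ℓ : ι → F →+ ℝ}
    (hℓ : ∀ z c, 0 ≤ c → (∀ i, |ℓ i z| ≤ c) → ‖z‖ ≤ c) (hε : 0 ≤ ε) (u : M → F) {y : M} {c : ℝ}
    (hc0 : 0 ≤ c) (hc : ∀ i, maxBirkhoff T (fun y => ℓ i (u y)) ⌊1 / ε⌋₊ y ≤ c) :
    scaledMax T ε u y ≤ ε * c := by
  obtain ⟨n, hn, h⟩ := exists_scaledMax_eq T ε u y
  rw [h]
  refine mul_le_mul_of_nonneg_left (hℓ _ _ hc0 fun i => ?_) hε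
  rw [map_sum]
  exact (abs_birkhoffSum_le_maxBirkhoff T (fun y => ℓ i (u y)) hn y).trans (hc i)

/-- Reduction to scalar observables; the maximum over coordinates is replaced by a sum of `q`-th
powers, which integrates termwise. -/
lemma scaledMax_rpow_le_sum {ι : Type*} [Fintype ι] {ℓ : ι → F →+ ℝ}
    (hℓ : ∀ z c, 0 ≤ c → (∀ i, |ℓ i z| ≤ c) → ‖z‖ ≤ c) (hε : 0 ≤ ε) (hq : 0 < q) (u : M → F)
    (y : M) : scaledMax T ε u y ^ q
      ≤ ∑ i, ε ^ q * maxBirkhoff T (fun y => ℓ i (u y)) ⌊1 / ε⌋₊ y ^ q := by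
  have h0 : ∀ i, 0 ≤ maxBirkhoff T (fun y => ℓ i (u y)) ⌊1 / ε⌋₊ y :=
    fun i => maxBirkhoff_nonneg _ _ _ _
  set S := ∑ i, maxBirkhoff T (fun y => ℓ i (u y)) ⌊1 / ε⌋₊ y ^ q with hS
  have hS0 : 0 ≤ S := Finset.sum_nonneg fun i _ => Real.rpow_nonneg (h0 i) q
  have h1 := scaledMax_le_of_coordinates hℓ hε (T := T) u (y := y)
    (Real.rpow_nonneg hS0 q⁻¹) fun i => by
      rw [Real.le_rpow_inv_iff_of_pos (h0 i) hS0 hq]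
      exact Finset.single_le_sum
        (f := fun i => maxBirkhoff T (fun y => ℓ i (u y)) ⌊1 / ε⌋₊ y ^ q)
        (fun i _ => Real.rpow_nonneg (h0 i) q) (Finset.mem_univ i)
  calc _ ≤ (ε * S ^ q⁻¹) ^ q := Real.rpow_le_rpow (scaledMax_nonneg hε u y) h1 hq.le
    _ = ε ^ q * S := by
      rw [Real.mul_rpow hε (Real.rpow_nonneg hS0 _), ← Real.rpow_mul hS0,
        inv_mul_cancel₀ hq.ne', Real.rpow_one]
    _ = _ := by rw [hS, Finset.mul_sum]

lemma rpow_mul_floor_rpow_le {a b : ℝ} (hε : 0 < ε) (hb : 0 ≤ b) :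
    ε ^ (a + b) * (⌊1 / ε⌋₊ : ℝ) ^ b ≤ ε ^ a := by
  have h1 : ε * (⌊1 / ε⌋₊ : ℝ) ≤ 1 := mul_natCast_le_one hε.le le_rfl
  calc _ = ε ^ a * (ε * (⌊1 / ε⌋₊ : ℝ)) ^ b := by
        rw [Real.rpow_add hε, Real.mul_rpow hε.le (Nat.cast_nonneg _), mul_assoc]
    _ ≤ ε ^ a * 1 := by
        gcongr
        exact Real.rpow_le_one (by positivity) h1 hb
    _ = _ := mul_one _

variable [MetricSpace M] [MeasurableSpace M] [BorelSpace M] [SecondCountableTopology M]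

lemma IsLipObservable.stronglyMeasurable {E : Set (Fin d → ℝ)} (hw : IsLipObservable w E B)
    (hB : 0 ≤ B) {x : Fin d → ℝ} (hx : x ∈ E) : StronglyMeasurable (w x) := by
  have : LipschitzWith ⟨B, hB⟩ (w x) := LipschitzWith.of_dist_le_mul fun y y' => by
    have := hw.norm_sub_le x hx x hx y y'
    rwa [dist_self, zero_add, ← dist_eq_norm] at this
  exact this.continuous.stronglyMeasurable

omit [MeasurableSpace M] [BorelSpace M] [SecondCountableTopology M] in
lemma IsLipObservable.abs_scaledMax_sub_le {E : Set (Fin d → ℝ)} (hw : IsLipObservable w E B)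
    (hB : 0 ≤ B) (hε : 0 ≤ ε) {x x' : Fin d → ℝ} (hx : x ∈ E) (hx' : x' ∈ E) (y : M) :
    |scaledMax T ε (w x) y - scaledMax T ε (w x') y| ≤ B * dist x x' := by
  have h : ∀ x ∈ E, ∀ x' ∈ E, ∀ y, ‖w x y - w x' y‖ ≤ B * dist x x' := fun x hx x' hx' y => by
    simpa using hw.norm_sub_le x hx x' hx' y y
  have h1 := scaledMax_le_add (T := T) (h x hx x' hx') (by positivity) hε y
  have h2 := scaledMax_le_add (T := T) (h x' hx' x hx) (by positivity) hε y
  rw [dist_comm x' x] at h2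
  rw [abs_le]
  constructor <;> linarith

lemma IsLipObservable.measurable_orderSup (hw : IsLipObservable w (Metric.closedBall x₀ L) B)
    (hB : 0 ≤ B) (hL : 0 ≤ L) (hε : 0 ≤ ε) (hT : Measurable T) :
    Measurable (orderSup T w (Metric.closedBall x₀ L) ε) := by
  rw [funext (orderSup_eq_iSup (T := T) hL hB hε hw.norm_le)]
  refine measurable_iSup_of_lipschitz hB
    (fun x y => scaledMax_le (hw.norm_le _ (clampBall_mem hL x)) hB hε y) (fun x x' y => ?_)
    fun x => measurable_scaledMax hT (hw.stronglyMeasurable hB (clampBall_mem hL x))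
  exact (hw.abs_scaledMax_sub_le hB hε (clampBall_mem hL x) (clampBall_mem hL x') y).trans
    (mul_le_mul_of_nonneg_left (dist_clampBall_le x x') hB)

/-- Stated for abstract coordinate functionals `ℓ` so that it serves both the vector field and its
Jacobian. It combines the fixed-parameter moment bound with the supremum estimate. -/
theorem exists_orderSup_moment_bound [StandardBorelSpace M] {lam η C₀ C₁ D p : ℝ} {K : ℝ≥0}
    (hlam : 1 < lam) (hη : 0 < η) (hη1 : η ≤ 1) (hC₀ : 1 ≤ C₀) (hC₁ : 1 ≤ C₁) (hD1 : 1 ≤ D)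
    (hD : ∀ x y : M, dist x y ≤ D) (hp : 1 < p) (hB : 1 ≤ B) (hL : 0 ≤ L) (x₀ : Fin d → ℝ)
    {ι : Type*} [Fintype ι] {ℓ : ι → F →+ ℝ} (hℓ1 : ∀ i z, |ℓ i z| ≤ ‖z‖)
    (hℓ : ∀ z c, 0 ≤ c → (∀ i, |ℓ i z| ≤ c) → ‖z‖ ≤ c) :
    ∃ C : ℝ, 0 < C ∧ ∀ (m : Measure M) [IsFiniteMeasure m] (T : M → M) (Y : Set M)
      (α : Set (Set M)) (τ : M → ℕ) (ν : Measure M) [IsProbabilityMeasure ν],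
      IsInducingScheme m T Y α τ lam η C₀ C₁ → QuasiErgodic T m →
      ⨍⁻ x in Y, (τ x : ℝ≥0∞) ^ p ∂m ≤ K → MeasurePreserving T ν ν → ν ≪ m →
      ∀ w : (Fin d → ℝ) → M → F, IsLipObservable w (Metric.closedBall x₀ L) B →
        (∀ x ∈ Metric.closedBall x₀ L, ∀ i, ∫ y, ℓ i (w x y) ∂ν = 0) → ∀ ε : ℝ, 0 ≤ ε →
        ∫⁻ y, ENNReal.ofReal (orderSup T w (Metric.closedBall x₀ L) ε y ^ (p - 1 + d)) ∂ν
          ≤ ENNReal.ofReal (C * ε ^ ((1 - momentExponent p / p) * (p - 1))) := by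
  obtain ⟨C, hC, hmoment⟩ := exists_maxBirkhoff_moment_bound (M := M) (H := B) (K := K)
    hlam hη hη1 hC₀ hC₁ hD1 hD hp (by linarith)
  set A := 4 ^ (p - 1) * (2 * B) ^ d * (2 * (L + 1)) ^ d with hA
  have hB0 : 0 ≤ B := by linarith
  have hA0 : 0 ≤ A := by positivity
  have hq : 0 < p - 1 := by linarith
  refine ⟨A * (Fintype.card ι * C) + 1, by positivity, ?_⟩
  intro m _ T Y α τ ν _ hs hT hK hν hνm w hw hw0 ε hε
  have hTm := hT.measurable
  set e := (1 - momentExponent p / p) * (p - 1) with he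
  set b := momentExponent p / p * (p - 1) with hb
  have hκ : 0 ≤ momentExponent p := zero_le_one.trans (le_max_right _ _)
  have hb0 : 0 ≤ b := mul_nonneg (div_nonneg hκ (by linarith)) hq.le
  -- Splits `ε ^ (p - 1) N ^ b` as `ε ^ e (ε N) ^ b`, where `ε N ≤ 1`.
  have heb : e + b = p - 1 := by rw [he, hb]; ring
  have hmain : ∀ x ∈ Metric.closedBall x₀ L,
      ∫⁻ y, ENNReal.ofReal (scaledMax T ε (w (clampBall x₀ L x)) y ^ (p - 1)) ∂ν
        ≤ ENNReal.ofReal (Fintype.card ι * C * ε ^ e) := by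
    intro x hx
    rw [clampBall_of_mem hx]
    -- The floor is `0` for `ε > 1` and, because `1 / 0 = 0`, also for `ε = 0`; only the empty sum
    -- remains.
    rcases Nat.eq_zero_or_pos ⌊1 / ε⌋₊ with hN | hN
    · have h0 : ∀ y, scaledMax T ε (w x) y = 0 := fun y => by
        obtain ⟨n, hn, h⟩ := exists_scaledMax_eq T ε (w x) y
        rw [hN, Nat.le_zero] at hn
        simp [h, hn]
      simp [h0, Real.zero_rpow hq.ne']
    have hε0 : 0 < ε := by
      rcases hε.eq_or_lt with rfl | h
      · simp at hN
      · exact h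
    have hvm : ∀ i, Measurable fun y => ℓ i (w x y) := fun i => by
      have : LipschitzWith ⟨B, hB0⟩ fun y => ℓ i (w x y) :=
        LipschitzWith.of_dist_le_mul fun y y' => by
          rw [Real.dist_eq, ← map_sub]
          refine (hℓ1 i _).trans ((hw.norm_sub_le x hx x hx y y').trans (le_of_eq ?_))
          rw [dist_self, zero_add]
          rfl
      exact this.continuous.measurable
    calc _ ≤ ∫⁻ y, ∑ i, ENNReal.ofReal (ε ^ (p - 1)) *
            ENNReal.ofReal (maxBirkhoff T (fun y => ℓ i (w x y)) ⌊1 / ε⌋₊ y ^ (p - 1)) ∂ν := by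
          refine lintegral_mono fun y => ?_
          refine (ENNReal.ofReal_le_ofReal (scaledMax_rpow_le_sum hℓ hε hq (w x) y)).trans ?_
          have h0 : ∀ i, 0 ≤ maxBirkhoff T (fun y => ℓ i (w x y)) ⌊1 / ε⌋₊ y ^ (p - 1) :=
            fun i => Real.rpow_nonneg (maxBirkhoff_nonneg _ _ _ _) _
          rw [ENNReal.ofReal_sum_of_nonneg fun i _ => mul_nonneg (by positivity) (h0 i)]
          exact Finset.sum_le_sum fun i _ => (ENNReal.ofReal_mul (by positivity)).le
      _ = ∑ i, ENNReal.ofReal (ε ^ (p - 1)) * ∫⁻ y,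
            ENNReal.ofReal (maxBirkhoff T (fun y => ℓ i (w x y)) ⌊1 / ε⌋₊ y ^ (p - 1)) ∂ν := by
          have h1 : ∀ i, Measurable fun y => ENNReal.ofReal
              (maxBirkhoff T (fun y => ℓ i (w x y)) ⌊1 / ε⌋₊ y ^ (p - 1)) := fun i =>
            ((measurable_maxBirkhoff hTm (hvm i) _).pow_const _).ennreal_ofReal
          rw [lintegral_finsetSum _ fun i _ => (h1 i).const_mul _]
          exact Finset.sum_congr rfl fun i _ => lintegral_const_mul _ (h1 i)
      _ ≤ ∑ _i : ι, ENNReal.ofReal (C * ε ^ e) := by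
          refine Finset.sum_le_sum fun i _ => ?_
          have h1 := hmoment m T Y α τ ν hs hT hK hν hνm (fun y => ℓ i (w x y))
            (fun y => (hℓ1 i _).trans (hw.norm_le x hx y))
            (fun y y' => by
              rw [← map_sub]
              simpa using (hℓ1 i _).trans (hw.norm_sub_le x hx x hx y y'))
            (hw0 x hx i) _ hN
          refine (mul_le_mul' le_rfl h1).trans ?_
          rw [← ENNReal.ofReal_mul (by positivity)]
          refine ENNReal.ofReal_le_ofReal ?_
          have h2 := rpow_mul_floor_rpow_le (a := e) hε0 hb0
          rw [heb] at h2
          calc _ = C * (ε ^ (p - 1) * (⌊1 / ε⌋₊ : ℝ) ^ b) := by ring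
            _ ≤ _ := by gcongr
      _ = _ := by
          rw [Finset.sum_const, Finset.card_univ, nsmul_eq_mul, ← ENNReal.ofReal_natCast,
            ← ENNReal.ofReal_mul (Nat.cast_nonneg _), mul_assoc]
  have hfinal := lintegral_iSup_rpow_le (ν := ν) (x₀ := x₀) (L := L) (B := B) (q := p - 1)
    (G := fun x y => scaledMax T ε (w (clampBall x₀ L x)) y) hB hL hq
    (fun x y => scaledMax_nonneg hε _ _)
    (fun x y => scaledMax_le (hw.norm_le _ (clampBall_mem hL x)) hB0 hε y)
    (fun x x' y => (hw.abs_scaledMax_sub_le hB0 hε (clampBall_mem hL x)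
      (clampBall_mem hL x') y).trans (mul_le_mul_of_nonneg_left (dist_clampBall_le x x') hB0))
    (fun x => measurable_scaledMax hTm (hw.stronglyMeasurable hB0 (clampBall_mem hL x)))
    (fun x => ⟨_, clampBall_mem hL x, fun y => by
      simp only [clampBall_of_mem (clampBall_mem hL x)]⟩) hmain
  simp_rw [orderSup_eq_iSup (T := T) hL hB0 hε hw.norm_le]
  refine hfinal.trans ?_
  rw [← ENNReal.ofReal_mul hA0]
  refine ENNReal.ofReal_le_ofReal ?_
  have : 0 ≤ ε ^ e := Real.rpow_nonneg hε e
  nlinarith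

end OrderFunction

/-! ### Lipschitz bounds for the centred field and its derivative -/

section Regularity

variable {M : Type*} [MetricSpace M] {d : ℕ} {ε₀ L L₁ L₂ L₃ ε : ℝ}

lemma isLipObservable_of_lipNorm_le {F : Type*} [NormedAddCommGroup F] {E : Set (Fin d → ℝ)}
    {g : (Fin d → ℝ) → M → ℝ → F} (hg : lipNorm E ε₀ g ≤ ENNReal.ofReal L) (hL : 0 ≤ L)
    (hε : ε ∈ Ico 0 ε₀) : IsLipObservable (fun x y => g x y ε) E L := by
  constructor
  · intro x hx y
    have h1 : ‖g x y ε‖ₑ ≤ ⨆ ε ∈ Ico 0 ε₀, ⨆ x ∈ E, ⨆ y : M, ‖g x y ε‖ₑ :=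
      (le_iSup (fun y => ‖g x y ε‖ₑ) y).trans <|
        (le_iSup₂ (f := fun x (_ : x ∈ E) => ⨆ y : M, ‖g x y ε‖ₑ) x hx).trans <|
        le_iSup₂ (f := fun ε (_ : ε ∈ Ico 0 ε₀) => ⨆ x ∈ E, ⨆ y : M, ‖g x y ε‖ₑ) ε hε
    have h2 := h1.trans (le_self_add.trans hg)
    rwa [← ofReal_norm, ENNReal.ofReal_le_ofReal_iff hL] at h2
  · intro x hx x' hx' y y'
    have h1 : ‖g x y ε - g x' y' ε‖ₑ / (edist x x' + edist y y') ≤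
        ⨆ ε ∈ Ico 0 ε₀, ⨆ x ∈ E, ⨆ x' ∈ E, ⨆ y : M, ⨆ y' : M,
          ‖g x y ε - g x' y' ε‖ₑ / (edist x x' + edist y y') :=
      (le_iSup₂ (f := fun y y' =>
          ‖g x y ε - g x' y' ε‖ₑ / (edist x x' + edist y y')) y y').trans <|
        (le_iSup₂ (f := fun x' (_ : x' ∈ E) => ⨆ y : M, ⨆ y' : M,
          ‖g x y ε - g x' y' ε‖ₑ / (edist x x' + edist y y')) x' hx').trans <|
        (le_iSup₂ (f := fun x (_ : x ∈ E) => ⨆ x' ∈ E, ⨆ y : M, ⨆ y' : M,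
          ‖g x y ε - g x' y' ε‖ₑ / (edist x x' + edist y y')) x hx).trans <|
        le_iSup₂ (f := fun ε (_ : ε ∈ Ico 0 ε₀) => ⨆ x ∈ E, ⨆ x' ∈ E, ⨆ y : M, ⨆ y' : M,
          ‖g x y ε - g x' y' ε‖ₑ / (edist x x' + edist y y')) ε hε
    have h2 := h1.trans (le_add_self.trans hg)
    have h3 : edist x x' + edist y y' = ENNReal.ofReal (dist x x' + dist y y') := by
      rw [ENNReal.ofReal_add dist_nonneg dist_nonneg, ← edist_dist, ← edist_dist]
    -- A zero denominator gives no information in the quotient bound, but then the two points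
    -- coincide and the claim is trivial.
    rcases (add_nonneg (dist_nonneg (x := x) (y := x')) (dist_nonneg (x := y) (y := y'))).eq_or_lt
      with h0 | h0
    · have hx0 : dist x x' = 0 := by
        have := dist_nonneg (x := x) (y := x')
        have := dist_nonneg (x := y) (y := y')
        linarith
      have hy0 : dist y y' = 0 := by linarith
      rw [dist_eq_zero] at hx0 hy0
      subst hx0 hy0
      simp
    · rw [h3, ENNReal.div_le_iff (by simpa using h0) ENNReal.ofReal_ne_top, ← ofReal_norm,
        ← ENNReal.ofReal_mul hL, ENNReal.ofReal_le_ofReal_iff (by positivity)] at h2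
      exact h2

lemma IsLipObservable.sub_integral [MeasurableSpace M] [BorelSpace M] [SecondCountableTopology M]
    {F : Type*} [NormedAddCommGroup F] [NormedSpace ℝ F] {E : Set (Fin d → ℝ)}
    {w : (Fin d → ℝ) → M → F} (hw : IsLipObservable w E L) (hL : 0 ≤ L) (ν : Measure M)
    [IsProbabilityMeasure ν] :
    IsLipObservable (fun x y => w x y - ∫ z, w x z ∂ν) E (2 * L) := by
  have hi : ∀ x ∈ E, Integrable (w x) ν := fun x hx =>
    Integrable.of_bound (hw.stronglyMeasurable hL hx).aestronglyMeasurable L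
      (ae_of_all _ (hw.norm_le x hx))
  constructor
  · intro x hx y
    have h1 : ‖∫ z, w x z ∂ν‖ ≤ L := by
      simpa using norm_integral_le_of_norm_le_const (μ := ν) (ae_of_all _ (hw.norm_le x hx))
    have h2 := hw.norm_le x hx y
    have h3 := _root_.norm_sub_le (w x y) (∫ z, w x z ∂ν)
    linarith
  · intro x hx x' hx' y y'
    have h1 : ‖∫ z, w x z ∂ν - ∫ z, w x' z ∂ν‖ ≤ L * dist x x' := by
      rw [← integral_sub (hi x hx) (hi x' hx')]
      have h : ∀ z, ‖w x z - w x' z‖ ≤ L * dist x x' := fun z => by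
        simpa using hw.norm_sub_le x hx x' hx' z z
      simpa using norm_integral_le_of_norm_le_const (μ := ν) (ae_of_all _ h)
    have h2 := hw.norm_sub_le x hx x' hx' y y'
    have h3 : w x y - ∫ z, w x z ∂ν - (w x' y' - ∫ z, w x' z ∂ν)
        = w x y - w x' y' - (∫ z, w x z ∂ν - ∫ z, w x' z ∂ν) := by abel
    have h4 := _root_.norm_sub_le (w x y - w x' y') (∫ z, w x z ∂ν - ∫ z, w x' z ∂ν)
    have h5 : 0 ≤ L * dist y y' := by positivity
    rw [h3]
    nlinarith

variable [MeasurableSpace M] [BorelSpace M] [SecondCountableTopology M]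

/-- Differentiation under the integral, dominated by the global Lipschitz constant. Joint continuity
of `f` supplies measurability of the derivative in the fast variable. -/
lemma jac_sub_integral {f : (Fin d → ℝ) → M → (Fin d → ℝ)} (hf : IsLipObservable f univ L)
    (hL : 0 ≤ L) (ν : Measure M) [IsProbabilityMeasure ν] {x : Fin d → ℝ}
    (hd : ∀ y, DifferentiableAt ℝ (fun x' => f x' y) x) (y : M) :
    jac (fun x' => f x' y - ∫ z, f x' z ∂ν) x
      = jac (fun x' => f x' y) x - ∫ z, jac (fun x' => f x' z) x ∂ν := by
  have hi : ∀ x, Integrable (f x) ν := fun x =>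
    Integrable.of_bound (hf.stronglyMeasurable hL (mem_univ x)).aestronglyMeasurable L
      (ae_of_all _ (hf.norm_le x (mem_univ x)))
  have hcont : Continuous (Function.uncurry fun y x => f x y) := by
    have : LipschitzWith (⟨L, hL⟩ * 2) (Function.uncurry fun y x => f x y) :=
      LipschitzWith.of_dist_le_mul fun a b => by
        refine (dist_eq_norm (E := Fin d → ℝ) _ _).le.trans ?_
        refine (hf.norm_sub_le a.2 (mem_univ _) b.2 (mem_univ _) a.1 b.1).trans ?_
        have h1 : dist a.1 b.1 ≤ dist a b := le_max_left _ _
        have h2 : dist a.2 b.2 ≤ dist a b := le_max_right _ _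
        calc L * (dist a.2 b.2 + dist a.1 b.1) ≤ L * (dist a b + dist a b) := by gcongr
          _ = L * 2 * dist a b := by ring
    exact this.continuous
  have hfm : Measurable fun z => fderiv ℝ (fun x' => f x' z) x :=
    (measurable_fderiv_with_param ℝ hcont).comp (measurable_id.prodMk measurable_const)
  obtain ⟨hI, hD⟩ := hasFDerivAt_integral_of_dominated_loc_of_lip (𝕜 := ℝ) (μ := ν) (F := f)
    (F' := fun z => fderiv ℝ (fun x' => f x' z) x) (x₀ := x) (bound := fun _ => L) (s := univ)
    univ_mem (Eventually.of_forall fun x => (hi x).aestronglyMeasurable) (hi x)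
    hfm.aestronglyMeasurable (ae_of_all _ fun z => by
      refine LipschitzWith.lipschitzOnWith (LipschitzWith.of_dist_le_mul fun x x' => ?_)
      rw [dist_eq_norm, Real.coe_nnabs, abs_of_nonneg hL]
      simpa using hf.norm_sub_le x (mem_univ _) x' (mem_univ _) z z)
    (integrable_const _) (ae_of_all _ fun z => (hd z).hasFDerivAt)
  have hJ : Integrable (fun z => jac (fun x' => f x' z) x) ν := by
    refine Integrable.of_eval fun i => Integrable.of_eval fun j => ?_
    exact (hI.apply_continuousLinearMap (Pi.single j 1)).eval i
  funext i j
  have h1 : fderiv ℝ (fun x' => f x' y - ∫ z, f x' z ∂ν) x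
      = fderiv ℝ (fun x' => f x' y) x - ∫ z, fderiv ℝ (fun x' => f x' z) x ∂ν :=
    ((hd y).hasFDerivAt.sub hD).fderiv
  rw [jac, h1, Pi.sub_apply, Pi.sub_apply, eval_integral fun i => hJ.eval i,
    eval_integral fun j => (hJ.eval i).eval j, _root_.sub_apply, Pi.sub_apply,
    ContinuousLinearMap.integral_apply hI, eval_integral fun i => ?_]
  · rfl
  · exact (hI.apply_continuousLinearMap (Pi.single j 1)).eval i

end Regularity

/-! ### Verification of the hypotheses and the final rate -/

section Conclusion

variable {M : Type*} [MetricSpace M] [MeasurableSpace M] [BorelSpace M] [SecondCountableTopology M]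
  {d : ℕ} {x₀ : Fin d → ℝ} {ε₀ L₁ L₂ L₃ ε : ℝ} {a : (Fin d → ℝ) → M → ℝ → (Fin d → ℝ)}

lemma IsLipObservable.integrable {F : Type*} [NormedAddCommGroup F] {E : Set (Fin d → ℝ)}
    {w : (Fin d → ℝ) → M → F} {L : ℝ} (hw : IsLipObservable w E L) (hL : 0 ≤ L) {ν : Measure M}
    [IsFiniteMeasure ν] {x : Fin d → ℝ} (hx : x ∈ E) : Integrable (w x) ν :=
  Integrable.of_bound (hw.stronglyMeasurable hL hx).aestronglyMeasurable L
    (ae_of_all _ (hw.norm_le x hx))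

omit [MetricSpace M] [BorelSpace M] [SecondCountableTopology M] in
lemma integral_sub_integral_self {F : Type*} [NormedAddCommGroup F] [NormedSpace ℝ F]
    [CompleteSpace F] {ν : Measure M} [IsProbabilityMeasure ν] {f : M → F} (hf : Integrable f ν) :
    ∫ y, (f y - ∫ z, f z ∂ν) ∂ν = 0 := by
  rw [integral_sub hf (integrable_const _)]
  simp

lemma IsRegular.isLipObservable_centred (ha : IsRegular a x₀ ε₀ L₁ L₂ L₃) (hL₁ : 0 ≤ L₁)
    (hε : ε ∈ Ico 0 ε₀) (ν : ℝ → Measure M) [IsProbabilityMeasure (ν ε)] :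
    IsLipObservable (centred a ν ε) (Metric.closedBall x₀ L₁) (2 * L₁) := by
  have h := (isLipObservable_of_lipNorm_le ha.lip hL₁ hε).sub_integral hL₁ (ν ε)
  exact ⟨fun x _ => h.norm_le x (mem_univ x),
    fun x _ x' _ => h.norm_sub_le x (mem_univ x) x' (mem_univ x')⟩

lemma IsRegular.integral_centred (ha : IsRegular a x₀ ε₀ L₁ L₂ L₃) (hL₁ : 0 ≤ L₁)
    (hε : ε ∈ Ico 0 ε₀) (ν : ℝ → Measure M) [IsProbabilityMeasure (ν ε)] (x : Fin d → ℝ)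
    (i : Fin d) : ∫ y, centred a ν ε x y i ∂(ν ε) = 0 := by
  have h0 : Integrable (fun y => a x y ε) (ν ε) :=
    (isLipObservable_of_lipNorm_le ha.lip hL₁ hε).integrable hL₁ (mem_univ x)
  have h1 : Integrable (centred a ν ε x) (ν ε) := h0.sub (integrable_const _)
  rw [← eval_integral fun i => h1.eval i]
  exact congrFun (integral_sub_integral_self h0) i

lemma IsRegular.jac_centred (ha : IsRegular a x₀ ε₀ L₁ L₂ L₃) (hL₁ : 0 ≤ L₁)
    (hε : ε ∈ Ico 0 ε₀) (ν : ℝ → Measure M) [IsProbabilityMeasure (ν ε)] {x : Fin d → ℝ}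
    (hx : x ∈ Metric.closedBall x₀ L₁) (y : M) :
    jac (fun x' => centred a ν ε x' y) x
      = jac (fun x' => a x' y ε) x - ∫ z, jac (fun x' => a x' z ε) x ∂(ν ε) :=
  jac_sub_integral (isLipObservable_of_lipNorm_le ha.lip hL₁ hε) hL₁ (ν ε)
    (fun y => ha.differentiableAt ε hε y x hx) y

lemma IsRegular.isLipObservable_jac_centred (ha : IsRegular a x₀ ε₀ L₁ L₂ L₃) (hL₁ : 0 ≤ L₁)
    (hL₂ : 0 ≤ L₂) (hε : ε ∈ Ico 0 ε₀) (ν : ℝ → Measure M) [IsProbabilityMeasure (ν ε)] :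
    IsLipObservable (fun x y => jac (fun x' => centred a ν ε x' y) x)
      (Metric.closedBall x₀ L₁) (2 * L₂) := by
  have h := (isLipObservable_of_lipNorm_le ha.lip_deriv hL₂ hε).sub_integral hL₂ (ν ε)
  constructor
  · intro x hx y
    simp only [ha.jac_centred hL₁ hε ν hx]
    exact h.norm_le x hx y
  · intro x hx x' hx' y y'
    simp only [ha.jac_centred hL₁ hε ν hx, ha.jac_centred hL₁ hε ν hx']
    exact h.norm_sub_le x hx x' hx' y y'

lemma IsRegular.integral_jac_centred (ha : IsRegular a x₀ ε₀ L₁ L₂ L₃) (hL₁ : 0 ≤ L₁)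
    (hL₂ : 0 ≤ L₂) (hε : ε ∈ Ico 0 ε₀) (ν : ℝ → Measure M) [IsProbabilityMeasure (ν ε)]
    {x : Fin d → ℝ} (hx : x ∈ Metric.closedBall x₀ L₁) (i j : Fin d) :
    ∫ y, jac (fun x' => centred a ν ε x' y) x i j ∂(ν ε) = 0 := by
  simp only [ha.jac_centred hL₁ hε ν hx]
  have h0 : Integrable (fun y => jac (fun x' => a x' y ε) x) (ν ε) :=
    (isLipObservable_of_lipNorm_le ha.lip_deriv hL₂ hε).integrable hL₂ hx
  have h1 : Integrable (fun y => jac (fun x' => a x' y ε) x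
      - ∫ z, jac (fun x' => a x' z ε) x ∂(ν ε)) (ν ε) := h0.sub (integrable_const _)
  rw [← eval_integral fun j => (h1.eval i).eval j, ← eval_integral fun i => h1.eval i]
  exact congrFun (congrFun (integral_sub_integral_self h0) i) j

lemma rate_exponent {p : ℝ} (hp : 1 < p) : (1 - momentExponent p / p) * (p - 1)
    = if 2 < p then (p - 1) / 2 else (p - 1) ^ 2 / p := by
  have h0 : p ≠ 0 := by linarith
  split_ifs with h
  · rw [momentExponent, max_eq_left (by linarith)]
    field_simp
    norm_num
  · rw [momentExponent, max_eq_right (by linarith)]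
    field_simp

omit [MetricSpace M] [BorelSpace M] [SecondCountableTopology M] in
lemma integrable_add_rpow_of_lintegral_le {ν : Measure M} {S₁ S₂ : M → ℝ} (h₁ : Measurable S₁)
    (h₂ : Measurable S₂) (h₁0 : ∀ y, 0 ≤ S₁ y) (h₂0 : ∀ y, 0 ≤ S₂ y) {r c₁ c₂ : ℝ} (hr : 0 ≤ r)
    (hc₁0 : 0 ≤ c₁) (hc₂0 : 0 ≤ c₂)
    (hc₁ : ∫⁻ y, ENNReal.ofReal (S₁ y ^ r) ∂ν ≤ ENNReal.ofReal c₁)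
    (hc₂ : ∫⁻ y, ENNReal.ofReal (S₂ y ^ r) ∂ν ≤ ENNReal.ofReal c₂) :
    Integrable (fun y => (S₁ y + S₂ y) ^ r) ν ∧
      ∫ y, (S₁ y + S₂ y) ^ r ∂ν ≤ 2 ^ r * (c₁ + c₂) := by
  have h0 : ∀ y, 0 ≤ (S₁ y + S₂ y) ^ r := fun y =>
    Real.rpow_nonneg (add_nonneg (h₁0 y) (h₂0 y)) r
  have hm : Measurable fun y => (S₁ y + S₂ y) ^ r := (h₁.add h₂).pow_const r
  have hle : ∫⁻ y, ENNReal.ofReal ((S₁ y + S₂ y) ^ r) ∂ν ≤ ENNReal.ofReal (2 ^ r * (c₁ + c₂)) := by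
    calc _ ≤ ∫⁻ y, ENNReal.ofReal (2 ^ r) *
          (ENNReal.ofReal (S₁ y ^ r) + ENNReal.ofReal (S₂ y ^ r)) ∂ν := by
          refine lintegral_mono fun y => ?_
          have h := abs_add_rpow_le_two hr (S₁ y) (S₂ y)
          rw [abs_of_nonneg (h₁0 y), abs_of_nonneg (h₂0 y),
            abs_of_nonneg (add_nonneg (h₁0 y) (h₂0 y))] at h
          rw [← ENNReal.ofReal_add (Real.rpow_nonneg (h₁0 y) r) (Real.rpow_nonneg (h₂0 y) r),
            ← ENNReal.ofReal_mul (by positivity)]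
          exact ENNReal.ofReal_le_ofReal h
      _ = ENNReal.ofReal (2 ^ r) * (∫⁻ y, ENNReal.ofReal (S₁ y ^ r) ∂ν
            + ∫⁻ y, ENNReal.ofReal (S₂ y ^ r) ∂ν) := by
          have hm₁ := (h₁.pow_const r).ennreal_ofReal
          rw [lintegral_const_mul' _ _ ENNReal.ofReal_ne_top, lintegral_add_left hm₁]
      _ ≤ ENNReal.ofReal (2 ^ r) * (ENNReal.ofReal c₁ + ENNReal.ofReal c₂) := by gcongr
      _ = _ := by
          rw [← ENNReal.ofReal_add hc₁0 hc₂0, ← ENNReal.ofReal_mul (by positivity)]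
  have hi : Integrable (fun y => (S₁ y + S₂ y) ^ r) ν := by
    refine ⟨hm.aestronglyMeasurable, ?_⟩
    rw [hasFiniteIntegral_iff_ofReal (ae_of_all _ h0)]
    exact hle.trans_lt ENNReal.ofReal_lt_top
  refine ⟨hi, ?_⟩
  rw [← ENNReal.ofReal_le_ofReal_iff (by positivity),
    ofReal_integral_eq_lintegral_ofReal hi (ae_of_all _ h0)]
  exact hle

lemma orderSup_nonneg {M F : Type*} [NormedAddCommGroup F] (T : M → M) (w : (Fin d → ℝ) → M → F)
    (E : Set (Fin d → ℝ)) (hε : 0 ≤ ε) (y : M) : 0 ≤ orderSup T w E ε y := by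
  refine Real.sSup_nonneg ?_
  rintro _ ⟨x, -, n, -, -, rfl⟩
  positivity

end Conclusion

end FastSlow


/-! ### The theorem -/

theorem theorem4p2 {M : Type*} [MetricSpace M] [LocallyCompactSpace M]
    [TopologicalSpace.SeparableSpace M] [BoundedSpace M] [MeasurableSpace M] [BorelSpace M]
    (m : Measure M) [IsFiniteMeasure m]
    (d : ℕ) (ε₀ p L₁ L₂ L₃ : ℝ) (hε₀ : 0 < ε₀) (hp : 1 < p)
    (hL₁ : 1 ≤ L₁) (hL₂ : 1 ≤ L₂) (hL₃ : 1 ≤ L₃)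
    (T : ℝ → M → M) (hT : FastSlow.IsUniformFamily m T ε₀ p)
    (ν : ℝ → Measure M)
    (hν : ∀ ε ∈ Ico 0 ε₀, IsProbabilityMeasure (ν ε) ∧ Ergodic (T ε) (ν ε) ∧ ν ε ≪ m)
    (x₀ : Fin d → ℝ) (a : (Fin d → ℝ) → M → ℝ → (Fin d → ℝ))
    (ha : FastSlow.IsRegular a x₀ ε₀ L₁ L₂ L₃) :
    ∃ C : ℝ, 0 < C ∧ ∀ ε ∈ Ico 0 ε₀,
      Integrable (fun y => FastSlow.orderFunction a T ν (Metric.closedBall x₀ L₁) ε y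
        ^ (p + d - 1)) (ν ε) ∧
      ∫ y, FastSlow.orderFunction a T ν (Metric.closedBall x₀ L₁) ε y ^ (p + d - 1) ∂(ν ε) ≤
        if 2 < p then C * ε ^ ((p - 1) / 2) else C * ε ^ ((p - 1) ^ 2 / p) := by
  have := UniformSpace.secondCountable_of_separable M
  have := FastSlow.standardBorelSpace_of_locallyCompact M
  obtain ⟨D₀, hD₀⟩ := Metric.isBounded_iff.1 (BoundedSpace.bounded_univ (α := M))
  have hD : ∀ x y : M, dist x y ≤ max D₀ 1 := fun x y =>
    (hD₀ (mem_univ x) (mem_univ y)).trans (le_max_left _ _)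
  obtain ⟨lam, η, C₀, C₁, K, hlam, hη, hη1, hC₀, hC₁, hfam⟩ := hT
  have hL₁0 : 0 ≤ L₁ := by linarith
  have hL₂0 : 0 ≤ L₂ := by linarith
  obtain ⟨A₁, hA₁, h₁⟩ := FastSlow.exists_orderSup_moment_bound (K := K) (B := 2 * L₁) hlam hη hη1
    hC₀ hC₁ (le_max_right D₀ 1) hD hp (by linarith) hL₁0 x₀
    (ℓ := fun i : Fin d => Pi.evalAddMonoidHom (fun _ => ℝ) i)
    (fun i z => norm_le_pi_norm z i) (fun z c hc h => (pi_norm_le_iff_of_nonneg hc).2 h)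
  obtain ⟨A₂, hA₂, h₂⟩ := FastSlow.exists_orderSup_moment_bound (K := K) (B := 2 * L₂) hlam hη hη1
    hC₀ hC₁ (le_max_right D₀ 1) hD hp (by linarith) hL₁0 x₀
    (ℓ := fun ij : Fin d × Fin d => (Pi.evalAddMonoidHom (fun _ => ℝ) ij.2).comp
      (Pi.evalAddMonoidHom (fun _ => Fin d → ℝ) ij.1))
    (fun ij z => (norm_le_pi_norm (z ij.1) ij.2).trans (norm_le_pi_norm z ij.1))
    (fun z c hc h => (pi_norm_le_iff_of_nonneg hc).2 fun i =>
      (pi_norm_le_iff_of_nonneg hc).2 fun j => h (i, j))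
  refine ⟨2 ^ (p + d - 1) * (A₁ + A₂), by positivity, fun ε hε => ?_⟩
  obtain ⟨hTε, Y, α, τ, hs, hK⟩ := hfam ε hε
  obtain ⟨hprob, herg, hac⟩ := hν ε hε
  have hw₁ := ha.isLipObservable_centred hL₁0 hε ν
  have hw₂ := ha.isLipObservable_jac_centred hL₁0 hL₂0 hε ν
  have hb₁ := h₁ m (T ε) Y α τ (ν ε) hs hTε hK herg.toMeasurePreserving hac _ hw₁
    (fun x _ i => ha.integral_centred hL₁0 hε ν x i) ε hε.1
  have hb₂ := h₂ m (T ε) Y α τ (ν ε) hs hTε hK herg.toMeasurePreserving hac _ hw₂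
    (fun x hx ij => ha.integral_jac_centred hL₁0 hL₂0 hε ν hx ij.1 ij.2) ε hε.1
  have hr : p - 1 + d = p + d - 1 := by ring
  have hr0 : 0 ≤ p + d - 1 := by
    have : (0 : ℝ) ≤ d := Nat.cast_nonneg d
    linarith
  rw [hr] at hb₁ hb₂
  have he : 0 ≤ ε ^ ((1 - FastSlow.momentExponent p / p) * (p - 1)) := Real.rpow_nonneg hε.1 _
  -- `order₁` and `order₂` unfold to `orderSup` of the centred field and of its Jacobian, so the sum
  -- bounded here is the order function by definition.
  have hmain := FastSlow.integrable_add_rpow_of_lintegral_le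
    (hw₁.measurable_orderSup (by linarith) hL₁0 hε.1 hTε.measurable)
    (hw₂.measurable_orderSup (by linarith) hL₁0 hε.1 hTε.measurable)
    (FastSlow.orderSup_nonneg _ _ _ hε.1) (FastSlow.orderSup_nonneg _ _ _ hε.1) hr0
    (mul_nonneg hA₁.le he) (mul_nonneg hA₂.le he) hb₁ hb₂
  refine ⟨hmain.1, hmain.2.trans (le_of_eq ?_)⟩
  rw [FastSlow.rate_exponent hp]
  split_ifs <;> ring
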